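/- Let $q\ge 2$ be an integer, let $H\in(1-\frac1{2q},1)$, and let $B=(B_t)_{t\ge0}$ be a fractional Brownian motion with Hurst index $H$, that is, a centered Gaussian process started from zero with covariance $E[B_sB_t]=R(s,t)=\frac12(t^{2H}+s^{2H}-|t-s|^{2H})$. Let $\mathfrak H$ be the Hilbert space obtained by completing the step functions on $[0,1]$ for the scalar product determined by $\langle \mathbf 1_{[0,s]},\mathbf 1_{[0,t]}\rangle_{\mathfrak H}=R(s,t)$, and let $h\mapsto B(h)$ be the isonormal process on $\mathfrak H$ with $B(\mathbf 1_{[0,t]})=B_t$. Let $\mathfrak H^{\odot q}\subset\mathfrak H^{\otimes q}$ be the symmetric tensor power, with the norm $\|g\|_{\mathfrak H^{\odot q}}=\sqrt{q!}\,\|g\|_{\mathfrak H^{\otimes q}}$, and let $I_q:\mathfrak H^{\odot q}\to L^2$ be the $q$th multiple Wiener–Itô integral with respect to $B$, that is, the continuous linear map with $I_q(h^{\otimes q})=H_q(B(h))$ whenever $\|h\|_{\mathfrak H}=1$, where $H_q(x)=(-1)^qe^{x^2/2}\frac{d^q}{dx^q}e^{-x^2/2}$. For $0<s<t$ let $$K_H(t,s)=c_H\,s^{\frac12-H}\int_s^t(u-s)^{H-\frac32}u^{H-\frac12}\,du,\qquad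 c_H=\Big(\frac{H(2H-1)\,\Gamma(\frac32-H)}{\Gamma(2-2H)\,\Gamma(H-\frac12)}\Big)^{1/2},$$ so that $R(t,s)=\int_0^{s\wedge t}K_H(t,r)K_H(s,r)\,dr$, and let $K_H^*:\mathfrak H\to L^2([0,1])$ be the isometry given on step functions by $(K_H^*\varphi)(s)=K_H(1,s)\varphi(s)+\int_s^1(\varphi(r)-\varphi(s))\,\partial_1K_H(r,s)\,dr$. Let $W_t=B\big((K_H^*)^{-1}\mathbf 1_{[0,t]}\big)$, $t\in[0,1]$, be the associated Wiener process, let $I_q^W$ be the $q$th multiple Wiener–Itô integral with respect to $W$ on the symmetric functions of $L^2([0,1]^q)$ (again with $I_q^W(h^{\otimes q})=H_q(\int_0^1h\,dW)$ for $\|h\|_{L^2}=1$), and let $Z=I_q^W(L_1)$ be the Hermite random variable with kernel $$L_1(y_1,\dots,y_q)=\mathbf 1_{[0,1]^q}(y_1,\dots,y_q)\int_{y_1\vee\dots\vee y_q}^1\partial_1K_H(u,y_1)\cdots\partial_1K_H(u,y_q)\,du .$$ For $n\ge1$ put $$f_n=n^{q-1}\sum_{k=0}^{n-1}\mathbf 1_{[k/n,(k+1)/n]}^{\otimes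 q},\quad S_n=n^{q(1-H)-1}\sum_{k=0}^{n-1}H_q\big(n^H(B_{(k+1)/n}-B_{k/n})\big),\quad Z_n=n^{-(1-q(1-H))}\sum_{k=0}^{n-1}H_q(B_{k+1}-B_k).$$ Then the multiple integrals $I_q$ and $I_q^W$ exist and $L_1\in L^2([0,1]^q)$. For every $n\ge1$ we have $f_n\in\mathfrak H^{\odot q}$, and $S_n=I_q(f_n)$ almost surely has the same law as $Z_n$. The sequence $(f_n)$ converges in $\mathfrak H^{\odot q}$ to a limit $f$, we have $Z=I_q(f)$ almost surely, for every $n\ge1$ $$E|S_n-Z|^2=E|I_q(f_n)-I_q(f)|^2=\|f_n-f\|^2_{\mathfrak H^{\odot q}},$$ and $$\|f_n-f\|^2_{\mathfrak H^{\odot q}}=O\big(n^{2q-1-2qH}\big)\qquad\text{as }n\to\infty .$$ -/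

import Mathlib

open MeasureTheory Set ProbabilityTheory Filter Topology Asymptotics
open scoped NNReal

namespace FBM

noncomputable section

/-! ### The covariance of fractional Brownian motion and its positivity -/

/-- The covariance `R(s,t) = (t^{2H} + s^{2H} - |t-s|^{2H}) / 2` of fractional Brownian motion. -/
def fbmCov (H s t : ℝ) : ℝ := (t ^ (2 * H) + s ^ (2 * H) - |t - s| ^ (2 * H)) / 2

/-- Auxiliary, for the proof that `R` is positive semidefinite: `R(s,t)` is, up to a positive factor,
`∫_0^∞ ((1 - cos sx)(1 - cos tx) + sin sx sin tx) x^{-1-2H} dx`. -/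
def osc (H x : ℝ) : ℝ := (1 - Real.cos x) * x ^ (-1 - 2 * H)

theorem osc_nonneg (H : ℝ) {x : ℝ} (hx : 0 < x) : 0 ≤ osc H x :=
  mul_nonneg (by linarith [Real.cos_le_one x]) (Real.rpow_nonneg hx.le _)

theorem osc_integrable {H : ℝ} (h0 : 0 < H) (h1 : H < 1) : IntegrableOn (osc H) (Ioi 0) := by
  have hmeas : Measurable (osc H) := by unfold osc; fun_prop
  rw [← Ioc_union_Ioi_eq_Ioi (zero_le_one' ℝ)]
  refine IntegrableOn.union ?_ ?_
  · have hi : IntegrableOn (fun x : ℝ => x ^ (1 - 2 * H)) (Ioc 0 1) :=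
      (intervalIntegrable_iff_integrableOn_Ioc_of_le zero_le_one).1
        (intervalIntegral.intervalIntegrable_rpow' (by linarith))
    refine hi.mono' hmeas.aestronglyMeasurable ?_
    filter_upwards [ae_restrict_mem measurableSet_Ioc] with x hx
    rw [Real.norm_of_nonneg (osc_nonneg H hx.1), osc]
    have e : x ^ (1 - 2 * H) = x ^ 2 * x ^ (-1 - 2 * H) := by
      rw [← Real.rpow_natCast, ← Real.rpow_add hx.1]; congr 1; push_cast; ring
    rw [e]
    have := Real.rpow_nonneg hx.1.le (-1 - 2 * H)
    have := Real.one_sub_sq_div_two_le_cos (x := x)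
    gcongr
    nlinarith [sq_nonneg x]
  · have hi : IntegrableOn (fun x : ℝ => 2 * x ^ (-1 - 2 * H)) (Ioi 1) :=
      (integrableOn_Ioi_rpow_of_lt (by linarith) zero_lt_one).const_mul 2
    refine hi.mono' hmeas.aestronglyMeasurable ?_
    filter_upwards [ae_restrict_mem measurableSet_Ioi] with x hx
    have hx0 : 0 < x := zero_lt_one.trans hx
    rw [Real.norm_of_nonneg (osc_nonneg H hx0), osc]
    have := Real.rpow_nonneg hx0.le (-1 - 2 * H)
    gcongr
    linarith [Real.neg_one_le_cos x]

theorem osc_integral_pos {H : ℝ} (h0 : 0 < H) (h1 : H < 1) : 0 < ∫ x in Ioi 0, osc H x := by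
  refine (setIntegral_pos_iff_support_of_nonneg_ae ?_ (osc_integrable h0 h1)).2 ?_
  · filter_upwards [ae_restrict_mem measurableSet_Ioi] with x hx using osc_nonneg H hx
  · have hsub : Ioo (0 : ℝ) 1 ⊆ Function.support (osc H) ∩ Ioi 0 := by
      intro x hx
      refine ⟨?_, hx.1⟩
      have hc : Real.cos x < 1 := by
        have := Real.cos_lt_cos_of_nonneg_of_le_pi le_rfl (by linarith [Real.pi_gt_three, hx.2]) hx.1
        simpa using this
      exact (mul_pos (by linarith) (Real.rpow_pos_of_pos hx.1 _)).ne'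
    refine lt_of_lt_of_le ?_ (measure_mono hsub)
    simp

theorem osc_scale_eq {H t x : ℝ} (ht : 0 < t) (hx : 0 < x) :
    (1 - Real.cos (t * x)) * x ^ (-1 - 2 * H) = t ^ (1 + 2 * H) * osc H (t * x) := by
  rw [osc, Real.mul_rpow ht.le hx.le]
  have : t ^ (1 + 2 * H) * t ^ (-1 - 2 * H) = 1 := by
    rw [← Real.rpow_add ht]; ring_nf; simp
  linear_combination (-(1 - Real.cos (t * x)) * x ^ (-1 - 2 * H)) * this

theorem osc_scaled {H : ℝ} (h0 : 0 < H) (h1 : H < 1) (t : ℝ) :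
    IntegrableOn (fun x => (1 - Real.cos (t * x)) * x ^ (-1 - 2 * H)) (Ioi 0) ∧
      ∫ x in Ioi 0, (1 - Real.cos (t * x)) * x ^ (-1 - 2 * H) =
        |t| ^ (2 * H) * ∫ x in Ioi 0, osc H x := by
  wlog ht : 0 < t generalizing t
  · rcases (not_lt.1 ht).lt_or_eq with h | h
    · simpa [Real.cos_neg] using this (-t) (by linarith)
    · subst h; simp [Real.zero_rpow (by linarith : 2 * H ≠ 0)]
  have hc : EqOn (fun x => (1 - Real.cos (t * x)) * x ^ (-1 - 2 * H))
      (fun x => t ^ (1 + 2 * H) * osc H (t * x)) (Ioi 0) := fun x hx => osc_scale_eq ht hx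
  constructor
  · rw [integrableOn_congr_fun hc measurableSet_Ioi]
    have := (integrableOn_Ioi_comp_mul_left_iff (osc H) 0 ht).2
      (by simpa using osc_integrable h0 h1)
    exact this.const_mul _
  · rw [setIntegral_congr_fun measurableSet_Ioi hc, integral_const_mul,
      integral_comp_mul_left_Ioi _ _ ht, mul_zero, abs_of_pos ht, smul_eq_mul, ← mul_assoc]
    congr 1
    rw [add_comm, Real.rpow_add ht, Real.rpow_one]
    field_simp

theorem fbmCov_posSemidef {H : ℝ} (h0 : 0 < H) (h1 : H < 1) {ι : Type*} (s : Finset ι)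
    (τ : ι → ℝ) (hτ : ∀ i, 0 ≤ τ i) (a : ι → ℝ) :
    0 ≤ ∑ u ∈ s, ∑ v ∈ s, a u * (a v * fbmCov H (τ u) (τ v)) := by
  have key : (∑ u ∈ s, ∑ v ∈ s, a u * (a v * fbmCov H (τ u) (τ v))) * (2 * ∫ x in Ioi 0, osc H x) =
      ∫ x in Ioi 0, ((∑ u ∈ s, a u * (1 - Real.cos (τ u * x))) ^ 2 +
        (∑ u ∈ s, a u * Real.sin (τ u * x)) ^ 2) * x ^ (-1 - 2 * H) := by
    have hI : ∀ u v : ι, IntegrableOn (fun x => a u * a v *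
        ((1 - Real.cos (τ v * x)) * x ^ (-1 - 2 * H) + (1 - Real.cos (τ u * x)) * x ^ (-1 - 2 * H)
          - (1 - Real.cos ((τ v - τ u) * x)) * x ^ (-1 - 2 * H))) (Ioi 0) := fun u v =>
      ((((osc_scaled h0 h1 (τ v)).1.add (osc_scaled h0 h1 (τ u)).1).sub
        (osc_scaled h0 h1 (τ v - τ u)).1).const_mul (a u * a v))
    have hA : ∀ u v : ι, IntegrableOn (fun x => (1 - Real.cos (τ v * x)) * x ^ (-1 - 2 * H) +
        (1 - Real.cos (τ u * x)) * x ^ (-1 - 2 * H)) (Ioi 0) := fun u v =>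
      (osc_scaled h0 h1 (τ v)).1.add (osc_scaled h0 h1 (τ u)).1
    have hR : ∀ u v, a u * (a v * fbmCov H (τ u) (τ v)) * (2 * ∫ x in Ioi 0, osc H x) =
        ∫ x in Ioi 0, a u * a v *
        ((1 - Real.cos (τ v * x)) * x ^ (-1 - 2 * H) + (1 - Real.cos (τ u * x)) * x ^ (-1 - 2 * H)
          - (1 - Real.cos ((τ v - τ u) * x)) * x ^ (-1 - 2 * H)) := by
      intro u v
      rw [integral_const_mul, integral_sub (hA u v)
        (osc_scaled h0 h1 (τ v - τ u)).1, integral_add (osc_scaled h0 h1 (τ v)).1 (osc_scaled h0 h1 (τ u)).1,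
        (osc_scaled h0 h1 (τ v)).2, (osc_scaled h0 h1 (τ u)).2, (osc_scaled h0 h1 (τ v - τ u)).2, fbmCov,
        abs_of_nonneg (hτ u), abs_of_nonneg (hτ v)]
      ring
    rw [Finset.sum_mul]
    simp_rw [Finset.sum_mul]
    rw [Finset.sum_congr rfl fun u _ => Finset.sum_congr rfl fun v _ => hR u v]
    rw [Finset.sum_congr rfl fun u _ => (integral_finsetSum s fun v _ => hI u v).symm,
      ← integral_finsetSum s fun u _ => integrable_finsetSum s fun v _ => hI u v]
    congr 1
    ext x
    rw [sq, sq, Finset.sum_mul_sum, Finset.sum_mul_sum, ← Finset.sum_add_distrib, Finset.sum_mul]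
    refine Finset.sum_congr rfl fun u _ => ?_
    rw [← Finset.sum_add_distrib, Finset.sum_mul]
    refine Finset.sum_congr rfl fun v _ => ?_
    rw [sub_mul (τ v) (τ u) x, Real.cos_sub]
    ring
  have hpos : 0 < 2 * ∫ x in Ioi 0, osc H x := by linarith [osc_integral_pos h0 h1]
  refine nonneg_of_mul_nonneg_left (b := 2 * ∫ x in Ioi 0, osc H x) ?_ hpos
  rw [key]
  refine setIntegral_nonneg measurableSet_Ioi fun x hx => ?_
  exact mul_nonneg (by positivity) (Real.rpow_nonneg (le_of_lt hx) _)

/-! ### The Hilbert space of fractional Brownian motion on `[0,1]` -/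

/-- The step function `1_{[0,t]}`, for `t ∈ [0,1]`. -/
def stepInd (t : Icc (0 : ℝ) 1) : ℝ → ℝ := (Icc (0 : ℝ) t).indicator 1

theorem linearIndependent_stepInd : LinearIndependent ℝ stepInd := by
  rw [linearIndependent_iff]
  intro l hl
  by_contra hne
  have hs : l.support.Nonempty := Finsupp.support_nonempty_iff.2 hne
  set m := l.support.max' hs with hm
  have hmem : m ∈ l.support := l.support.max'_mem hs
  have h := congrFun hl (m : ℝ)
  rw [Finsupp.linearCombination_apply, Finsupp.sum, Finset.sum_apply,
    Finset.sum_eq_single_of_mem m hmem] at h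
  · simp [stepInd, m.2.1] at h
    exact (Finsupp.mem_support_iff.1 hmem) h
  · intro t ht htm
    have hlt : (t : ℝ) < m := lt_of_le_of_ne (l.support.le_max' t ht) (fun e => htm (Subtype.ext e))
    simp [stepInd, (show t < m from hlt)]

/-- The step functions on `[0,1]`: the linear span of the functions `1_{[0,t]}`, `t ∈ [0,1]`.
The type carries `H` because its inner product depends on `H`. -/
def StepFun (_H : Ioo (0 : ℝ) 1) : Type := Submodule.span ℝ (range stepInd)

instance (H : Ioo (0 : ℝ) 1) : AddCommGroup (StepFun H) :=
  inferInstanceAs (AddCommGroup (Submodule.span ℝ (range stepInd)))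

instance (H : Ioo (0 : ℝ) 1) : Module ℝ (StepFun H) :=
  inferInstanceAs (Module ℝ (Submodule.span ℝ (range stepInd)))

/-- The functions `1_{[0,t]}` as a basis of the space of step functions. -/
def stepBasis (H : Ioo (0 : ℝ) 1) : Module.Basis (Icc (0 : ℝ) 1) ℝ (StepFun H) :=
  Module.Basis.span linearIndependent_stepInd

/-- The bilinear form on step functions with `⟨1_{[0,s]}, 1_{[0,t]}⟩ = R(s,t)`. -/
def stepForm (H : Ioo (0 : ℝ) 1) : StepFun H →ₗ[ℝ] StepFun H →ₗ[ℝ] ℝ :=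
  (stepBasis H).constr ℝ fun s => (stepBasis H).constr ℝ fun t => fbmCov H s t

theorem fbmCov_comm (H s t : ℝ) : fbmCov H s t = fbmCov H t s := by
  rw [fbmCov, fbmCov, abs_sub_comm]; ring

instance (H : Ioo (0 : ℝ) 1) : PreInnerProductSpace.Core ℝ (StepFun H) where
  inner φ ψ := stepForm H φ ψ
  conj_inner_symm φ ψ := by
    have h : (stepForm H).flip = stepForm H := by
      refine (stepBasis H).ext fun s => (stepBasis H).ext fun t => ?_
      simp only [LinearMap.flip_apply, stepForm, Module.Basis.constr_basis]
      exact fbmCov_comm _ _ _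
    exact LinearMap.congr_fun₂ h φ ψ
  re_inner_nonneg φ := by
    have h := fbmCov_posSemidef H.2.1 H.2.2 ((stepBasis H).repr φ).support
      (fun t : Icc (0 : ℝ) 1 => (t : ℝ)) (fun t => t.2.1) ((stepBasis H).repr φ)
    simpa [stepForm, Module.Basis.constr_apply, Finsupp.sum, Finset.mul_sum] using h
  add_left _ _ _ := by simp
  smul_left _ _ _ := by simp

instance (H : Ioo (0 : ℝ) 1) : SeminormedAddCommGroup (StepFun H) :=
  InnerProductSpace.Core.toSeminormedAddCommGroup (𝕜 := ℝ)

instance (H : Ioo (0 : ℝ) 1) : InnerProductSpace ℝ (StepFun H) := .ofCore _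

/-- The Hilbert space of fractional Brownian motion on `[0,1]`: the (separated) completion of the
step functions for the scalar product `⟨1_{[0,s]}, 1_{[0,t]}⟩ = R(s,t)`. -/
abbrev FBMSpace (H : Ioo (0 : ℝ) 1) : Type := UniformSpace.Completion (StepFun H)

/-- `1_{[0,t]}` as an element of the Hilbert space. -/
def ind (H : Ioo (0 : ℝ) 1) (t : Icc (0 : ℝ) 1) : FBMSpace H :=
  ((stepBasis H t : StepFun H) : FBMSpace H)

theorem inner_ind (H : Ioo (0 : ℝ) 1) (s t : Icc (0 : ℝ) 1) :
    inner ℝ (ind H s) (ind H t) = fbmCov H s t := by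
  rw [ind, ind, UniformSpace.Completion.inner_coe]
  change stepForm H _ _ = _
  simp [stepForm]

/-! ### Hilbert tensor powers -/

section Tensor

open TensorProduct

variable (E : Type*) [NormedAddCommGroup E] [InnerProductSpace ℝ E] (q : ℕ)

/-- The algebraic tensor power, with the inner product determined by
`⟨x₁ ⊗ ⋯ ⊗ x_q, y₁ ⊗ ⋯ ⊗ y_q⟩ = ∏ ⟨x_i, y_i⟩`. -/
def PreTensorPower : Type _ := ⨂[ℝ] _ : Fin q, E

instance : AddCommGroup (PreTensorPower E q) :=
  inferInstanceAs (AddCommGroup (⨂[ℝ] _ : Fin q, E))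

instance : Module ℝ (PreTensorPower E q) :=
  inferInstanceAs (Module ℝ (⨂[ℝ] _ : Fin q, E))

/-- The bilinear form with `⟨x₁ ⊗ ⋯ ⊗ x_q, y₁ ⊗ ⋯ ⊗ y_q⟩ = ∏ ⟨x_i, y_i⟩`. -/
def tensorForm : (⨂[ℝ] _ : Fin q, E) →ₗ[ℝ] (⨂[ℝ] _ : Fin q, E) →ₗ[ℝ] ℝ :=
  PiTensorProduct.dualDistrib ∘ₗ PiTensorProduct.map fun _ => innerₗ E

theorem tensorForm_tprod (x y : Fin q → E) :
    tensorForm E q (PiTensorProduct.tprod ℝ x) (PiTensorProduct.tprod ℝ y) =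
      ∏ i, inner ℝ (x i) (y i) := by
  simp [tensorForm]

theorem posSemidef_prod_inner (s : Finset (Fin q)) :
    (Matrix.of fun x y : Fin q → E => ∏ i ∈ s, inner ℝ (x i) (y i)).PosSemidef := by
  classical
  induction s using Finset.induction_on with
  | empty =>
    refine ⟨by ext; simp, fun c => ?_⟩
    simp only [Finset.prod_empty, Matrix.of_apply, star_trivial, mul_one, Finsupp.sum]
    rw [← Finset.sum_mul_sum]
    exact mul_self_nonneg _
  | insert i s hi ih =>
    have hg : (Matrix.of fun x y : Fin q → E => inner ℝ (x i) (y i)).PosSemidef := by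
      refine ⟨by ext x y; simp [real_inner_comm], fun c => ?_⟩
      have h0 : 0 ≤ inner ℝ (∑ x ∈ c.support, c x • x i) (∑ x ∈ c.support, c x • x i) :=
        real_inner_self_nonneg
      simp only [sum_inner, inner_sum, real_inner_smul_left, real_inner_smul_right] at h0
      simp only [Matrix.of_apply, star_trivial, Finsupp.sum]
      refine h0.trans_eq (Finset.sum_congr rfl fun x _ => Finset.sum_congr rfl fun y _ => ?_)
      rw [real_inner_comm]; ring
    have e : (Matrix.of fun x y : Fin q → E => ∏ j ∈ insert i s, inner ℝ (x j) (y j)) =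
        Matrix.hadamard (Matrix.of fun x y : Fin q → E => inner ℝ (x i) (y i))
          (Matrix.of fun x y : Fin q → E => ∏ j ∈ s, inner ℝ (x j) (y j)) := by
      ext x y
      simp [Finset.prod_insert hi, Matrix.hadamard]
    rw [e]
    exact hg.hadamard ih

theorem tensorForm_comm (x y : ⨂[ℝ] _ : Fin q, E) : tensorForm E q y x = tensorForm E q x y := by
  have h : (tensorForm E q).flip = tensorForm E q := by
    refine PiTensorProduct.ext (MultilinearMap.ext fun x => PiTensorProduct.ext
      (MultilinearMap.ext fun y => ?_))
    simp only [LinearMap.compMultilinearMap_apply, LinearMap.flip_apply, tensorForm_tprod]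
    exact Finset.prod_congr rfl fun i _ => real_inner_comm _ _
  exact LinearMap.congr_fun₂ h x y

theorem tensorForm_nonneg (x : ⨂[ℝ] _ : Fin q, E) : 0 ≤ tensorForm E q x x := by
  have hx : x ∈ Submodule.span ℝ (range (PiTensorProduct.tprod ℝ (s := fun _ : Fin q => E))) := by
    rw [PiTensorProduct.span_tprod_eq_top]; trivial
  obtain ⟨c, rfl⟩ := Finsupp.mem_span_range_iff_exists_finsupp.1 hx
  refine ((posSemidef_prod_inner E q Finset.univ).2 c).trans_eq ?_
  simp only [Finsupp.sum, map_sum, map_smul, LinearMap.sum_apply, LinearMap.smul_apply,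
    tensorForm_tprod, smul_eq_mul, star_trivial, Finset.mul_sum, Matrix.of_apply]
  rw [Finset.sum_comm]
  exact Finset.sum_congr rfl fun _ _ => Finset.sum_congr rfl fun _ _ => by ring

instance : PreInnerProductSpace.Core ℝ (PreTensorPower E q) where
  inner x y := tensorForm E q x y
  conj_inner_symm x y := tensorForm_comm E q x y
  re_inner_nonneg x := tensorForm_nonneg E q x
  add_left x y z := LinearMap.map_add₂ (tensorForm E q) x y z
  smul_left x y r := LinearMap.map_smul₂ (tensorForm E q) r x y

instance : SeminormedAddCommGroup (PreTensorPower E q) :=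
  InnerProductSpace.Core.toSeminormedAddCommGroup (𝕜 := ℝ)

instance : InnerProductSpace ℝ (PreTensorPower E q) := .ofCore _

/-- The Hilbert space tensor power `E^{⊗q}`. -/
abbrev TensorPower : Type _ := UniformSpace.Completion (PreTensorPower E q)

variable {E} in
/-- `h^{⊗q}` in the algebraic tensor power. -/
def preTpow (h : E) : PreTensorPower E q := PiTensorProduct.tprod ℝ (fun _ : Fin q => h)

variable {E} in
/-- `h^{⊗q}` in the Hilbert space tensor power. -/
def tpow (h : E) : TensorPower E q := (preTpow q h : TensorPower E q)

theorem inner_tpow (g h : E) : inner ℝ (tpow q g) (tpow q h) = (inner ℝ g h) ^ q := by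
  rw [tpow, tpow, UniformSpace.Completion.inner_coe]
  change tensorForm E q _ _ = _
  rw [preTpow, preTpow, tensorForm_tprod]
  simp

/-- The symmetric tensor power `E^{⊙q}`, as a closed subspace of `E^{⊗q}`: the closed linear span of
the powers `h^{⊗q}` (by polarization these span the symmetric tensors). -/
def symTensorPower : Submodule ℝ (TensorPower E q) :=
  (Submodule.span ℝ (range (tpow q : E → TensorPower E q))).topologicalClosure

variable {E} in
/-- The norm `‖g‖_{E^{⊙q}} = √(q!) ‖g‖_{E^{⊗q}}` used on `E^{⊙q}`, for which multiple Wiener-Itô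
integrals are isometries. -/
def symNorm (g : TensorPower E q) : ℝ := √(q.factorial : ℝ) * ‖g‖

end Tensor

/-! ### Continuous linear maps determined by their values on a family -/

section Extension

variable {ι E F : Type*} [NormedAddCommGroup E] [InnerProductSpace ℝ E]
  [NormedAddCommGroup F] [NormedSpace ℝ F]

/-- `T` is the continuous linear map with `T (u i) = v i` that vanishes on the orthogonal
complement of the `u i`. -/
def IsExtension (u : ι → E) (v : ι → F) (T : E →L[ℝ] F) : Prop :=
  (∀ i, T (u i) = v i) ∧ ∀ x ∈ (Submodule.span ℝ (range u))ᗮ, T x = 0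

theorem IsExtension.unique [CompleteSpace E] {u : ι → E} {v : ι → F} {T T' : E →L[ℝ] F}
    (h : IsExtension u v T) (h' : IsExtension u v T') : T = T' := by
  have h1 : Submodule.span ℝ (range u) ≤ (T - T').ker := by
    rw [Submodule.span_le]
    rintro _ ⟨i, rfl⟩
    simp [h.1 i, h'.1 i]
  have h2 : (Submodule.span ℝ (range u)).topologicalClosure ≤ (T - T').ker :=
    Submodule.topologicalClosure_minimal _ h1 (T - T').isClosed_ker
  have h3 : ((Submodule.span ℝ (range u)).topologicalClosure)ᗮ ≤ (T - T').ker := by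
    intro x hx
    rw [Submodule.orthogonal_closure] at hx
    simp [h.2 x hx, h'.2 x hx]
  have h4 : (⊤ : Submodule ℝ E) ≤ (T - T').ker := by
    have : CompleteSpace (Submodule.span ℝ (range u)).topologicalClosure :=
      (Submodule.isClosed_topologicalClosure _).completeSpace_coe
    rw [← Submodule.sup_orthogonal_of_hasOrthogonalProjection
      (K := (Submodule.span ℝ (range u)).topologicalClosure)]
    exact sup_le h2 h3
  ext x
  have := h4 (Submodule.mem_top (x := x))
  simpa [sub_eq_zero] using this

open Classical in
/-- The unique `T` with `IsExtension u v T` (and `0` if there is none). -/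
def extension (u : ι → E) (v : ι → F) : E →L[ℝ] F :=
  if h : ∃ T, IsExtension u v T then h.choose else 0

end Extension

open Classical in
/-- The class of `f` in `L²(μ)` (and `0` if `f` is not square integrable). -/
def toL2 {α : Type*} {mα : MeasurableSpace α} (μ : Measure α) (f : α → ℝ) : Lp ℝ 2 μ :=
  if h : MemLp f 2 μ then h.toLp f else 0

/-! ### Fractional Brownian motion, the isonormal process and multiple integrals -/

section Probability

variable {Ω : Type*} {mΩ : MeasurableSpace Ω}

/-- `B` is a fractional Brownian motion on `[0,∞)` with Hurst index `H`: a centered Gaussian process,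
started from zero, with covariance `R`. -/
structure IsFBM (H : ℝ) (B : ℝ≥0 → Ω → ℝ) (P : Measure Ω) : Prop where
  isGaussianProcess : IsGaussianProcess B P
  start : ∀ᵐ ω ∂P, B 0 ω = 0
  centered : ∀ t, ∫ ω, B t ω ∂P = 0
  covariance : ∀ s t, ∫ ω, B s ω * B t ω ∂P = fbmCov H s t

/-- The isonormal process `h ↦ B(h) ∈ L²(P)`, determined by `B(1_{[0,t]}) = B_t`. -/
def isonormal (H : Ioo (0 : ℝ) 1) (P : Measure Ω) (B : ℝ≥0 → Ω → ℝ) :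
    FBMSpace H →L[ℝ] Lp ℝ 2 P :=
  extension (ind H) fun t => toL2 P (B ⟨t, t.2.1⟩)

/-- The Hermite polynomial `H_q(x) = (-1)^q e^{x²/2} (d/dx)^q e^{-x²/2}`. -/
def hermiteFun (q : ℕ) (x : ℝ) : ℝ := Polynomial.aeval x (Polynomial.hermite q)

variable {E T : Type*} [NormedAddCommGroup E] [NormedAddCommGroup T] [InnerProductSpace ℝ T]

/-- `I` is the `q`-th multiple Wiener-Itô integral with respect to the isonormal process
`X : E → L²(P)`: the continuous linear map with `I(h^{⊗q}) = H_q(X(h))` whenever `‖h‖ = 1`. Here `T`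
is the Hilbert space in which the tensor power is realized and `pow h = h^{⊗q}`. As usual, `I` is
defined on all tensors through `I(g) = I(sym g)`, that is, it vanishes on the orthogonal complement
of the symmetric tensors. -/
def IsMultipleIntegral {P : Measure Ω} (q : ℕ) (pow : E → T) (X : E → Lp ℝ 2 P)
    (I : T →L[ℝ] Lp ℝ 2 P) : Prop :=
  IsExtension (fun h : Metric.sphere (0 : E) 1 => pow h)
    (fun h => toL2 P fun ω => hermiteFun q (X h ω)) I

/-- The multiple Wiener-Itô integral: the unique `I` with `IsMultipleIntegral q pow X I`. -/
def multipleIntegral {P : Measure Ω} (q : ℕ) (pow : E → T) (X : E → Lp ℝ 2 P) :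
    T →L[ℝ] Lp ℝ 2 P :=
  extension (fun h : Metric.sphere (0 : E) 1 => pow h)
    (fun h => toL2 P fun ω => hermiteFun q (X h ω))

/-- The multiple integral `I_q` with respect to `B`, on the tensor power of the Hilbert space of
fractional Brownian motion. -/
def fbmIntegral (H : Ioo (0 : ℝ) 1) (q : ℕ) (P : Measure Ω) (B : ℝ≥0 → Ω → ℝ) :
    TensorPower (FBMSpace H) q →L[ℝ] Lp ℝ 2 P :=
  multipleIntegral q (tpow q) (isonormal H P B)

/-- `f_n = n^{q-1} ∑_{k<n} 1_{[k/n,(k+1)/n]}^{⊗q}`. -/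
def kernelSeq (H : Ioo (0 : ℝ) 1) (q n : ℕ) : TensorPower (FBMSpace H) q :=
  (n : ℝ) ^ (q - 1) • ∑ k ∈ Finset.range n,
    tpow q (ind H (projIcc 0 1 zero_le_one (((k : ℝ) + 1) / n)) -
      ind H (projIcc 0 1 zero_le_one ((k : ℝ) / n)))

/-- `S_n = n^{q(1-H)-1} ∑_{k<n} H_q(n^H (B_{(k+1)/n} - B_{k/n}))`. -/
def S (H : ℝ) (q : ℕ) (B : ℝ≥0 → Ω → ℝ) (n : ℕ) (ω : Ω) : ℝ :=
  (n : ℝ) ^ (q * (1 - H) - 1) * ∑ k ∈ Finset.range n,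
    hermiteFun q ((n : ℝ) ^ H * (B (((k : ℝ≥0) + 1) / n) ω - B ((k : ℝ≥0) / n) ω))

/-- `Z_n = n^{-(1-q(1-H))} ∑_{k<n} H_q(B_{k+1} - B_k)`. -/
def hermiteVariation (H : ℝ) (q : ℕ) (B : ℝ≥0 → Ω → ℝ) (n : ℕ) (ω : Ω) : ℝ :=
  (∑ k ∈ Finset.range n, hermiteFun q (B ((k : ℝ≥0) + 1) ω - B (k : ℝ≥0) ω)) /
    (n : ℝ) ^ (1 - q * (1 - H))

/-! ### The Hermite random variable -/

/-- The kernel `K_H`, for `H > 1/2`: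
`K_H(t,s) = c_H s^{1/2-H} ∫_s^t (u-s)^{H-3/2} u^{H-1/2} du` for `0 < s < t`, where
`c_H² = H(2H-1)/β(2-2H, H-1/2)`. It equals
`c_H (H-1/2)⁻¹ (t-s)^{H-1/2} F(H-1/2, 1/2-H, H+1/2, 1-t/s)`, with the normalization for which
`R(t,s) = ∫_0^{s∧t} K_H(t,r) K_H(s,r) dr`. -/
def kernelK (H t s : ℝ) : ℝ :=
  if s < t then
    √(H * (2 * H - 1) * Real.Gamma (3 / 2 - H) / (Real.Gamma (2 - 2 * H) * Real.Gamma (H - 1 / 2))) *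
      s ^ (1 / 2 - H) * ∫ u in s..t, (u - s) ^ (H - 3 / 2) * u ^ (H - 1 / 2)
  else 0

/-- The partial derivative `∂₁K_H(t,s)`. -/
def derivK (H t s : ℝ) : ℝ := deriv (fun r => kernelK H r s) t

/-- Lebesgue measure on `[0,1]`. -/
def unitMeasure : Measure ℝ := volume.restrict (Icc 0 1)

/-- `(K_H^* φ)(s) = K_H(1,s) φ(s) + ∫_s^1 (φ(r) - φ(s)) ∂₁K_H(r,s) dr`, for a step function `φ`. -/
def starFun (H : ℝ) (φ : ℝ → ℝ) (s : ℝ) : ℝ :=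
  kernelK H 1 s * φ s + ∫ r in s..1, (φ r - φ s) * derivK H r s

/-- The isometry `K_H^*` from the Hilbert space of fractional Brownian motion to `L²([0,1])`. -/
def Kstar (H : Ioo (0 : ℝ) 1) : FBMSpace H →L[ℝ] Lp ℝ 2 unitMeasure :=
  extension (ind H) fun t => toL2 unitMeasure (starFun H (stepInd t))

/-- The Wiener process `W_t = B((K_H^*)⁻¹ 1_{[0,t]})`, `t ∈ [0,1]`. -/
def wiener (H : Ioo (0 : ℝ) 1) (P : Measure Ω) (B : ℝ≥0 → Ω → ℝ) (t : Icc (0 : ℝ) 1) : Lp ℝ 2 P :=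
  isonormal H P B (Function.invFun (Kstar H) (toL2 unitMeasure (stepInd t)))

/-- The Wiener integral `h ↦ W(h) = ∫_0^1 h dW` on `L²([0,1])`, determined by `W(1_{[0,t]}) = W_t`. -/
def wienerIntegral (H : Ioo (0 : ℝ) 1) (P : Measure Ω) (B : ℝ≥0 → Ω → ℝ) :
    Lp ℝ 2 unitMeasure →L[ℝ] Lp ℝ 2 P :=
  extension (fun t : Icc (0 : ℝ) 1 => toL2 unitMeasure (stepInd t)) (wiener H P B)

/-- Lebesgue measure on `[0,1]^q`. -/
def cubeMeasure (q : ℕ) : Measure (Fin q → ℝ) := Measure.pi fun _ => unitMeasure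

/-- `h^{⊗q}(y₁, …, y_q) = h(y₁) ⋯ h(y_q)` in `L²([0,1]^q)`, for `h ∈ L²([0,1])`. -/
def powL2 (q : ℕ) (h : Lp ℝ 2 unitMeasure) : Lp ℝ 2 (cubeMeasure q) :=
  toL2 (cubeMeasure q) fun y => ∏ i, h (y i)

/-- The multiple integral `I_q^W` with respect to `W`, on `L²([0,1]^q)`. -/
def wienerMultipleIntegral (H : Ioo (0 : ℝ) 1) (q : ℕ) (P : Measure Ω) (B : ℝ≥0 → Ω → ℝ) :
    Lp ℝ 2 (cubeMeasure q) →L[ℝ] Lp ℝ 2 P :=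
  multipleIntegral q (powL2 q) (wienerIntegral H P B)

/-- The symmetric kernel
`L_1(y₁, …, y_q) = 1_{[0,1]^q}(y) ∫_{y₁ ∨ ⋯ ∨ y_q}^1 ∂₁K_H(u,y₁) ⋯ ∂₁K_H(u,y_q) du`. There is no
factor `1/q!`, since the Hermite polynomials are normalized to have leading coefficient `1`. -/
def hermiteKernel (H : ℝ) (q : ℕ) : (Fin q → ℝ) → ℝ :=
  {y | ∀ i, y i ∈ Icc (0 : ℝ) 1}.indicator
    fun y => ∫ u in (⨆ i, y i)..1, ∏ i, derivK H u (y i)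

/-- The Hermite random variable `Z = I_q^W(L_1)`. -/
def hermiteRV (H : Ioo (0 : ℝ) 1) (q : ℕ) (P : Measure Ω) (B : ℝ≥0 → Ω → ℝ) : Lp ℝ 2 P :=
  wienerMultipleIntegral H q P B (toL2 (cubeMeasure q) (hermiteKernel H q))

end Probability

end

end FBM

/-!
Through the isometry `K_H^*`, the tensor `h^{⊗q}` becomes the function `∏ᵢ (K_H^* h)(yᵢ)` in
`L²([0,1]^q)`, and `I_q` becomes `I_q^W`. The image of `f_n` is the sum over the cells
`A = (k/n,(k+1)/n]` of `n^{q-1} ∏ᵢ ∫_A ∂₁K_H(u,yᵢ) du`, while the kernel `L_1` is the sum of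
`∫_A ∏ᵢ ∂₁K_H(u,yᵢ) du`. All inner products between such functions reduce to
`∫₀^{u∧v} ∂₁K_H(u,y) ∂₁K_H(v,y) dy = H(2H-1)|u-v|^{2H-2}`. Hence the contributions of two cells at
distance `m ≥ 2` to the difference have inner product at most a constant times
`n^{2q-2-2qH} ((m-1)^{-β} - (m+1)^{-β})` with `β = q(2-2H)`. These telescope over `m`, and the
`O(n)` pairs of cells at distance at most `1` contribute at the same order `n^{2q-1-2qH}`.

The image of `K_H^*` is all of `L²([0,1])`, by Abel inversion, so that `W` is a Wiener process on
`[0,1]`. The multiple integrals exist, and are isometric up to the factor `q!`, because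
`E[H_q(X) H_q(Y)] = q! E[XY]^q` for jointly Gaussian standard variables.
-/

namespace FBM

noncomputable section

open scoped ENNReal

section Hermite

open Polynomial

local notation "γ" => gaussianReal 0 1

/-- The probabilists' Hermite polynomial with real coefficients. -/
def hermiteR (q : ℕ) : ℝ[X] := (hermite q).map (Int.castRingHom ℝ)

theorem hermiteFun_eq_eval (q : ℕ) (x : ℝ) : hermiteFun q x = (hermiteR q).eval x := by
  rw [hermiteFun, hermiteR, aeval_def, eval_map]
  rfl

theorem hermiteR_zero : hermiteR 0 = 1 := by simp [hermiteR]

theorem hermiteR_succ (q : ℕ) : hermiteR (q + 1) = X * hermiteR q - derivative (hermiteR q) := by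
  simp [hermiteR, derivative_map]

theorem derivative_hermiteR_succ (q : ℕ) :
    derivative (hermiteR (q + 1)) = ((q : ℝ) + 1) • hermiteR q := by
  induction q with
  | zero => simp [hermiteR]
  | succ q ih =>
    rw [hermiteR_succ (q + 1), derivative_sub, derivative_mul, ih, derivative_X, one_mul,
      derivative_smul, mul_smul_comm, add_sub_assoc, ← smul_sub, ← hermiteR_succ]
    push_cast
    module

theorem measurable_hermiteFun (q : ℕ) : Measurable (hermiteFun q) := by
  rw [funext (hermiteFun_eq_eval q)]
  exact (hermiteR q).continuous.measurable

theorem integrable_eval_gaussianReal (p : ℝ[X]) (m : ℝ) (v : ℝ≥0) :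
    Integrable (fun x => p.eval x) (gaussianReal m v) := by
  simp_rw [eval_eq_sum_range]
  refine integrable_finsetSum _ fun i _ => Integrable.const_mul ?_ _
  have hmoment : MemLp (id : ℝ → ℝ) i (gaussianReal m v) := mod_cast memLp_id_gaussianReal (i : ℝ≥0)
  exact hmoment.integrable_norm_pow'.mono' (by fun_prop) (by simp)

theorem memLp_eval_gaussianReal (p : ℝ[X]) (m : ℝ) (v : ℝ≥0) :
    MemLp (fun x => p.eval x) 2 (gaussianReal m v) := by
  rw [memLp_two_iff_integrable_sq p.continuous.aestronglyMeasurable]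
  simp_rw [← eval_pow]
  exact integrable_eval_gaussianReal (p ^ 2) m v

theorem integrable_gaussianReal_iff (f : ℝ → ℝ) (m : ℝ) {v : ℝ≥0} (hv : v ≠ 0) :
    Integrable f (gaussianReal m v) ↔ Integrable fun x => gaussianPDFReal m v x * f x := by
  rw [gaussianReal_of_var_ne_zero m hv, integrable_withDensity_iff_integrable_smul'
    (measurable_gaussianPDF m v) (Eventually.of_forall fun _ => gaussianPDF_lt_top)]
  simp [toReal_gaussianPDF]

theorem hasDerivAt_gaussianPDFReal (x : ℝ) :
    HasDerivAt (gaussianPDFReal 0 1) (-x * gaussianPDFReal 0 1 x) x := by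
  have hpdf : gaussianPDFReal 0 1 = fun x => (√(2 * Real.pi))⁻¹ * Real.exp (-(x ^ 2 / 2)) := by
    ext x; simp [gaussianPDFReal, neg_div]
  rw [hpdf]
  have hexponent : HasDerivAt (fun x : ℝ => -(x ^ 2 / 2)) (-x) x :=
    ((hasDerivAt_pow 2 x).div_const 2).fun_neg.congr_deriv (by simp)
  exact (hexponent.exp.const_mul (√(2 * Real.pi))⁻¹).congr_deriv (by ring)

theorem integral_eval_X_mul_sub_derivative (p : ℝ[X]) :
    ∫ x, (X * p - derivative p).eval x ∂γ = 0 := by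
  rw [integral_gaussianReal_eq_integral_smul one_ne_zero, ← neg_eq_zero, ← integral_neg]
  refine integral_eq_zero_of_hasDerivAt_of_integrable
    (f := fun x => gaussianPDFReal 0 1 x * p.eval x) (fun x => ?_) ?_ ?_
  · refine ((hasDerivAt_gaussianPDFReal x).fun_mul (p.hasDerivAt x)).congr_deriv ?_
    rw [eval_sub, eval_mul, eval_X, smul_eq_mul]
    ring
  · exact ((integrable_gaussianReal_iff _ _ one_ne_zero).1
      (integrable_eval_gaussianReal (X * p - derivative p) 0 1)).neg
  · exact (integrable_gaussianReal_iff _ _ one_ne_zero).1 (integrable_eval_gaussianReal p 0 1)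

theorem integral_X_mul_sub_derivative_mul (p r : ℝ[X]) :
    ∫ x, ((X * p - derivative p) * r).eval x ∂γ = ∫ x, (p * derivative r).eval x ∂γ := by
  have hsplit : (X * p - derivative p) * r =
      (X * (p * r) - derivative (p * r)) + p * derivative r := by
    rw [derivative_mul]; ring
  simp_rw [hsplit, eval_add]
  rw [integral_add (integrable_eval_gaussianReal _ _ _) (integrable_eval_gaussianReal _ _ _),
    integral_eval_X_mul_sub_derivative, zero_add]

theorem integral_hermiteR_sq (q : ℕ) :
    ∫ x, (hermiteR q * hermiteR q).eval x ∂γ = q.factorial := by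
  induction q with
  | zero => simp [hermiteR_zero]
  | succ q ih =>
    nth_rewrite 1 [hermiteR_succ]
    rw [integral_X_mul_sub_derivative_mul, derivative_hermiteR_succ, mul_smul_comm]
    simp_rw [eval_smul]
    rw [integral_smul, ih, Nat.factorial_succ]
    push_cast
    rfl

/-- Integration by parts in `w` shows that the raising operator `p ↦ X p - p'` commutes with the
Ornstein–Uhlenbeck operator `p ↦ ∫ p (ρ · + σ w) dγ(w)` up to the factor `ρ`. -/
theorem integral_eval_X_mul_sub_derivative_comp {ρ σ : ℝ} (h : ρ ^ 2 + σ ^ 2 = 1) (x : ℝ)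
    (p : ℝ[X]) :
    ∫ w, (X * p - derivative p).eval (ρ * x + σ * w) ∂γ =
      ρ * (x * ∫ w, p.eval (ρ * x + σ * w) ∂γ -
        ρ * ∫ w, (derivative p).eval (ρ * x + σ * w) ∂γ) := by
  set L : ℝ[X] := C (ρ * x) + C σ * X
  have heval (r : ℝ[X]) (w : ℝ) : r.eval (ρ * x + σ * w) = (r.comp L).eval w := by simp [L]
  have hsplit : (X * p - derivative p).comp L =
      C σ * (X * p.comp L - derivative (p.comp L)) +
        (C (ρ * x) * p.comp L - C (ρ ^ 2) * (derivative p).comp L) := by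
    have hL : derivative L = C σ := by simp [L]
    have hσ : C σ * C σ = 1 - C (ρ ^ 2) := by
      rw [← C_mul, ← C_1, ← C_sub]; congr 1; linear_combination h
    rw [sub_comp, mul_comp, X_comp, derivative_comp, hL]
    linear_combination (derivative p).comp L * hσ
  simp_rw [heval, hsplit, eval_add]
  rw [integral_add (integrable_eval_gaussianReal _ _ _) (integrable_eval_gaussianReal _ _ _)]
  simp_rw [eval_C_mul (a := σ), eval_sub _ (C _ * _), eval_C_mul]
  rw [integral_const_mul, integral_eval_X_mul_sub_derivative,
    integral_sub ((integrable_eval_gaussianReal _ _ _).const_mul _)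
      ((integrable_eval_gaussianReal _ _ _).const_mul _), integral_const_mul, integral_const_mul]
  ring

theorem integral_hermiteR_mehler {ρ σ : ℝ} (h : ρ ^ 2 + σ ^ 2 = 1) (x : ℝ) (q : ℕ) :
    ∫ w, (hermiteR q).eval (ρ * x + σ * w) ∂γ = ρ ^ q * (hermiteR q).eval x := by
  suffices (∫ w, (hermiteR q).eval (ρ * x + σ * w) ∂γ = ρ ^ q * (hermiteR q).eval x) ∧
      ρ * ∫ w, (derivative (hermiteR q)).eval (ρ * x + σ * w) ∂γ =
        ρ ^ q * (derivative (hermiteR q)).eval x from this.1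
  induction q with
  | zero => simp [hermiteR_zero]
  | succ q ih =>
    constructor
    · rw [hermiteR_succ, integral_eval_X_mul_sub_derivative_comp h, ih.1, ih.2]
      simp only [eval_sub, eval_mul, eval_X]
      ring
    · simp only [derivative_hermiteR_succ, eval_smul, smul_eq_mul]
      rw [integral_const_mul, ih.1]
      ring

end Hermite

section Extension

variable {ι E F : Type*} [NormedAddCommGroup E] [InnerProductSpace ℝ E]
  [NormedAddCommGroup F] [InnerProductSpace ℝ F]

/-- The closed linear span of a family of vectors. -/
abbrev closedSpan (u : ι → E) : Submodule ℝ E := (Submodule.span ℝ (range u)).topologicalClosure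

theorem mem_closedSpan (u : ι → E) (i : ι) : u i ∈ closedSpan u :=
  Submodule.le_topologicalClosure _ (Submodule.subset_span ⟨i, rfl⟩)

theorem inner_linearCombination {u : ι → E} {v : ι → F} {c : ℝ}
    (h : ∀ i j, inner ℝ (v i) (v j) = c * inner ℝ (u i) (u j)) (a b : ι →₀ ℝ) :
    inner ℝ (Finsupp.linearCombination ℝ v a) (Finsupp.linearCombination ℝ v b) =
      c * inner ℝ (Finsupp.linearCombination ℝ u a) (Finsupp.linearCombination ℝ u b) := by
  simp only [Finsupp.linearCombination_apply, Finsupp.sum, sum_inner, inner_sum,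
    real_inner_smul_left, real_inner_smul_right, h, Finset.mul_sum]
  exact Finset.sum_congr rfl fun _ _ => Finset.sum_congr rfl fun _ _ => by ring

theorem norm_linearCombination {u : ι → E} {v : ι → F} {c : ℝ} (hc : 0 ≤ c)
    (h : ∀ i j, inner ℝ (v i) (v j) = c * inner ℝ (u i) (u j)) (a : ι →₀ ℝ) :
    ‖Finsupp.linearCombination ℝ v a‖ = √c * ‖Finsupp.linearCombination ℝ u a‖ := by
  have hsq := inner_linearCombination h a a
  rw [real_inner_self_eq_norm_sq, real_inner_self_eq_norm_sq] at hsq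
  rw [← Real.sqrt_sq (norm_nonneg (Finsupp.linearCombination ℝ v a)), hsq, Real.sqrt_mul hc,
    Real.sqrt_sq (norm_nonneg _)]

theorem exists_continuousLinearMap_closedSpan [CompleteSpace F] {u : ι → E} {v : ι → F} {c : ℝ}
    (hc : 0 ≤ c) (h : ∀ i j, inner ℝ (v i) (v j) = c * inner ℝ (u i) (u j)) :
    ∃ T : closedSpan u →L[ℝ] F, ∀ i, T ⟨u i, mem_closedSpan u i⟩ = v i := by
  have hrange : range (Finsupp.linearCombination ℝ u) = Submodule.span ℝ (range u) := by
    rw [← Finsupp.range_linearCombination]; rfl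
  have hmem (a : ι →₀ ℝ) : Finsupp.linearCombination ℝ u a ∈ closedSpan u :=
    Submodule.le_topologicalClosure _ (SetLike.mem_coe.1 (hrange ▸ mem_range_self a))
  let combination : (ι →₀ ℝ) →ₗ[ℝ] closedSpan u :=
    (Finsupp.linearCombination ℝ u).codRestrict _ hmem
  have hdense : DenseRange combination := by
    refine Subtype.dense_iff.2 fun x hx => ?_
    have himage : Subtype.val '' range combination = (Submodule.span ℝ (range u) : Set E) := by
      rw [← range_comp, ← hrange]; rfl
    exact closure_mono himage.ge hx
  have hbound : ∃ C, ∀ a, ‖Finsupp.linearCombination ℝ v a‖ ≤ C * ‖combination a‖ :=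
    ⟨√c, fun a => (norm_linearCombination hc h a).le⟩
  refine ⟨(Finsupp.linearCombination ℝ v).extendOfNorm combination, fun i => ?_⟩
  have hsingle : (⟨u i, mem_closedSpan u i⟩ : closedSpan u) = combination (Finsupp.single i 1) := by
    ext; simp [combination]
  rw [hsingle, LinearMap.extendOfNorm_eq hdense hbound]
  simp

theorem exists_isExtension [CompleteSpace E] [CompleteSpace F] {u : ι → E} {v : ι → F} {c : ℝ}
    (hc : 0 ≤ c) (h : ∀ i j, inner ℝ (v i) (v j) = c * inner ℝ (u i) (u j)) :
    ∃ T : E →L[ℝ] F, IsExtension u v T := by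
  obtain ⟨T, hT⟩ := exists_continuousLinearMap_closedSpan hc h
  have : CompleteSpace (closedSpan u) :=
    (Submodule.isClosed_topologicalClosure _).completeSpace_coe
  refine ⟨T ∘L (closedSpan u).orthogonalProjectionOnto, fun i => ?_, fun x hx => ?_⟩
  · rw [ContinuousLinearMap.comp_apply, ← hT i]
    congr 1
    exact Submodule.orthogonalProjectionOnto_mem_subspace_eq_self
      (⟨u i, mem_closedSpan u i⟩ : closedSpan u)
  · rw [← Submodule.orthogonal_closure] at hx
    rw [ContinuousLinearMap.comp_apply,
      Submodule.orthogonalProjectionOnto_apply_of_mem_orthogonal hx, map_zero]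

theorem isExtension_extension {u : ι → E} {v : ι → F} (h : ∃ T : E →L[ℝ] F, IsExtension u v T) :
    IsExtension u v (extension u v) := by
  rw [extension, dif_pos h]
  exact h.choose_spec

theorem IsExtension.inner_eq {u : ι → E} {v : ι → F} {c : ℝ} {T : E →L[ℝ] F}
    (hT : IsExtension u v T) (h : ∀ i j, inner ℝ (v i) (v j) = c * inner ℝ (u i) (u j)) {x y : E}
    (hx : x ∈ closedSpan u) (hy : y ∈ closedSpan u) :
    inner ℝ (T x) (T y) = c * inner ℝ x y := by
  have hspan : (Submodule.span ℝ (range u) : Set E) ×ˢ (Submodule.span ℝ (range u) : Set E) ⊆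
      {z : E × E | inner ℝ (T z.1) (T z.2) = c * inner ℝ z.1 z.2} := by
    have hcomb (a : ι →₀ ℝ) :
        T (Finsupp.linearCombination ℝ u a) = Finsupp.linearCombination ℝ v a := by
      simp [Finsupp.linearCombination_apply, Finsupp.sum, hT.1]
    rintro ⟨x, y⟩ ⟨hx, hy⟩
    rw [SetLike.mem_coe, ← Finsupp.range_linearCombination] at hx hy
    obtain ⟨a, rfl⟩ := hx
    obtain ⟨b, rfl⟩ := hy
    rw [mem_ofPred_eq, hcomb, hcomb, inner_linearCombination h]
  refine closure_minimal hspan (isClosed_eq (by fun_prop) (by fun_prop)) (?_ : (x, y) ∈ _)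
  rw [closure_prod_eq]
  exact ⟨hx, hy⟩

end Extension

section L2

variable {α : Type*} {mα : MeasurableSpace α} {μ : Measure α}

theorem coeFn_toL2 {f : α → ℝ} (hf : MemLp f 2 μ) : toL2 μ f =ᵐ[μ] f := by
  rw [toL2, dif_pos hf]
  exact hf.coeFn_toLp

theorem inner_toL2 {f g : α → ℝ} (hf : MemLp f 2 μ) (hg : MemLp g 2 μ) :
    inner ℝ (toL2 μ f) (toL2 μ g) = ∫ x, f x * g x ∂μ := by
  rw [L2.inner_def]
  refine integral_congr_ae ?_
  filter_upwards [coeFn_toL2 hf, coeFn_toL2 hg] with x hfx hgx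
  rw [hfx, hgx, RCLike.inner_apply', conj_trivial]

theorem toL2_congr {f g : α → ℝ} (h : f =ᵐ[μ] g) : toL2 μ f = toL2 μ g := by
  by_cases hf : MemLp f 2 μ
  · rw [toL2, toL2, dif_pos hf, dif_pos ((memLp_congr_ae h).1 hf)]
    exact MemLp.toLp_congr _ _ h
  · rw [toL2, toL2, dif_neg hf, dif_neg (fun hg => hf ((memLp_congr_ae h).2 hg))]

end L2

section TensorPow

variable {E F T T' : Type*} [NormedAddCommGroup E] [InnerProductSpace ℝ E]
  [NormedAddCommGroup F] [InnerProductSpace ℝ F] [NormedAddCommGroup T'] [InnerProductSpace ℝ T']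
  [NormedAddCommGroup T] [InnerProductSpace ℝ T]

/-- `pow` realizes `h ↦ h^{⊗q}` in the inner product space `T`. The values on the diagonal determine
the symmetric tensor power up to isometry, so no other tensors are mentioned. -/
def IsTensorPow (q : ℕ) (pow : E → T) : Prop :=
  ∀ g h, inner ℝ (pow g) (pow h) = inner ℝ g h ^ q

theorem isTensorPow_tpow (q : ℕ) : IsTensorPow q (tpow q : E → TensorPower E q) := inner_tpow E q

namespace IsTensorPow

variable {q : ℕ} {pow : E → T} {pow' : E → T'}

theorem map_smul (hpow : IsTensorPow q pow) (r : ℝ) (h : E) : pow (r • h) = r ^ q • pow h := by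
  rw [← sub_eq_zero, ← inner_self_eq_zero (𝕜 := ℝ)]
  simp only [inner_sub_left, inner_sub_right, real_inner_smul_left, real_inner_smul_right, hpow _ _]
  ring

theorem map_zero (hpow : IsTensorPow q pow) (hq : q ≠ 0) : pow 0 = 0 := by
  simpa only [zero_smul, zero_pow hq] using hpow.map_smul 0 0

theorem closedSpan_sphere (hpow : IsTensorPow q pow) (hq : q ≠ 0) :
    closedSpan (fun h : Metric.sphere (0 : E) 1 => pow h) = closedSpan pow := by
  refine congrArg Submodule.topologicalClosure
    (le_antisymm (Submodule.span_mono ?_) (Submodule.span_le.2 ?_))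
  · rintro _ ⟨h, rfl⟩
    exact ⟨h, rfl⟩
  · rintro _ ⟨h, rfl⟩
    rcases eq_or_ne h 0 with rfl | hne
    · rw [hpow.map_zero hq]
      exact Submodule.zero_mem _
    · rw [← smul_inv_smul₀ (norm_ne_zero_iff.2 hne) h, hpow.map_smul]
      exact Submodule.smul_mem _ _
        (Submodule.subset_span ⟨⟨‖h‖⁻¹ • h, by simp [norm_smul, hne]⟩, rfl⟩)

theorem comp {pow : F → T} (hpow : IsTensorPow q pow) {K : E → F}
    (hK : ∀ g h, inner ℝ (K g) (K h) = inner ℝ g h) : IsTensorPow q fun h => pow (K h) :=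
  fun g h => by rw [hpow, hK]

theorem isExtension [CompleteSpace T] [CompleteSpace T'] (hpow : IsTensorPow q pow)
    (hpow' : IsTensorPow q pow') : IsExtension pow pow' (extension pow pow') :=
  isExtension_extension
    (exists_isExtension zero_le_one fun g h => by rw [one_mul, hpow, hpow'])

theorem norm_extension [CompleteSpace T] [CompleteSpace T'] (hpow : IsTensorPow q pow)
    (hpow' : IsTensorPow q pow') {x : T} (hx : x ∈ closedSpan pow) :
    ‖extension pow pow' x‖ = ‖x‖ := by
  have hinner := (hpow.isExtension hpow').inner_eq (c := 1)
    (fun g h => by rw [one_mul, hpow, hpow']) hx hx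
  rw [one_mul, real_inner_self_eq_norm_sq, real_inner_self_eq_norm_sq] at hinner
  exact (sq_eq_sq₀ (norm_nonneg _) (norm_nonneg _)).1 hinner

end IsTensorPow

end TensorPow

section Isonormal

variable {Ω : Type*} {mΩ : MeasurableSpace Ω} {P : Measure Ω}
  {E : Type*} [NormedAddCommGroup E] [InnerProductSpace ℝ E]

/-- `X` is an isonormal process: a linear map into `L²(P)` such that `X h` is centered Gaussian with
variance `‖h‖²`. Joint Gaussianity and the covariance are consequences of linearity. -/
def IsIsonormal (X : E →L[ℝ] Lp ℝ 2 P) : Prop :=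
  ∀ h, P.map (X h) = gaussianReal 0 (‖h‖₊ ^ 2)

theorem aemeasurable_Lp (f : Lp ℝ 2 P) : AEMeasurable f P :=
  (Lp.aestronglyMeasurable f).aemeasurable

theorem coeFn_map_smul_add_smul (X : E →L[ℝ] Lp ℝ 2 P) (a b : ℝ) (h k : E) :
    X (a • h + b • k) =ᵐ[P] fun ω => a * X h ω + b * X k ω := by
  rw [map_add, map_smul, map_smul]
  filter_upwards [Lp.coeFn_add (a • X h) (b • X k), Lp.coeFn_smul a (X h),
    Lp.coeFn_smul b (X k)] with ω hadd hh hk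
  rw [hadd, Pi.add_apply, hh, hk, Pi.smul_apply, Pi.smul_apply, smul_eq_mul, smul_eq_mul]

theorem map_mul_add_mul_prod_gaussianReal (a b : ℝ) :
    ((gaussianReal 0 1).prod (gaussianReal 0 1)).map (fun z => a * z.1 + b * z.2) =
      gaussianReal 0 (‖a‖₊ ^ 2 + ‖b‖₊ ^ 2) := by
  have hlaw (c : ℝ) : (gaussianReal 0 1).map (c * ·) = gaussianReal 0 (‖c‖₊ ^ 2) := by
    rw [gaussianReal_map_const_mul, mul_zero]
    congr 1
    ext
    simp
  have hfst : ((gaussianReal 0 1).prod (gaussianReal 0 1)).map (fun z => a * z.1) =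
      gaussianReal 0 (‖a‖₊ ^ 2) := by
    rw [← hlaw, ← Function.comp_def (a * ·), ← Measure.map_map (by fun_prop) measurable_fst,
      Measure.map_fst_prod, measure_univ, one_smul]
  have hsnd : ((gaussianReal 0 1).prod (gaussianReal 0 1)).map (fun z => b * z.2) =
      gaussianReal 0 (‖b‖₊ ^ 2) := by
    rw [← hlaw, ← Function.comp_def (b * ·), ← Measure.map_map (by fun_prop) measurable_snd,
      Measure.map_snd_prod, measure_univ, one_smul]
  have hindep : IndepFun (fun z : ℝ × ℝ => a * z.1) (fun z => b * z.2)
      ((gaussianReal 0 1).prod (gaussianReal 0 1)) :=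
    indepFun_prod (X := (a * ·)) (Y := (b * ·)) (by fun_prop) (by fun_prop)
  have hsum := gaussianReal_add_gaussianReal_of_indepFun hindep hfst hsnd
  rwa [add_zero] at hsum

namespace IsIsonormal

variable {X : E →L[ℝ] Lp ℝ 2 P}

theorem memLp_hermiteFun (hX : IsIsonormal X) (q : ℕ) (h : E) :
    MemLp (fun ω => hermiteFun q (X h ω)) 2 P := by
  have hmem := memLp_eval_gaussianReal (hermiteR q) 0 (‖h‖₊ ^ 2)
  simp_rw [← hermiteFun_eq_eval, ← hX h] at hmem
  exact hmem.comp_of_map (aemeasurable_Lp _)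

theorem map_prodMk [IsFiniteMeasure P] (hX : IsIsonormal X) {g h : E} {σ : ℝ} (hg : ‖g‖ = 1)
    (hh : ‖h‖ ^ 2 = inner ℝ g h ^ 2 + σ ^ 2) :
    P.map (fun ω => (X g ω, X h ω)) = ((gaussianReal 0 1).prod (gaussianReal 0 1)).map
      fun z => (z.1, inner ℝ g h * z.1 + σ * z.2) := by
  have hmeas := (aemeasurable_Lp (X g)).prodMk (aemeasurable_Lp (X h))
  -- Cramér–Wold: a law on the plane is determined by its one-dimensional marginals.
  refine Measure.ext_of_charFunDual (funext fun L => ?_)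
  set a := L (1, 0)
  set b := L (0, 1)
  have hL (x y : ℝ) : L (x, y) = a * x + b * y := by
    rw [show (x, y) = x • ((1, 0) : ℝ × ℝ) + y • ((0, 1) : ℝ × ℝ) by simp, map_add, map_smul,
      map_smul, smul_eq_mul, smul_eq_mul, mul_comm x, mul_comm y]
  rw [charFunDual_eq_charFun_map_one, charFunDual_eq_charFun_map_one,
    AEMeasurable.map_map_of_aemeasurable (by fun_prop) hmeas,
    Measure.map_map (by fun_prop) (by fun_prop)]
  congr 1
  have hleft : P.map (L ∘ fun ω => (X g ω, X h ω)) = gaussianReal 0 (‖a • g + b • h‖₊ ^ 2) := by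
    rw [← hX (a • g + b • h)]
    refine Measure.map_congr ?_
    filter_upwards [coeFn_map_smul_add_smul X a b g h] with ω hω
    rw [hω, Function.comp_apply, hL]
  have hright : (L ∘ fun z : ℝ × ℝ => (z.1, inner ℝ g h * z.1 + σ * z.2)) =
      fun z => (a + b * inner ℝ g h) * z.1 + (b * σ) * z.2 := by
    ext z
    rw [Function.comp_apply, hL]
    ring
  rw [hleft, hright, map_mul_add_mul_prod_gaussianReal]
  congr 1
  ext
  push_cast
  simp only [Real.norm_eq_abs, sq_abs]
  rw [norm_add_sq_real, norm_smul, norm_smul, mul_pow, mul_pow, hh, hg, real_inner_smul_left,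
    real_inner_smul_right, Real.norm_eq_abs, Real.norm_eq_abs, sq_abs, sq_abs]
  ring

theorem integral_hermiteFun_mul [IsFiniteMeasure P] (hX : IsIsonormal X) (q : ℕ) {g h : E}
    (hg : ‖g‖ = 1) (hh : ‖h‖ = 1) :
    ∫ ω, hermiteFun q (X g ω) * hermiteFun q (X h ω) ∂P = q.factorial * inner ℝ g h ^ q := by
  set ρ : ℝ := inner ℝ g h with hρ
  obtain ⟨σ, hσ⟩ : ∃ σ : ℝ, ρ ^ 2 + σ ^ 2 = 1 := by
    refine ⟨√(1 - ρ ^ 2), ?_⟩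
    have hρ1 : |ρ| ≤ 1 := by simpa [hg, hh] using abs_real_inner_le_norm g h
    rw [Real.sq_sqrt (sub_nonneg.2 ((sq_le_one_iff_abs_le_one ρ).2 hρ1))]
    ring
  have hlaw := hX.map_prodMk (σ := σ) hg (by rw [hh, ← hρ, hσ, one_pow])
  have hmeas := (aemeasurable_Lp (X g)).prodMk (aemeasurable_Lp (X h))
  have hherm := measurable_hermiteFun q
  have hcont : Measurable fun z : ℝ × ℝ => hermiteFun q z.1 * hermiteFun q z.2 := by fun_prop
  have hint := (hX.memLp_hermiteFun q g).integrable_mul (hX.memLp_hermiteFun q h)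
  rw [show ((fun ω => hermiteFun q (X g ω)) * fun ω => hermiteFun q (X h ω)) =
      (fun z : ℝ × ℝ => hermiteFun q z.1 * hermiteFun q z.2) ∘ fun ω => (X g ω, X h ω) from rfl,
    ← integrable_map_measure hcont.aestronglyMeasurable hmeas, hlaw,
    integrable_map_measure hcont.aestronglyMeasurable (by fun_prop)] at hint
  calc ∫ ω, hermiteFun q (X g ω) * hermiteFun q (X h ω) ∂P
      = ∫ z, hermiteFun q z.1 * hermiteFun q (ρ * z.1 + σ * z.2)
          ∂((gaussianReal 0 1).prod (gaussianReal 0 1)) := by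
        rw [← integral_map (f := fun z : ℝ × ℝ => hermiteFun q z.1 * hermiteFun q z.2) hmeas
          hcont.aestronglyMeasurable, hlaw,
          integral_map (by fun_prop) hcont.aestronglyMeasurable]
    _ = ∫ x, hermiteFun q x * (ρ ^ q * hermiteFun q x) ∂gaussianReal 0 1 := by
        refine (integral_prod _ hint).trans ?_
        simp_rw [Function.comp_apply, integral_const_mul, hermiteFun_eq_eval, ← hρ,
          integral_hermiteR_mehler hσ]
    _ = q.factorial * ρ ^ q := by
        rw [← integral_hermiteR_sq, ← integral_mul_const]
        refine integral_congr_ae (ae_of_all _ fun x => ?_)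
        simp only [hermiteFun_eq_eval, Polynomial.eval_mul]
        ring

variable {T : Type*} [NormedAddCommGroup T] [InnerProductSpace ℝ T] {q : ℕ} {pow : E → T}

theorem inner_toL2_hermiteFun [IsFiniteMeasure P] (hX : IsIsonormal X) (hpow : IsTensorPow q pow)
    (g h : Metric.sphere (0 : E) 1) :
    inner ℝ (toL2 P fun ω => hermiteFun q (X g ω)) (toL2 P fun ω => hermiteFun q (X h ω)) =
      q.factorial * inner ℝ (pow g) (pow h) := by
  rw [inner_toL2 (hX.memLp_hermiteFun q g) (hX.memLp_hermiteFun q h),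
    hX.integral_hermiteFun_mul q (by simp) (by simp), hpow]

variable [CompleteSpace T]

theorem isMultipleIntegral [IsFiniteMeasure P] (hX : IsIsonormal X) (hpow : IsTensorPow q pow) :
    IsMultipleIntegral q pow X (multipleIntegral q pow X) :=
  isExtension_extension (exists_isExtension (Nat.cast_nonneg _) (hX.inner_toL2_hermiteFun hpow))

theorem inner_multipleIntegral [IsFiniteMeasure P] (hX : IsIsonormal X) (hpow : IsTensorPow q pow)
    (hq : q ≠ 0) {x y : T} (hx : x ∈ closedSpan pow) (hy : y ∈ closedSpan pow) :
    inner ℝ (multipleIntegral q pow X x) (multipleIntegral q pow X y) =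
      q.factorial * inner ℝ x y := by
  rw [← hpow.closedSpan_sphere hq] at hx hy
  exact (hX.isMultipleIntegral hpow).inner_eq (hX.inner_toL2_hermiteFun hpow) hx hy

theorem integral_sq_multipleIntegral_sub [IsFiniteMeasure P] (hX : IsIsonormal X)
    (hpow : IsTensorPow q pow) (hq : q ≠ 0) {x y : T} (hx : x ∈ closedSpan pow)
    (hy : y ∈ closedSpan pow) :
    ∫ ω, |multipleIntegral q pow X x ω - multipleIntegral q pow X y ω| ^ 2 ∂P =
      q.factorial * ‖x - y‖ ^ 2 := by
  have hxy := Submodule.sub_mem _ hx hy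
  rw [← real_inner_self_eq_norm_sq, ← hX.inner_multipleIntegral hpow hq hxy hxy, map_sub,
    L2.inner_def]
  refine integral_congr_ae ?_
  filter_upwards [Lp.coeFn_sub (multipleIntegral q pow X x) (multipleIntegral q pow X y)] with ω hω
  rw [hω, Pi.sub_apply, real_inner_self_eq_norm_sq, Real.norm_eq_abs]

theorem multipleIntegral_pow [IsFiniteMeasure P] (hX : IsIsonormal X) (hpow : IsTensorPow q pow)
    (hq : q ≠ 0) (h : E) :
    multipleIntegral q pow X (pow h) =ᵐ[P]
      fun ω => ‖h‖ ^ q * hermiteFun q (‖h‖⁻¹ * X h ω) := by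
  rcases eq_or_ne h 0 with rfl | hne
  · rw [hpow.map_zero hq, map_zero, norm_zero, zero_pow hq]
    filter_upwards [Lp.coeFn_zero ℝ 2 P] with ω hω
    rw [hω, zero_mul, Pi.zero_apply]
  · have hunit : ‖h‖⁻¹ • h ∈ Metric.sphere (0 : E) 1 := by simp [norm_smul, hne]
    have hscale : pow h = ‖h‖ ^ q • pow (‖h‖⁻¹ • h) := by
      rw [← hpow.map_smul, smul_inv_smul₀ (norm_ne_zero_iff.2 hne)]
    rw [hscale, map_smul, (hX.isMultipleIntegral hpow).1 ⟨_, hunit⟩]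
    filter_upwards [Lp.coeFn_smul (‖h‖ ^ q) (toL2 P fun ω => hermiteFun q (X (‖h‖⁻¹ • h) ω)),
      coeFn_toL2 (hX.memLp_hermiteFun q (‖h‖⁻¹ • h)), Lp.coeFn_smul ‖h‖⁻¹ (X h)]
      with ω houter hherm hinner
    rw [houter, Pi.smul_apply, hherm, map_smul, hinner, Pi.smul_apply, smul_eq_mul, smul_eq_mul]

theorem multipleIntegral_extension [IsFiniteMeasure P] {F T' : Type*} [NormedAddCommGroup F]
    [InnerProductSpace ℝ F] [NormedAddCommGroup T'] [InnerProductSpace ℝ T'] [CompleteSpace T']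
    {pow' : F → T'} {X' : F →L[ℝ] Lp ℝ 2 P} {K : E → F} (hX : IsIsonormal X)
    (hX' : IsIsonormal X') (hpow : IsTensorPow q pow) (hpow' : IsTensorPow q pow') (hq : q ≠ 0)
    (hK : ∀ g h, inner ℝ (K g) (K h) = inner ℝ g h) (hXX' : ∀ h, X' (K h) = X h) {x : T}
    (hx : x ∈ closedSpan pow) :
    multipleIntegral q pow' X' (extension pow (fun h => pow' (K h)) x) =
      multipleIntegral q pow X x := by
  have hnorm (h : E) : ‖K h‖ = ‖h‖ := by
    rw [norm_eq_sqrt_real_inner, hK, ← norm_eq_sqrt_real_inner]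
  have hle : closedSpan pow ≤ (multipleIntegral q pow' X' ∘L extension pow (fun h => pow' (K h)) -
      multipleIntegral q pow X).ker := by
    refine Submodule.topologicalClosure_minimal _ (Submodule.span_le.2 ?_)
      (ContinuousLinearMap.isClosed_ker _)
    rintro _ ⟨h, rfl⟩
    have hpow_eq : multipleIntegral q pow' X' (pow' (K h)) = multipleIntegral q pow X (pow h) := by
      refine Lp.ext ((hX'.multipleIntegral_pow hpow' hq (K h)).trans ?_)
      rw [hnorm, hXX']
      exact (hX.multipleIntegral_pow hpow hq h).symm
    simp [(hpow.isExtension (hpow'.comp hK)).1 h, hpow_eq]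
  simpa [sub_eq_zero] using hle hx

end IsIsonormal

end Isonormal

section FBMIsonormal

theorem coe_mem_span_ind {H : Ioo (0 : ℝ) 1} (φ : StepFun H) :
    (φ : FBMSpace H) ∈ Submodule.span ℝ (range (ind H)) := by
  have hφ : φ ∈ Submodule.span ℝ (range (stepBasis H)) := (stepBasis H).mem_span φ
  have hmap := Submodule.mem_map_of_mem (f := (UniformSpace.Completion.toComplL :
    StepFun H →L[ℝ] FBMSpace H).toLinearMap) hφ
  rwa [Submodule.map_span, ← range_comp] at hmap

theorem closedSpan_ind (H : Ioo (0 : ℝ) 1) : closedSpan (ind H) = ⊤ := by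
  refine eq_top_iff.2 fun x _ => ?_
  refine UniformSpace.Completion.induction_on x ?_ fun φ => ?_
  · exact Submodule.isClosed_topologicalClosure _
  · exact Submodule.le_topologicalClosure _ (coe_mem_span_ind φ)

variable {Ω : Type*} {mΩ : MeasurableSpace Ω} {P : Measure Ω}

theorem continuous_charFun_map [IsProbabilityMeasure P] (t : ℝ) :
    Continuous fun f : Lp ℝ 2 P => charFun (P.map f) t := by
  refine continuous_iff_seqContinuous.2 fun f f₀ hf => ?_
  have hlaw := (tendstoInMeasure_of_tendsto_Lp hf).tendstoInDistribution
    fun n => aemeasurable_Lp (f n)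
  exact ProbabilityMeasure.tendsto_iff_tendsto_charFun.1 hlaw.tendsto t

namespace IsFBM

variable {H : Ioo (0 : ℝ) 1} {B : ℝ≥0 → Ω → ℝ}

theorem memLp (hB : IsFBM H B P) (t : ℝ≥0) : MemLp (B t) 2 P :=
  (hB.isGaussianProcess.hasGaussianLaw_eval t).memLp_two

theorem inner_toL2 (hB : IsFBM H B P) (s t : Icc (0 : ℝ) 1) :
    inner ℝ (toL2 P (B (unitInterval.toNNReal s))) (toL2 P (B (unitInterval.toNNReal t))) =
      1 * inner ℝ (ind H s) (ind H t) := by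
  rw [FBM.inner_toL2 (hB.memLp _) (hB.memLp _), hB.covariance, inner_ind, one_mul,
    unitInterval.coe_toNNReal, unitInterval.coe_toNNReal]

theorem isExtension_isonormal (hB : IsFBM H B P) :
    IsExtension (ind H) (fun t => toL2 P (B (unitInterval.toNNReal t))) (isonormal H P B) :=
  isExtension_extension (exists_isExtension zero_le_one hB.inner_toL2)

theorem isonormal_ind (hB : IsFBM H B P) (t : Icc (0 : ℝ) 1) :
    isonormal H P B (ind H t) =ᵐ[P] B (unitInterval.toNNReal t) := by
  rw [hB.isExtension_isonormal.1 t]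
  exact coeFn_toL2 (hB.memLp _)

theorem inner_isonormal (hB : IsFBM H B P) (x y : FBMSpace H) :
    inner ℝ (isonormal H P B x) (isonormal H P B y) = inner ℝ x y := by
  rw [hB.isExtension_isonormal.inner_eq hB.inner_toL2, one_mul] <;>
  simp only [closedSpan_ind, Submodule.mem_top]

theorem isonormal_linearCombination (hB : IsFBM H B P) (a : Icc (0 : ℝ) 1 →₀ ℝ) :
    isonormal H P B (Finsupp.linearCombination ℝ (ind H) a) =ᵐ[P]
      fun ω => ∑ t ∈ a.support, a t * B (unitInterval.toNNReal t) ω := by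
  have hsum : isonormal H P B (Finsupp.linearCombination ℝ (ind H) a) =
      ∑ t ∈ a.support, a t • isonormal H P B (ind H t) := by
    simp only [Finsupp.linearCombination_apply, Finsupp.sum, map_sum, map_smul]
  have hterm : ∀ᵐ ω ∂P, ∀ t ∈ a.support, (a t • isonormal H P B (ind H t) : Lp ℝ 2 P) ω =
      a t * B (unitInterval.toNNReal t) ω := by
    refine (Finset.eventually_all _).2 fun t _ => ?_
    filter_upwards [Lp.coeFn_smul (a t) (isonormal H P B (ind H t)), hB.isonormal_ind t]
      with ω hsmul hind
    rw [hsmul, Pi.smul_apply, hind, smul_eq_mul]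
  rw [hsum]
  filter_upwards [Lp.coeFn_finsetSum a.support fun t => a t • isonormal H P B (ind H t), hterm]
    with ω hω hterm
  rw [hω, Finset.sum_apply, Finset.sum_congr rfl hterm]

theorem integral_isonormal_sq (hB : IsFBM H B P) (x : FBMSpace H) :
    ∫ ω, isonormal H P B x ω ^ 2 ∂P = ‖x‖ ^ 2 := by
  rw [← real_inner_self_eq_norm_sq, ← hB.inner_isonormal, L2.inner_def]
  simp only [sq, RCLike.inner_apply, conj_trivial]

theorem map_isonormal_of_mem_span (hB : IsFBM H B P) {x : FBMSpace H}
    (hx : x ∈ Submodule.span ℝ (range (ind H))) :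
    P.map (isonormal H P B x) = gaussianReal 0 (‖x‖₊ ^ 2) := by
  have := hB.isGaussianProcess.isProbabilityMeasure
  rw [← Finsupp.range_linearCombination] at hx
  obtain ⟨a, rfl⟩ := hx
  have hae := hB.isonormal_linearCombination a
  have hgauss : HasGaussianLaw (isonormal H P B (Finsupp.linearCombination ℝ (ind H) a)) P :=
    (((hB.isGaussianProcess.comp_right unitInterval.toNNReal).smul a).hasGaussianLaw_fun_sum
      (I := a.support)).congr hae.symm
  have hmean : ∫ ω, isonormal H P B (Finsupp.linearCombination ℝ (ind H) a) ω ∂P = 0 := by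
    rw [integral_congr_ae hae, integral_finsetSum _ fun t _ =>
      ((hB.memLp _).integrable one_le_two).const_mul _]
    simp only [integral_const_mul, hB.centered, mul_zero, Finset.sum_const_zero]
  rw [hgauss.map_eq_gaussianReal, hmean, variance_of_integral_eq_zero hgauss.aemeasurable hmean,
    hB.integral_isonormal_sq]
  congr 1
  ext
  simp

theorem isIsonormal [IsProbabilityMeasure P] (hB : IsFBM H B P) :
    IsIsonormal (isonormal H P B) := by
  refine fun x => Measure.ext_of_charFun (funext fun t => ?_)
  refine UniformSpace.Completion.induction_on (p := fun x => charFun (P.map (isonormal H P B x)) t =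
      charFun (gaussianReal 0 (‖x‖₊ ^ 2)) t) x ?_ fun φ => ?_
  · refine isClosed_eq ((continuous_charFun_map t).comp (isonormal H P B).continuous) ?_
    simp only [charFun_gaussianReal]
    push_cast
    fun_prop
  · rw [hB.map_isonormal_of_mem_span (coe_mem_span_ind φ)]

end IsFBM

end FBMIsonormal

section SelfSimilar

variable {Ω : Type*} {mΩ : MeasurableSpace Ω} {P : Measure Ω}

theorem variance_strongDual_comp {ι : Type*} [Fintype ι] [DecidableEq ι] [IsFiniteMeasure P]
    {X : ι → Ω → ℝ} (hX : ∀ i, MemLp (X i) 2 P) (L : StrongDual ℝ (ι → ℝ)) :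
    Var[fun ω => L fun i => X i ω; P] =
      ∑ i, ∑ j, L (Pi.single j 1) * (L (Pi.single i 1) * cov[X i, X j; P]) := by
  have hL (v : ι → ℝ) : L v = ∑ i, L (Pi.single i 1) * v i := by
    have hv : v = ∑ i, v i • (Pi.single i 1 : ι → ℝ) := by
      ext j
      simp [Finset.sum_apply, Pi.single_apply]
    conv_lhs => rw [hv]
    simp [mul_comm]
  have hLX : AEMeasurable (fun ω => L fun i => X i ω) P := by
    have hmeas i : AEMeasurable (X i) P := (hX i).aestronglyMeasurable.aemeasurable
    fun_prop
  rw [← covariance_self hLX]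
  simp only [hL fun i => X i _]
  rw [covariance_fun_sum_fun_sum (fun i => (hX i).const_mul _) fun i => (hX i).const_mul _]
  simp only [covariance_const_mul_left, covariance_const_mul_right]

theorem identDistrib_of_hasGaussianLaw {Ω' : Type*} {mΩ' : MeasurableSpace Ω'} {P' : Measure Ω'}
    {ι : Type*} [Finite ι] {X : ι → Ω → ℝ} {Y : ι → Ω' → ℝ}
    (hX : HasGaussianLaw (fun ω i => X i ω) P) (hY : HasGaussianLaw (fun ω i => Y i ω) P')
    (hmean : ∀ i, P[X i] = P'[Y i]) (hcov : ∀ i j, cov[X i, X j; P] = cov[Y i, Y j; P']) :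
    IdentDistrib (fun ω i => X i ω) (fun ω i => Y i ω) P P' := by
  classical
  have := Fintype.ofFinite ι
  have := hX.isProbabilityMeasure
  have := hY.isProbabilityMeasure
  have := hX.isGaussian_map
  have := hY.isGaussian_map
  refine ⟨hX.aemeasurable, hY.aemeasurable, Measure.ext_of_charFunDual (funext fun L => ?_)⟩
  have hLmean : ∫ ω, L (fun i => X i ω) ∂P = ∫ ω, L (fun i => Y i ω) ∂P' := by
    rw [L.integral_comp_comm hX.integrable, L.integral_comp_comm hY.integrable]
    congr 1
    ext i
    rw [eval_integral fun i => (hX.eval i).integrable,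
      eval_integral fun i => (hY.eval i).integrable, hmean]
  have hLvar : Var[fun ω => L fun i => X i ω; P] = Var[fun ω => L fun i => Y i ω; P'] := by
    rw [variance_strongDual_comp fun i => (hX.eval i).memLp_two,
      variance_strongDual_comp fun i => (hY.eval i).memLp_two]
    simp only [hcov]
  rw [IsGaussian.charFunDual_eq, IsGaussian.charFunDual_eq,
    integral_map hX.aemeasurable (by fun_prop), integral_map hY.aemeasurable (by fun_prop),
    variance_map (by fun_prop) hX.aemeasurable, variance_map (by fun_prop) hY.aemeasurable]
  simp only [Function.comp_def, integral_complex_ofReal, hLmean, hLvar]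

theorem hasGaussianLaw_of_isGaussianProcess {ι : Type*} [Finite ι] {X : ι → Ω → ℝ}
    (hX : IsGaussianProcess X P) : HasGaussianLaw (fun ω i => X i ω) P := by
  have := Fintype.ofFinite ι
  let L : ({i // i ∈ (Finset.univ : Finset ι)} → ℝ) →L[ℝ] (ι → ℝ) :=
    ContinuousLinearMap.pi fun i => ContinuousLinearMap.proj ⟨i, Finset.mem_univ i⟩
  exact (hX.hasGaussianLaw Finset.univ).map_fun L

theorem fbmCov_div (H : ℝ) {c s t : ℝ} (hc : 0 < c) (hs : 0 ≤ s) (ht : 0 ≤ t) :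
    fbmCov H (s / c) (t / c) = fbmCov H s t / c ^ (2 * H) := by
  rw [fbmCov, fbmCov, ← sub_div, abs_div, abs_of_pos hc, Real.div_rpow hs hc.le,
    Real.div_rpow ht hc.le, Real.div_rpow (abs_nonneg _) hc.le]
  ring

namespace IsFBM

variable {H : ℝ} {B : ℝ≥0 → Ω → ℝ}

theorem cov_eq (hB : IsFBM H B P) (s t : ℝ≥0) : cov[B s, B t; P] = fbmCov H s t := by
  rw [ProbabilityTheory.covariance, hB.centered, hB.centered, ← hB.covariance]
  simp only [sub_zero]

theorem identDistrib_scaled (hB : IsFBM H B P) {ι : Type*} [Finite ι] (τ : ι → ℝ≥0) {c : ℝ≥0}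
    (hc : 0 < c) :
    IdentDistrib (fun ω i => (c : ℝ) ^ H * B (τ i / c) ω) (fun ω i => B (τ i) ω) P P := by
  have hscaled : IsGaussianProcess (fun i ω => (c : ℝ) ^ H * B (τ i / c) ω) P :=
    (hB.isGaussianProcess.comp_right fun i => τ i / c).smul fun _ => (c : ℝ) ^ H
  refine identDistrib_of_hasGaussianLaw (hasGaussianLaw_of_isGaussianProcess hscaled)
    (hasGaussianLaw_of_isGaussianProcess (hB.isGaussianProcess.comp_right τ))
    (fun i => ?_) fun i j => ?_
  · rw [integral_const_mul, hB.centered, mul_zero]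
    exact (hB.centered _).symm
  · have hpow : (c : ℝ) ^ H * (c : ℝ) ^ H = (c : ℝ) ^ (2 * H) := by
      rw [← Real.rpow_add (by exact_mod_cast hc), two_mul]
    rw [covariance_const_mul_left, covariance_const_mul_right, hB.cov_eq, NNReal.coe_div,
      NNReal.coe_div, fbmCov_div H (by exact_mod_cast hc) (τ i).coe_nonneg (τ j).coe_nonneg,
      ← mul_assoc, hpow, mul_div_cancel₀ _ (by positivity)]
    exact (hB.cov_eq _ _).symm

theorem identDistrib_hermiteVariation (hB : IsFBM H B P) (q : ℕ) {n : ℕ} (hn : 1 ≤ n) :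
    IdentDistrib (S H q B n) (hermiteVariation H q B n) P P := by
  let F : (Fin (n + 1) → ℝ) → ℝ := fun v => (n : ℝ) ^ (q * (1 - H) - 1) *
    ∑ k : Fin n, hermiteFun q (v k.succ - v k.castSucc)
  have hF : Measurable F := by
    have hherm := measurable_hermiteFun q
    fun_prop
  have hscaled := hB.identDistrib_scaled (fun i : Fin (n + 1) => ((i : ℕ) : ℝ≥0))
    (c := n) (by exact_mod_cast hn)
  have hS : S H q B n = F ∘ fun ω i => ((n : ℝ≥0) : ℝ) ^ H * B ((i : ℕ) / n) ω := by
    ext ω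
    simp [S, F, Finset.sum_range, mul_sub]
  have hvar : hermiteVariation H q B n = F ∘ fun ω (i : Fin (n + 1)) => B (i : ℕ) ω := by
    ext ω
    simp [hermiteVariation, F, Finset.sum_range, div_eq_inv_mul, ← Real.rpow_neg]
  rw [hS, hvar]
  exact hscaled.comp hF

end IsFBM

end SelfSimilar

section KernelDerivative

/-- The normalizing constant `c_H` of the kernel `K_H`. -/
def constC (H : ℝ) : ℝ :=
  √(H * (2 * H - 1) * Real.Gamma (3 / 2 - H) / (Real.Gamma (2 - 2 * H) * Real.Gamma (H - 1 / 2)))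

/-- The closed form of the derivative `∂₁K_H(u,y)` for `0 < y < u`, extended by `0`. Unlike
`derivK`, it is visibly measurable and nonnegative. -/
def dK (H u y : ℝ) : ℝ :=
  if 0 < y ∧ y < u then constC H * y ^ (1 / 2 - H) * ((u - y) ^ (H - 3 / 2) * u ^ (H - 1 / 2))
  else 0

variable {H s t u v x y : ℝ}

theorem constC_nonneg (H : ℝ) : 0 ≤ constC H := Real.sqrt_nonneg _

theorem dK_of_lt (hy : 0 < y) (hu : y < u) :
    dK H u y = constC H * y ^ (1 / 2 - H) * ((u - y) ^ (H - 3 / 2) * u ^ (H - 1 / 2)) :=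
  if_pos ⟨hy, hu⟩

theorem dK_of_le (hu : u ≤ y) : dK H u y = 0 := if_neg fun h => absurd h.2 hu.not_gt

theorem dK_nonneg (H u y : ℝ) : 0 ≤ dK H u y := by
  rw [dK]
  split_ifs with h
  · have hu : 0 < u := h.1.trans h.2
    have huy : 0 < u - y := sub_pos.2 h.2
    have hy := h.1
    have hc := constC_nonneg H
    positivity
  · exact le_rfl

theorem measurable_dK (H : ℝ) : Measurable fun p : ℝ × ℝ => dK H p.1 p.2 := by
  unfold dK
  refine Measurable.ite ?_ (by fun_prop) measurable_const
  exact (measurableSet_lt measurable_const measurable_snd).inter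
    (measurableSet_lt measurable_snd measurable_fst)

theorem intervalIntegrable_sub_rpow_mul_rpow (hH : 1 / 2 < H) (hs : 0 < s) (hst : s ≤ t) :
    IntervalIntegrable (fun u => (u - s) ^ (H - 3 / 2) * u ^ (H - 1 / 2)) volume s t := by
  refine IntervalIntegrable.mul_continuousOn ?_ fun u hu => ?_
  · simpa using (intervalIntegral.intervalIntegrable_rpow' (a := 0) (b := t - s)
      (r := H - 3 / 2) (by linarith)).comp_sub_right s
  · rw [uIcc_of_le hst] at hu
    exact (Real.continuousAt_rpow_const _ _ (Or.inl (hs.trans_le hu.1).ne')).continuousWithinAt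

theorem derivK_of_lt (h : u < y) : derivK H u y = 0 := by
  have hzero : (fun r => kernelK H r y) =ᶠ[𝓝 u] fun _ => 0 := by
    filter_upwards [eventually_lt_nhds h] with r hr
    rw [kernelK, if_neg hr.not_gt]
  rw [derivK, hzero.deriv_eq, deriv_const]

theorem derivK_eq_dK (hH : 1 / 2 < H) (hy : 0 < y) (huy : u ≠ y) :
    derivK H u y = dK H u y := by
  rcases huy.lt_or_gt with h | h
  · rw [dK_of_le h.le, derivK_of_lt h]
  have hkernel : (fun r => kernelK H r y) =ᶠ[𝓝 u] fun r => constC H * y ^ (1 / 2 - H) *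
      ∫ v in y..r, (v - y) ^ (H - 3 / 2) * v ^ (H - 1 / 2) := by
    filter_upwards [eventually_gt_nhds h] with r hr
    rw [kernelK, if_pos hr, constC]
  have hcont : ContinuousAt (fun v : ℝ => (v - y) ^ (H - 3 / 2) * v ^ (H - 1 / 2)) u := by
    refine ContinuousAt.mul ?_ ?_
    · exact ContinuousAt.rpow_const (by fun_prop) (Or.inl (sub_pos.2 h).ne')
    · exact ContinuousAt.rpow_const (by fun_prop) (Or.inl (hy.trans h).ne')
  have hmeas : Measurable fun v : ℝ => (v - y) ^ (H - 3 / 2) * v ^ (H - 1 / 2) := by fun_prop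
  have hderiv := intervalIntegral.integral_hasDerivAt_right
    (intervalIntegrable_sub_rpow_mul_rpow hH hy h.le)
    hmeas.stronglyMeasurable.stronglyMeasurableAtFilter hcont
  rw [dK_of_lt hy h, derivK, hkernel.deriv_eq]
  exact (hderiv.const_mul _).deriv

theorem intervalIntegrable_dK (hH : 1 / 2 < H) (hy : 0 < y) (a b : ℝ) :
    IntervalIntegrable (fun u => dK H u y) volume a b := by
  suffices hbase : ∀ t, IntervalIntegrable (fun u => dK H u y) volume y t from
    (hbase a).symm.trans (hbase b)
  intro t
  rcases le_total y t with hyt | hty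
  · refine ((intervalIntegrable_sub_rpow_mul_rpow hH hy hyt).const_mul
      (constC H * y ^ (1 / 2 - H))).congr_ae ?_
    rw [uIoc_of_le hyt]
    filter_upwards [ae_restrict_mem measurableSet_Ioc] with u hu
    rw [dK_of_lt hy hu.1]
  · refine (intervalIntegrable_const (c := (0 : ℝ))).congr_ae ?_
    rw [uIoc_of_ge hty]
    filter_upwards [ae_restrict_mem measurableSet_Ioc] with u hu
    rw [dK_of_le hu.2]

theorem kernelK_eq_integral (hs : 0 < s) (hst : s ≤ t) : kernelK H t s = ∫ u in s..t, dK H u s := by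
  rcases hst.eq_or_lt with rfl | h
  · simp [kernelK]
  rw [kernelK, if_pos h, ← intervalIntegral.integral_const_mul]
  refine intervalIntegral.integral_congr_ae (ae_of_all _ fun u hu => ?_)
  rw [uIoc_of_le h.le] at hu
  rw [dK_of_lt hs hu.1, constC]

theorem starFun_eq_integral (hH : 1 / 2 < H) (hs : 0 < s) (hs1 : s ≤ 1) {φ : ℝ → ℝ}
    (hφ : IntervalIntegrable (fun r => φ r * dK H r s) volume s 1) :
    starFun H φ s = ∫ r in s..1, φ r * dK H r s := by
  have hderiv : ∫ r in s..1, (φ r - φ s) * derivK H r s =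
      ∫ r in s..1, (φ r * dK H r s - φ s * dK H r s) := by
    refine intervalIntegral.integral_congr_ae (ae_of_all _ fun r hr => ?_)
    rw [uIoc_of_le hs1] at hr
    rw [derivK_eq_dK hH hs hr.1.ne', sub_mul]
  rw [starFun, hderiv, intervalIntegral.integral_sub hφ
    ((intervalIntegrable_dK hH hs s 1).const_mul _), intervalIntegral.integral_const_mul,
    kernelK_eq_integral hs hs1]
  ring

theorem starFun_stepInd (hH : 1 / 2 < H) (t : Icc (0 : ℝ) 1) (hs : 0 < s) (hs1 : s ≤ 1) :
    starFun H (stepInd t) s = ∫ u in (0 : ℝ)..t, dK H u s := by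
  have hind : EqOn (fun r => stepInd t r * dK H r s)
      ({r : ℝ | r ≤ t}.indicator fun r => dK H r s) (Ioi 0) := by
    intro r hr
    by_cases hrt : r ≤ t <;> simp [stepInd, indicator, hrt, (mem_Ioi.1 hr).le]
  have hint : IntervalIntegrable (fun r => stepInd t r * dK H r s) volume 0 1 := by
    rw [intervalIntegrable_iff_integrableOn_Ioc_of_le zero_le_one]
    refine IntegrableOn.congr_fun (((intervalIntegrable_iff_integrableOn_Ioc_of_le zero_le_one).1
      (intervalIntegrable_dK hH hs 0 1)).indicator measurableSet_Iic)
      (fun r hr => (hind hr.1).symm) measurableSet_Ioc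
  have hs01 : s ∈ uIcc (0 : ℝ) 1 := by rw [uIcc_of_le zero_le_one]; exact ⟨hs.le, hs1⟩
  have hzero : ∫ r in (0 : ℝ)..s, stepInd t r * dK H r s = 0 := by
    refine intervalIntegral.integral_zero_ae (ae_of_all _ fun r hr => ?_)
    rw [uIoc_of_le hs.le] at hr
    rw [dK_of_le hr.2, mul_zero]
  have hint_s1 := hint.mono_set (uIcc_subset_uIcc_right hs01)
  have hsplit := intervalIntegral.integral_add_adjacent_intervals
    (hint.mono_set (uIcc_subset_uIcc_left hs01)) hint_s1
  rw [hzero, zero_add] at hsplit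
  rw [starFun_eq_integral hH hs hs1 hint_s1, hsplit, ← intervalIntegral.integral_indicator t.2]
  refine intervalIntegral.integral_congr_ae (ae_of_all _ fun r hr => ?_)
  rw [uIoc_of_le zero_le_one] at hr
  exact hind hr.1

end KernelDerivative

section CovarianceDensity

variable {H u v x : ℝ}

theorem lintegral_beta {a b : ℝ} (ha : 0 < a) (hb : 0 < b) :
    ∫⁻ x in Ioo (0 : ℝ) 1, ENNReal.ofReal (x ^ (a - 1) * (1 - x) ^ (b - 1)) =
      ENNReal.ofReal (beta a b) := by
  have hpos := beta_pos ha hb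
  have hone := lintegral_betaPDF_eq_one ha hb
  simp only [lintegral_betaPDF, mul_assoc, ENNReal.ofReal_mul (one_div_pos.2 hpos).le] at hone
  rw [lintegral_const_mul _ (by fun_prop)] at hone
  calc ∫⁻ x in Ioo (0 : ℝ) 1, ENNReal.ofReal (x ^ (a - 1) * (1 - x) ^ (b - 1))
      = ENNReal.ofReal (beta a b) * (ENNReal.ofReal (1 / beta a b) *
          ∫⁻ x in Ioo (0 : ℝ) 1, ENNReal.ofReal (x ^ (a - 1) * (1 - x) ^ (b - 1))) := by
        rw [← mul_assoc, ← ENNReal.ofReal_mul hpos.le, mul_one_div_cancel hpos.ne',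
          ENNReal.ofReal_one, one_mul]
    _ = ENNReal.ofReal (beta a b) := by rw [hone, mul_one]

/-- The density `∂²R/∂u∂v = H(2H-1)|u-v|^{2H-2}` of the covariance of fractional Brownian motion,
for `H > 1/2`. -/
def covDensity (H u v : ℝ) : ℝ := H * (2 * H - 1) * |u - v| ^ (2 * H - 2)

theorem covDensity_comm (H u v : ℝ) : covDensity H u v = covDensity H v u := by
  rw [covDensity, covDensity, abs_sub_comm]

theorem constC_sq_mul_beta (hH : 1 / 2 < H) (hH1 : H < 1) :
    constC H * constC H * beta (H - 1 / 2) (2 - 2 * H) = H * (2 * H - 1) := by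
  have hG₁ := Real.Gamma_pos_of_pos (show 0 < 3 / 2 - H by linarith)
  have hG₂ := Real.Gamma_pos_of_pos (show 0 < 2 - 2 * H by linarith)
  have hG₃ := Real.Gamma_pos_of_pos (show 0 < H - 1 / 2 by linarith)
  have hradicand := div_pos (mul_pos (mul_pos (show 0 < H by linarith)
    (show 0 < 2 * H - 1 by linarith)) hG₁) (mul_pos hG₂ hG₃)
  rw [constC, Real.mul_self_sqrt hradicand.le, beta,
    show H - 1 / 2 + (2 - 2 * H) = 3 / 2 - H by ring]
  generalize Real.Gamma (3 / 2 - H) = a at *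
  generalize Real.Gamma (2 - 2 * H) = b at *
  generalize Real.Gamma (H - 1 / 2) = c at *
  field_simp

/-- The Möbius substitution `x ↦ uv(1-x)/(v-ux)` of `(0,1)` onto `(0,u)`, which turns
`∫ ∂₁K_H(u,y) ∂₁K_H(v,y) dy` into a beta integral. -/
def betaSubst (u v x : ℝ) : ℝ := u * v * (1 - x) / (v - u * x)

theorem sub_mul_pos (hu : 0 < u) (huv : u < v) (hx : x < 1) : 0 < v - u * x := by nlinarith

theorem betaSubst_pos (hu : 0 < u) (huv : u < v) (hx : x < 1) : 0 < betaSubst u v x :=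
  div_pos (mul_pos (mul_pos hu (hu.trans huv)) (sub_pos.2 hx)) (sub_mul_pos hu huv hx)

theorem sub_betaSubst_left (hu : 0 < u) (huv : u < v) (hx : x < 1) :
    u - betaSubst u v x = u * x * (v - u) / (v - u * x) := by
  have hden := sub_mul_pos hu huv hx
  rw [betaSubst]
  field_simp
  ring

theorem sub_betaSubst_right (hu : 0 < u) (huv : u < v) (hx : x < 1) :
    v - betaSubst u v x = v * (v - u) / (v - u * x) := by
  have hden := sub_mul_pos hu huv hx
  rw [betaSubst]
  field_simp
  ring

theorem bijOn_betaSubst (hu : 0 < u) (huv : u < v) :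
    BijOn (betaSubst u v) (Ioo 0 1) (Ioo 0 u) := by
  have hv : 0 < v := hu.trans huv
  have hw : 0 < v - u := sub_pos.2 huv
  have hinv : InvOn (fun y => v * (u - y) / (u * (v - y))) (betaSubst u v) (Ioo 0 1) (Ioo 0 u) := by
    refine ⟨fun x hx => ?_, fun y hy => ?_⟩
    · have hden := sub_mul_pos hu huv hx.2
      simp only [sub_betaSubst_left hu huv hx.2, sub_betaSubst_right hu huv hx.2]
      field_simp
    · have hvy : 0 < v - y := sub_pos.2 (hy.2.trans huv)
      have hnum : 1 - v * (u - y) / (u * (v - y)) = y * (v - u) / (u * (v - y)) := by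
        field_simp
        ring
      have hden : v - u * (v * (u - y) / (u * (v - y))) = v * (v - u) / (v - y) := by
        field_simp
        ring
      rw [betaSubst, hnum, hden]
      field_simp
  refine hinv.bijOn (fun x hx => ⟨betaSubst_pos hu huv hx.2, ?_⟩) fun y hy => ?_
  · have hden := sub_mul_pos hu huv hx.2
    have hx0 := hx.1
    rw [← sub_pos, sub_betaSubst_left hu huv hx.2]
    positivity
  · have hvy : 0 < v - y := sub_pos.2 (hy.2.trans huv)
    have huy : 0 < u - y := sub_pos.2 hy.2
    refine ⟨by positivity, ?_⟩
    rw [div_lt_one (by positivity)]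
    nlinarith [mul_pos hy.1 hw]

theorem hasDerivAt_betaSubst (hu : 0 < u) (huv : u < v) (hx : x < 1) :
    HasDerivAt (betaSubst u v) (-(u * v * (v - u)) / (v - u * x) ^ 2) x := by
  have hnum : HasDerivAt (fun x => u * v * (1 - x)) (u * v * (-1)) x :=
    ((hasDerivAt_id x).const_sub 1).const_mul (u * v)
  have hden : HasDerivAt (fun x => v - u * x) (-(u * 1)) x :=
    ((hasDerivAt_id x).const_mul u).const_sub v
  refine (hnum.fun_div hden (sub_mul_pos hu huv hx).ne').congr_deriv ?_
  congr 1
  ring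

-- With the arguments below, all powers of `uv` and of the denominator `v - ux` cancel.
theorem jacobian_mul_rpow_mul_rpow {P w D z : ℝ} (H : ℝ) (hP : 0 < P) (hw : 0 < w) (hD : 0 < D)
    (hx : 0 < x) (hz : 0 < z) :
    P * w / D ^ 2 * ((P * z / D) ^ (1 - 2 * H) *
        ((P * x * w ^ 2 / D ^ 2) ^ (H - 3 / 2) * P ^ (H - 1 / 2))) =
      w ^ (2 * H - 2) * (x ^ (H - 1 / 2 - 1) * z ^ (2 - 2 * H - 1)) := by
  rw [← Real.exp_log hP, ← Real.exp_log hw, ← Real.exp_log hD, ← Real.exp_log hx,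
    ← Real.exp_log hz]
  simp only [← Real.exp_add, ← Real.exp_sub, ← Real.exp_mul, ← Real.exp_nat_mul]
  congr 1
  push_cast
  ring

theorem dK_mul_dK (hv : 0 < v) (hu : 0 < u) {y : ℝ} (hy : 0 < y) (hyu : y < u) (hyv : y < v) :
    dK H u y * dK H v y = constC H * constC H *
      (y ^ (1 - 2 * H) * (((u - y) * (v - y)) ^ (H - 3 / 2) * (u * v) ^ (H - 1 / 2))) := by
  rw [dK_of_lt hy hyu, dK_of_lt hy hyv, Real.mul_rpow (sub_pos.2 hyu).le (sub_pos.2 hyv).le,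
    Real.mul_rpow hu.le hv.le, show 1 - 2 * H = 1 / 2 - H + (1 / 2 - H) by ring,
    Real.rpow_add hy]
  ring

theorem abs_deriv_betaSubst_mul_dK_mul_dK (hu : 0 < u) (huv : u < v) (hx : x ∈ Ioo (0 : ℝ) 1) :
    |-(u * v * (v - u)) / (v - u * x) ^ 2| *
        (dK H u (betaSubst u v x) * dK H v (betaSubst u v x)) =
      constC H * constC H * (v - u) ^ (2 * H - 2) *
        (x ^ (H - 1 / 2 - 1) * (1 - x) ^ (2 - 2 * H - 1)) := by
  have hv : 0 < v := hu.trans huv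
  have hx1 : 0 < 1 - x := sub_pos.2 hx.2
  have hw : 0 < v - u := sub_pos.2 huv
  have hD := sub_mul_pos hu huv hx.2
  have hlt : betaSubst u v x < u := ((bijOn_betaSubst hu huv).mapsTo hx).2
  have hprod : (u - betaSubst u v x) * (v - betaSubst u v x) =
      u * v * x * (v - u) ^ 2 / (v - u * x) ^ 2 := by
    rw [sub_betaSubst_left hu huv hx.2, sub_betaSubst_right hu huv hx.2, div_mul_div_comm]
    congr 1 <;> ring
  rw [dK_mul_dK hv hu (betaSubst_pos hu huv hx.2) hlt (hlt.trans huv), hprod, betaSubst, neg_div,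
    abs_neg, abs_of_pos (by positivity)]
  linear_combination constC H * constC H *
    jacobian_mul_rpow_mul_rpow H (mul_pos hu hv) hw hD hx.1 hx1

theorem lintegral_dK_mul_dK_of_lt (hH : 1 / 2 < H) (hH1 : H < 1) (hu : 0 < u) (huv : u < v) :
    ∫⁻ y, ENNReal.ofReal (dK H u y) * ENNReal.ofReal (dK H v y) =
      ENNReal.ofReal (covDensity H u v) := by
  have hw : 0 < v - u := sub_pos.2 huv
  have hcoef : 0 ≤ constC H * constC H * (v - u) ^ (2 * H - 2) :=
    mul_nonneg (mul_self_nonneg _) (Real.rpow_nonneg hw.le _)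
  have hsupp : Function.support (fun y => ENNReal.ofReal (dK H u y) * ENNReal.ofReal (dK H v y)) ⊆
      Ioo 0 u := by
    refine Function.support_subset_iff'.2 fun y hy => ?_
    have hdK : dK H u y = 0 := if_neg hy
    rw [hdK, ENNReal.ofReal_zero, zero_mul]
  calc ∫⁻ y, ENNReal.ofReal (dK H u y) * ENNReal.ofReal (dK H v y)
      = ∫⁻ x in Ioo 0 1, ENNReal.ofReal |-(u * v * (v - u)) / (v - u * x) ^ 2| *
          (ENNReal.ofReal (dK H u (betaSubst u v x)) *
            ENNReal.ofReal (dK H v (betaSubst u v x))) := by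
        rw [← setLIntegral_eq_of_support_subset hsupp, ← (bijOn_betaSubst hu huv).image_eq,
          lintegral_image_eq_lintegral_abs_deriv_mul measurableSet_Ioo
            (fun x hx => (hasDerivAt_betaSubst hu huv hx.2).hasDerivWithinAt)
            (bijOn_betaSubst hu huv).injOn]
    _ = ∫⁻ x in Ioo 0 1, ENNReal.ofReal (constC H * constC H * (v - u) ^ (2 * H - 2)) *
          ENNReal.ofReal (x ^ (H - 1 / 2 - 1) * (1 - x) ^ (2 - 2 * H - 1)) := by
        refine setLIntegral_congr_fun measurableSet_Ioo fun x hx => ?_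
        rw [← ENNReal.ofReal_mul (dK_nonneg _ _ _), ← ENNReal.ofReal_mul (abs_nonneg _),
          abs_deriv_betaSubst_mul_dK_mul_dK hu huv hx, ENNReal.ofReal_mul hcoef]
    _ = ENNReal.ofReal (covDensity H u v) := by
        rw [lintegral_const_mul _ (by fun_prop), lintegral_beta (by linarith) (by linarith),
          ← ENNReal.ofReal_mul hcoef, covDensity, abs_sub_comm, abs_of_pos hw,
          ← constC_sq_mul_beta hH hH1]
        congr 1
        ring

theorem lintegral_dK_mul_dK (hH : 1 / 2 < H) (hH1 : H < 1) (hu : u ∈ Ioc (0 : ℝ) 1)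
    (hv : 0 < v) (huv : u ≠ v) :
    ∫⁻ y, ENNReal.ofReal (dK H u y) * ENNReal.ofReal (dK H v y) ∂unitMeasure =
      ENNReal.ofReal (covDensity H u v) := by
  have hsupp : Function.support (fun y => ENNReal.ofReal (dK H u y) * ENNReal.ofReal (dK H v y)) ⊆
      Icc 0 1 := by
    refine Function.support_subset_iff'.2 fun y hy => ?_
    rw [dK, if_neg fun h => hy ⟨h.1.le, h.2.le.trans hu.2⟩, ENNReal.ofReal_zero, zero_mul]
  rw [unitMeasure, setLIntegral_eq_of_support_subset hsupp]
  rcases huv.lt_or_gt with h | h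
  · exact lintegral_dK_mul_dK_of_lt hH hH1 hu.1 h
  · rw [covDensity_comm, ← lintegral_dK_mul_dK_of_lt hH hH1 hv h]
    simp only [mul_comm]

end CovarianceDensity

section Tonelli

variable {U V Y : Type*} [MeasurableSpace U] [MeasurableSpace V] [MeasurableSpace Y]

theorem lintegral_lintegral_mul_lintegral {μ : Measure U} {ν : Measure V} {κ : Measure Y}
    [SFinite μ] [SFinite ν] [SFinite κ] {f : U → Y → ℝ≥0∞} {g : V → Y → ℝ≥0∞}
    (hf : Measurable (Function.uncurry f)) (hg : Measurable (Function.uncurry g)) :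
    ∫⁻ y, (∫⁻ u, f u y ∂μ) * ∫⁻ v, g v y ∂ν ∂κ = ∫⁻ u, ∫⁻ v, ∫⁻ y, f u y * g v y ∂κ ∂ν ∂μ := by
  have hmeas : Measurable fun p : (Y × U) × V => f p.1.2 p.1.1 * g p.2 p.1.1 :=
    (hf.comp (f := fun p : (Y × U) × V => (p.1.2, p.1.1)) (by fun_prop)).mul
      (hg.comp (f := fun p : (Y × U) × V => (p.2, p.1.1)) (by fun_prop))
  calc ∫⁻ y, (∫⁻ u, f u y ∂μ) * ∫⁻ v, g v y ∂ν ∂κ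
      = ∫⁻ y, ∫⁻ u, ∫⁻ v, f u y * g v y ∂ν ∂μ ∂κ := by
        refine lintegral_congr fun y => (lintegral_lintegral_mul ?_ ?_).symm
        · exact (hf.comp (measurable_id.prodMk measurable_const)).aemeasurable
        · exact (hg.comp (measurable_id.prodMk measurable_const)).aemeasurable
    _ = ∫⁻ u, ∫⁻ y, ∫⁻ v, f u y * g v y ∂ν ∂κ ∂μ :=
        lintegral_lintegral_swap hmeas.lintegral_prod_right'.aemeasurable
    _ = ∫⁻ u, ∫⁻ v, ∫⁻ y, f u y * g v y ∂κ ∂ν ∂μ := by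
        refine lintegral_congr fun u => lintegral_lintegral_swap (Measurable.aemeasurable ?_)
        exact hmeas.comp (f := fun p : Y × V => ((p.1, u), p.2)) (by fun_prop)

variable {μ : Measure Y} {f g : Y → ℝ≥0∞}

theorem memLp_two_toReal (hf : AEMeasurable f μ) (h : ∫⁻ y, f y * f y ∂μ ≠ ∞) :
    MemLp (fun y => (f y).toReal) 2 μ := by
  rw [memLp_two_iff_integrable_sq hf.ennreal_toReal.aestronglyMeasurable]
  refine (integrable_toReal_of_lintegral_ne_top (hf.mul hf) h).congr (ae_of_all _ fun y => ?_)
  simp only [Pi.mul_apply, ENNReal.toReal_mul, sq]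

theorem ae_lt_top_of_lintegral_mul_self (hf : AEMeasurable f μ) (h : ∫⁻ y, f y * f y ∂μ ≠ ∞) :
    ∀ᵐ y ∂μ, f y < ∞ := by
  filter_upwards [ae_lt_top' (hf.mul hf) h] with y hy
  exact (ENNReal.mul_self_lt_top_iff).1 hy

theorem lintegral_mul_ne_top (hf : AEMeasurable f μ) (hff : ∫⁻ y, f y * f y ∂μ ≠ ∞)
    (hgg : ∫⁻ y, g y * g y ∂μ ≠ ∞) : ∫⁻ y, f y * g y ∂μ ≠ ∞ := by
  refine ne_top_of_le_ne_top (ENNReal.add_ne_top.2 ⟨hff, hgg⟩) ?_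
  have hmeas : AEMeasurable (fun y => f y * f y) μ := hf.mul hf
  rw [← lintegral_add_left' hmeas]
  refine lintegral_mono fun y => ?_
  rcases le_total (f y) (g y) with hfg | hgf
  · exact (mul_le_mul_left hfg _).trans le_add_self
  · exact (mul_le_mul_right hgf _).trans le_self_add

theorem inner_toL2_toReal (hf : AEMeasurable f μ) (hg : AEMeasurable g μ)
    (hff : ∫⁻ y, f y * f y ∂μ ≠ ∞) (hgg : ∫⁻ y, g y * g y ∂μ ≠ ∞) :
    inner ℝ (toL2 μ fun y => (f y).toReal) (toL2 μ fun y => (g y).toReal) =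
      (∫⁻ y, f y * g y ∂μ).toReal := by
  rw [inner_toL2 (memLp_two_toReal hf hff) (memLp_two_toReal hg hgg)]
  simp_rw [← ENNReal.toReal_mul]
  exact integral_toReal (hf.mul hg) (ae_lt_top' (hf.mul hg) (lintegral_mul_ne_top hf hff hgg))

end Tonelli

section CovarianceIntegral

variable {H r a b s t u : ℝ}

theorem setLIntegral_Ioc_ofReal {f : ℝ → ℝ} (hab : a ≤ b) (hf : IntervalIntegrable f volume a b)
    (hnonneg : ∀ x ∈ Ioc a b, 0 ≤ f x) :
    ∫⁻ x in Ioc a b, ENNReal.ofReal (f x) = ENNReal.ofReal (∫ x in a..b, f x) := by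
  rw [intervalIntegral.integral_of_le hab, ofReal_integral_eq_lintegral_ofReal
    ((intervalIntegrable_iff_integrableOn_Ioc_of_le hab).1 hf)]
  filter_upwards [ae_restrict_mem measurableSet_Ioc] with x hx using hnonneg x hx

theorem lintegral_sub_left_rpow (hr : -1 < r) (hab : a ≤ b) :
    ∫⁻ x in Ioc a b, ENNReal.ofReal ((x - a) ^ r) =
      ENNReal.ofReal ((b - a) ^ (r + 1) / (r + 1)) := by
  rw [setLIntegral_Ioc_ofReal hab ?_ fun x hx => Real.rpow_nonneg (sub_nonneg.2 hx.1.le) r,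
    intervalIntegral.integral_comp_sub_right (fun x => x ^ r), sub_self,
    integral_rpow (Or.inl hr), Real.zero_rpow (by linarith), sub_zero]
  simpa using (intervalIntegral.intervalIntegrable_rpow' (a := 0) (b := b - a) hr).comp_sub_right a

theorem lintegral_sub_right_rpow (hr : -1 < r) (hab : a ≤ b) :
    ∫⁻ x in Ioc a b, ENNReal.ofReal ((b - x) ^ r) =
      ENNReal.ofReal ((b - a) ^ (r + 1) / (r + 1)) := by
  rw [setLIntegral_Ioc_ofReal hab ?_ fun x hx => Real.rpow_nonneg (sub_nonneg.2 hx.2) r,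
    intervalIntegral.integral_comp_sub_left (fun x => x ^ r), sub_self,
    integral_rpow (Or.inl hr), Real.zero_rpow (by linarith), sub_zero]
  simpa using (intervalIntegral.intervalIntegrable_rpow' (a := b - a) (b := 0) hr).comp_sub_left b

theorem lintegral_abs_sub_rpow (hr : -1 < r) (hau : a ≤ u) (hub : u ≤ b) :
    ∫⁻ v in Ioc a b, ENNReal.ofReal (|u - v| ^ r) =
      ENNReal.ofReal ((u - a) ^ (r + 1) / (r + 1)) +
        ENNReal.ofReal ((b - u) ^ (r + 1) / (r + 1)) := by
  rw [← Ioc_union_Ioc_eq_Ioc hau hub, lintegral_union measurableSet_Ioc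
    (Ioc_disjoint_Ioc_of_le le_rfl), ← lintegral_sub_right_rpow hr hau,
    ← lintegral_sub_left_rpow hr hub]
  congr 1
  · refine setLIntegral_congr_fun measurableSet_Ioc fun v hv => ?_
    simp only [abs_of_nonneg (sub_nonneg.2 hv.2)]
  · refine setLIntegral_congr_fun measurableSet_Ioc fun v hv => ?_
    simp only [abs_sub_comm u, abs_of_pos (sub_pos.2 hv.1)]

theorem measurable_covDensity (H : ℝ) : Measurable fun p : ℝ × ℝ => covDensity H p.1 p.2 := by
  unfold covDensity
  fun_prop

theorem covDensity_nonneg (hH : 1 / 2 < H) (u v : ℝ) : 0 ≤ covDensity H u v :=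
  mul_nonneg (mul_nonneg (by linarith) (by linarith)) (Real.rpow_nonneg (abs_nonneg _) _)

theorem lintegral_covDensity_right (hH : 1 / 2 < H) (hu : 0 ≤ u) (hut : u ≤ t) :
    ∫⁻ v in Ioc 0 t, ENNReal.ofReal (covDensity H u v) =
      ENNReal.ofReal (H * u ^ (2 * H - 1) + H * (t - u) ^ (2 * H - 1)) := by
  have h2H : 0 < 2 * H - 1 := by linarith
  have hcoef : 0 ≤ H * (2 * H - 1) := mul_nonneg (by linarith) h2H.le
  have hpow : ∀ x : ℝ, 0 ≤ x → 0 ≤ x ^ (2 * H - 1) / (2 * H - 1) := fun x hx =>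
    div_nonneg (Real.rpow_nonneg hx _) h2H.le
  simp only [covDensity, ENNReal.ofReal_mul hcoef]
  rw [lintegral_const_mul _ (by fun_prop), lintegral_abs_sub_rpow (by linarith) hu hut, sub_zero,
    show 2 * H - 2 + 1 = 2 * H - 1 by ring,
    ← ENNReal.ofReal_add (hpow u hu) (hpow _ (sub_nonneg.2 hut)), ← ENNReal.ofReal_mul hcoef,
    ← add_div, mul_assoc, mul_div_cancel₀ _ h2H.ne', mul_add]

theorem lintegral_covDensity_of_le (hH : 1 / 2 < H) (hs : 0 ≤ s) (hst : s ≤ t) :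
    ∫⁻ u in Ioc 0 s, ∫⁻ v in Ioc 0 t, ENNReal.ofReal (covDensity H u v) =
      ENNReal.ofReal (fbmCov H s t) := by
  have hH0 : 0 < H := by linarith
  have hint : IntervalIntegrable (fun u : ℝ => H * u ^ (2 * H - 1)) volume 0 s :=
    (intervalIntegral.intervalIntegrable_rpow' (by linarith)).const_mul H
  have hint' : IntervalIntegrable (fun u : ℝ => H * (t - u) ^ (2 * H - 1)) volume 0 s := by
    simpa using ((intervalIntegral.intervalIntegrable_rpow' (a := t) (b := t - s)
      (r := 2 * H - 1) (by linarith)).comp_sub_left t).const_mul H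
  have hnonneg : ∀ u ∈ Ioc 0 s, 0 ≤ H * u ^ (2 * H - 1) + H * (t - u) ^ (2 * H - 1) := fun u hu =>
    add_nonneg (mul_nonneg hH0.le (Real.rpow_nonneg hu.1.le _))
      (mul_nonneg hH0.le (Real.rpow_nonneg (sub_nonneg.2 (hu.2.trans hst)) _))
  rw [setLIntegral_congr_fun measurableSet_Ioc fun u hu =>
      lintegral_covDensity_right hH hu.1.le (hu.2.trans hst),
    setLIntegral_Ioc_ofReal hs (hint.add hint') hnonneg, intervalIntegral.integral_add hint hint',
    intervalIntegral.integral_const_mul, intervalIntegral.integral_const_mul,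
    intervalIntegral.integral_comp_sub_left (fun x : ℝ => x ^ (2 * H - 1)) t,
    integral_rpow (Or.inl (by linarith)), integral_rpow (Or.inl (by linarith)), fbmCov,
    abs_of_nonneg (sub_nonneg.2 hst), sub_add_cancel, Real.zero_rpow (by linarith), sub_zero t]
  congr 1
  field_simp
  ring

theorem lintegral_covDensity (hH : 1 / 2 < H) (hs : 0 ≤ s) (ht : 0 ≤ t) :
    ∫⁻ u in Ioc 0 s, ∫⁻ v in Ioc 0 t, ENNReal.ofReal (covDensity H u v) =
      ENNReal.ofReal (fbmCov H s t) := by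
  rcases le_total s t with h | h
  · exact lintegral_covDensity_of_le hH hs h
  · rw [lintegral_lintegral_swap (measurable_covDensity H).ennreal_ofReal.aemeasurable,
      fbmCov_comm, ← lintegral_covDensity_of_le hH ht h]
    simp_rw [covDensity_comm H]

theorem fbmCov_nonneg (hH : 0 ≤ H) (hs : 0 ≤ s) (ht : 0 ≤ t) : 0 ≤ fbmCov H s t := by
  wlog hst : s ≤ t generalizing s t
  · rw [fbmCov_comm]
    exact this ht hs (not_le.1 hst).le
  have hs2H := Real.rpow_nonneg hs (2 * H)
  have hsub : (t - s) ^ (2 * H) ≤ t ^ (2 * H) :=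
    Real.rpow_le_rpow (sub_nonneg.2 hst) (by linarith) (by linarith)
  rw [fbmCov, abs_of_nonneg (sub_nonneg.2 hst)]
  linarith

end CovarianceIntegral

section Kstar

instance : IsFiniteMeasure unitMeasure := by
  unfold unitMeasure
  infer_instance

theorem ae_unitMeasure_mem : ∀ᵐ y ∂unitMeasure, y ∈ Ioc (0 : ℝ) 1 := by
  rw [unitMeasure, ← Measure.restrict_congr_set Ioc_ae_eq_Icc]
  exact ae_restrict_mem measurableSet_Ioc

/-- The function `y ↦ ∫_A ∂₁K_H(u,y) du`, which is `K_H^* 1_A`. -/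
def kernelInt (H : ℝ) (A : Set ℝ) (y : ℝ) : ℝ≥0∞ := ∫⁻ u in A, ENNReal.ofReal (dK H u y)

theorem measurable_ofReal_dK (H : ℝ) :
    Measurable (Function.uncurry fun u y => ENNReal.ofReal (dK H u y)) :=
  (measurable_dK H).ennreal_ofReal

theorem measurable_kernelInt (H : ℝ) (A : Set ℝ) : Measurable (kernelInt H A) :=
  (measurable_ofReal_dK H).lintegral_prod_left'

theorem toReal_kernelInt_Ioc {H y a b : ℝ} (hab : a ≤ b) :
    (kernelInt H (Ioc a b) y).toReal = ∫ u in a..b, dK H u y := by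
  rw [intervalIntegral.integral_of_le hab, kernelInt, integral_eq_lintegral_of_nonneg_ae]
  · exact ae_of_all _ fun u => dK_nonneg _ _ _
  · exact ((measurable_dK H).comp (f := fun u => (u, y)) (by fun_prop)).aestronglyMeasurable

theorem lintegral_kernelInt_mul {H : ℝ} (hH : 1 / 2 < H) (hH1 : H < 1) {A A' : Set ℝ}
    (hA : MeasurableSet A) (hA' : MeasurableSet A') (hA1 : A ⊆ Ioc 0 1) (hA0' : A' ⊆ Ioi 0) :
    ∫⁻ y, kernelInt H A y * kernelInt H A' y ∂unitMeasure =
      ∫⁻ u in A, ∫⁻ v in A', ENNReal.ofReal (covDensity H u v) := by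
  simp only [kernelInt]
  rw [lintegral_lintegral_mul_lintegral (measurable_ofReal_dK H) (measurable_ofReal_dK H)]
  refine setLIntegral_congr_fun hA fun u hu => lintegral_congr_ae ?_
  filter_upwards [ae_restrict_mem hA', ae_restrict_of_ae (Measure.ae_ne volume u)] with v hv hne
  exact lintegral_dK_mul_dK hH hH1 (hA1 hu) (hA0' hv) hne.symm

variable {H : Ioo (0 : ℝ) 1}

theorem lintegral_kernelInt_Ioc (hH : 1 / 2 < (H : ℝ)) (s t : Icc (0 : ℝ) 1) :
    ∫⁻ y, kernelInt H (Ioc 0 s) y * kernelInt H (Ioc 0 t) y ∂unitMeasure =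
      ENNReal.ofReal (fbmCov H s t) := by
  rw [lintegral_kernelInt_mul hH H.2.2 measurableSet_Ioc measurableSet_Ioc
    (Ioc_subset_Ioc_right s.2.2) Ioc_subset_Ioi_self, lintegral_covDensity hH s.2.1 t.2.1]

theorem lintegral_kernelInt_Ioc_ne_top (hH : 1 / 2 < (H : ℝ)) (t : Icc (0 : ℝ) 1) :
    ∫⁻ y, kernelInt H (Ioc 0 t) y * kernelInt H (Ioc 0 t) y ∂unitMeasure ≠ ∞ := by
  rw [lintegral_kernelInt_Ioc hH]
  exact ENNReal.ofReal_ne_top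

theorem memLp_kernelInt_Ioc (hH : 1 / 2 < (H : ℝ)) (t : Icc (0 : ℝ) 1) :
    MemLp (fun y => (kernelInt H (Ioc 0 t) y).toReal) 2 unitMeasure :=
  memLp_two_toReal (measurable_kernelInt _ _).aemeasurable (lintegral_kernelInt_Ioc_ne_top hH t)

theorem toL2_starFun_stepInd (hH : 1 / 2 < (H : ℝ)) (t : Icc (0 : ℝ) 1) :
    toL2 unitMeasure (starFun H (stepInd t)) =
      toL2 unitMeasure fun y => (kernelInt H (Ioc 0 t) y).toReal := by
  refine toL2_congr ?_
  filter_upwards [ae_unitMeasure_mem] with y hy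
  rw [starFun_stepInd hH t hy.1 hy.2, toReal_kernelInt_Ioc t.2.1]

theorem inner_toL2_starFun (hH : 1 / 2 < (H : ℝ)) (s t : Icc (0 : ℝ) 1) :
    inner ℝ (toL2 unitMeasure (starFun H (stepInd s))) (toL2 unitMeasure (starFun H (stepInd t))) =
      1 * inner ℝ (ind H s) (ind H t) := by
  rw [toL2_starFun_stepInd hH, toL2_starFun_stepInd hH,
    inner_toL2_toReal (measurable_kernelInt _ _).aemeasurable
      (measurable_kernelInt _ _).aemeasurable (lintegral_kernelInt_Ioc_ne_top hH s)
      (lintegral_kernelInt_Ioc_ne_top hH t),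
    lintegral_kernelInt_Ioc hH, ENNReal.toReal_ofReal (fbmCov_nonneg H.2.1.le s.2.1 t.2.1),
    inner_ind, one_mul]

theorem isExtension_Kstar (hH : 1 / 2 < (H : ℝ)) :
    IsExtension (ind H) (fun t => toL2 unitMeasure (starFun H (stepInd t))) (Kstar H) :=
  isExtension_extension (exists_isExtension zero_le_one (inner_toL2_starFun hH))

theorem inner_Kstar (hH : 1 / 2 < (H : ℝ)) (x y : FBMSpace H) :
    inner ℝ (Kstar H x) (Kstar H y) = inner ℝ x y := by
  rw [(isExtension_Kstar hH).inner_eq (inner_toL2_starFun hH), one_mul] <;>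
  simp [closedSpan_ind]

theorem Kstar_ind (hH : 1 / 2 < (H : ℝ)) (t : Icc (0 : ℝ) 1) :
    Kstar H (ind H t) =ᵐ[unitMeasure] fun y => (kernelInt H (Ioc 0 t) y).toReal := by
  have hKstar : Kstar H (ind H t) = toL2 unitMeasure fun y => (kernelInt H (Ioc 0 t) y).toReal :=
    ((isExtension_Kstar hH).1 t).trans (toL2_starFun_stepInd hH t)
  rw [hKstar]
  exact coeFn_toL2 (memLp_kernelInt_Ioc hH t)

end Kstar

section AbelInversion

variable {y t : ℝ}

theorem ae_eq_zero_of_intervalIntegral_eq_zero {f : ℝ → ℝ} (hf : Integrable f unitMeasure)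
    (h : ∀ t ∈ Icc (0 : ℝ) 1, ∫ u in (0 : ℝ)..t, f u = 0) : f =ᵐ[unitMeasure] 0 := by
  have hf' : IntervalIntegrable f volume 0 1 := by
    rw [intervalIntegrable_iff_integrableOn_Ioc_of_le zero_le_one]
    exact (show IntegrableOn f (Icc 0 1) volume from hf).mono_set Ioc_subset_Icc_self
  have hmem : ∀ᵐ x ∂unitMeasure, x ∈ Ioo (0 : ℝ) 1 := by
    rw [unitMeasure, ← Measure.restrict_congr_set Ioo_ae_eq_Icc]
    exact ae_restrict_mem measurableSet_Ioo
  filter_upwards [hmem, ae_restrict_of_ae hf'.ae_hasDerivAt_integral] with x hx hderiv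
  have hzero : (fun x => ∫ u in (0 : ℝ)..x, f u) =ᶠ[𝓝 x] fun _ => 0 := by
    filter_upwards [Ioo_mem_nhds hx.1 hx.2] with t ht using h t (Ioo_subset_Icc_self ht)
  rw [uIcc_of_le zero_le_one] at hderiv
  exact (hderiv (Ioo_subset_Icc_self hx) 0 (left_mem_Icc.2 zero_le_one)).unique
    ((hasDerivAt_const x (0 : ℝ)).congr_of_eventuallyEq hzero)

theorem integrable_prod_mul_of_memLp_integral_norm {Y U : Type*} [MeasurableSpace Y]
    [MeasurableSpace U] {ν : Measure Y} {μ : Measure U} [SFinite μ] {k : Y → U → ℝ}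
    {g : Y → ℝ} (hk : AEStronglyMeasurable (Function.uncurry k) (ν.prod μ))
    (hint : ∀ᵐ y ∂ν, Integrable (k y) μ) (hL2 : MemLp (fun y => ∫ u, ‖k y u‖ ∂μ) 2 ν)
    (hg : MemLp g 2 ν) : Integrable (fun p : Y × U => k p.1 p.2 * g p.1) (ν.prod μ) := by
  have hmeas : AEStronglyMeasurable (fun p : Y × U => k p.1 p.2 * g p.1) (ν.prod μ) :=
    hk.mul hg.aestronglyMeasurable.comp_fst
  refine (integrable_prod_iff hmeas).2 ⟨?_, ?_⟩
  · filter_upwards [hint] with y hy using hy.mul_const _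
  · refine (hL2.integrable_mul hg.norm).congr (ae_of_all _ fun y => ?_)
    simp only [Pi.mul_apply, norm_mul, integral_mul_const]

theorem lintegral_beta_Ioo {a b : ℝ} (ha : 0 < a) (hb : 0 < b) (hyt : y < t) :
    ∫⁻ u in Ioo y t, ENNReal.ofReal ((u - y) ^ (a - 1) * (t - u) ^ (b - 1)) =
      ENNReal.ofReal ((t - y) ^ (a + b - 1) * beta a b) := by
  have hw : 0 < t - y := sub_pos.2 hyt
  have himage : (fun x => (t - y) * x + y) '' Ioo 0 1 = Ioo y t := by
    rw [image_affine_Ioo hw]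
    simp
  have hderiv : ∀ x ∈ Ioo (0 : ℝ) 1,
      HasDerivWithinAt (fun x => (t - y) * x + y) (t - y) (Ioo 0 1) x := fun x _ => by
    simpa using (((hasDerivAt_id x).const_mul (t - y)).add_const y).hasDerivWithinAt
  have hinj : InjOn (fun x => (t - y) * x + y) (Ioo 0 1) := fun x _ x' _ h =>
    mul_left_cancel₀ hw.ne' (add_right_cancel h)
  rw [← himage, lintegral_image_eq_lintegral_abs_deriv_mul measurableSet_Ioo hderiv hinj,
    ENNReal.ofReal_mul (Real.rpow_nonneg hw.le _), ← lintegral_beta ha hb,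
    ← lintegral_const_mul _ (by fun_prop)]
  refine setLIntegral_congr_fun measurableSet_Ioo fun x hx => ?_
  have hpow : (t - y) * ((t - y) ^ (a - 1) * (t - y) ^ (b - 1)) = (t - y) ^ (a + b - 1) := by
    rw [show a + b - 1 = 1 + (a - 1 + (b - 1)) by ring, Real.rpow_add hw, Real.rpow_one,
      Real.rpow_add hw]
  simp only [← ENNReal.ofReal_mul (abs_nonneg _), ← ENNReal.ofReal_mul (Real.rpow_nonneg hw.le _)]
  rw [abs_of_pos hw, add_sub_cancel_right,
    show t - ((t - y) * x + y) = (t - y) * (1 - x) by ring, Real.mul_rpow hw.le hx.1.le,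
    Real.mul_rpow hw.le (sub_pos.2 hx.2).le, ← hpow]
  ring_nf

/-- The weight inverting the Abel transform contained in `∂₁K_H`: the integral of
`abelWeight H t · ∂₁K_H(·,y)` over `(y,t)` is proportional to `y^{1/2-H}`, with a factor that does
not depend on `t`. -/
def abelWeight (H t u : ℝ) : ℝ := (t - u) ^ (1 / 2 - H) * u ^ (1 / 2 - H)

theorem abelWeight_nonneg {H u : ℝ} (hu : u ∈ Ioo 0 t) : 0 ≤ abelWeight H t u :=
  mul_nonneg (Real.rpow_nonneg (sub_pos.2 hu.2).le _) (Real.rpow_nonneg hu.1.le _)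

theorem measurable_abelWeight_mul_dK (H t : ℝ) :
    Measurable fun p : ℝ × ℝ => abelWeight H t p.2 * dK H p.2 p.1 := by
  unfold abelWeight
  exact Measurable.mul (by fun_prop) ((measurable_dK H).comp measurable_swap)

theorem abelWeight_mul_dK {H u : ℝ} (hy : 0 < y) (hyu : y < u) :
    abelWeight H t u * dK H u y = constC H * y ^ (1 / 2 - H) *
      ((u - y) ^ (H - 1 / 2 - 1) * (t - u) ^ (3 / 2 - H - 1)) := by
  have hcancel : u ^ (1 / 2 - H) * u ^ (H - 1 / 2) = 1 := by
    rw [← Real.rpow_add (hy.trans hyu), sub_add_sub_cancel', sub_self, Real.rpow_zero]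
  rw [abelWeight, dK_of_lt hy hyu, show H - 1 / 2 - 1 = H - 3 / 2 by ring,
    show 3 / 2 - H - 1 = 1 / 2 - H by ring]
  linear_combination
    (constC H * y ^ (1 / 2 - H) * (u - y) ^ (H - 3 / 2) * (t - u) ^ (1 / 2 - H)) * hcancel

theorem lintegral_abelWeight_mul_dK {H : ℝ} (hH : 1 / 2 < H) (hH1 : H < 1) (hy : y ∈ Ioo 0 t) :
    ∫⁻ u in Ioo 0 t, ENNReal.ofReal (abelWeight H t u * dK H u y) =
      ENNReal.ofReal (constC H * beta (H - 1 / 2) (3 / 2 - H) * y ^ (1 / 2 - H)) := by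
  have hcoef : 0 ≤ constC H * y ^ (1 / 2 - H) :=
    mul_nonneg (constC_nonneg H) (Real.rpow_nonneg hy.1.le _)
  have hzero : ∫⁻ u in Ioc 0 y, ENNReal.ofReal (abelWeight H t u * dK H u y) = 0 := by
    refine (setLIntegral_congr_fun measurableSet_Ioc fun u hu => ?_).trans lintegral_zero
    rw [dK_of_le hu.2, mul_zero, ENNReal.ofReal_zero]
  rw [← Ioc_union_Ioo_eq_Ioo hy.1.le hy.2, lintegral_union measurableSet_Ioo
    (disjoint_left.2 fun u hu hu' => hu'.1.not_ge hu.2), hzero, zero_add,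
    setLIntegral_congr_fun measurableSet_Ioo fun u hu => by
      rw [abelWeight_mul_dK hy.1 hu.1, ENNReal.ofReal_mul hcoef],
    lintegral_const_mul _ (by fun_prop), lintegral_beta_Ioo (by linarith) (by linarith) hy.2,
    show H - 1 / 2 + (3 / 2 - H) - 1 = 0 by ring, Real.rpow_zero, one_mul,
    ← ENNReal.ofReal_mul hcoef, mul_right_comm]

theorem integrableOn_abelWeight_mul_dK {H : ℝ} (hH : 1 / 2 < H) (hH1 : H < 1) (hy : y ∈ Ioo 0 t) :
    IntegrableOn (fun u => abelWeight H t u * dK H u y) (Ioo 0 t) := by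
  refine ⟨((measurable_abelWeight_mul_dK H t).comp measurable_prodMk_left).aestronglyMeasurable, ?_⟩
  rw [hasFiniteIntegral_iff_ofReal, lintegral_abelWeight_mul_dK hH hH1 hy]
  · exact ENNReal.ofReal_lt_top
  · filter_upwards [ae_restrict_mem measurableSet_Ioo] with u hu
    exact mul_nonneg (abelWeight_nonneg hu) (dK_nonneg _ _ _)

theorem integral_abelWeight_mul_dK {H : ℝ} (hH : 1 / 2 < H) (hH1 : H < 1) (hy : y ∈ Ioo 0 t) :
    ∫ u in Ioo 0 t, abelWeight H t u * dK H u y =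
      constC H * beta (H - 1 / 2) (3 / 2 - H) * y ^ (1 / 2 - H) := by
  have hbeta : 0 < beta (H - 1 / 2) (3 / 2 - H) := beta_pos (by linarith) (by linarith)
  rw [integral_eq_lintegral_of_nonneg_ae ?_ (integrableOn_abelWeight_mul_dK hH hH1 hy).1,
    lintegral_abelWeight_mul_dK hH hH1 hy, ENNReal.toReal_ofReal
      (mul_nonneg (mul_nonneg (constC_nonneg H) hbeta.le) (Real.rpow_nonneg hy.1.le _))]
  filter_upwards [ae_restrict_mem measurableSet_Ioo] with u hu
  exact mul_nonneg (abelWeight_nonneg hu) (dK_nonneg _ _ _)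

theorem memLp_rpow_unitMeasure {H : ℝ} (hH1 : H < 1) :
    MemLp (fun y : ℝ => y ^ (1 / 2 - H)) 2 unitMeasure := by
  have hint : IntegrableOn (fun y : ℝ => y ^ (1 - 2 * H)) (Ioc 0 1) :=
    (intervalIntegrable_iff_integrableOn_Ioc_of_le zero_le_one).1
      (intervalIntegral.intervalIntegrable_rpow' (by linarith))
  rw [memLp_two_iff_integrable_sq (by fun_prop), unitMeasure,
    ← Measure.restrict_congr_set Ioc_ae_eq_Icc]
  refine hint.congr_fun (fun y hy => ?_) measurableSet_Ioc
  simp only [← Real.rpow_mul_natCast hy.1.le]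
  ring_nf

theorem constC_pos {H : ℝ} (hH : 1 / 2 < H) (hH1 : H < 1) : 0 < constC H := by
  refine (constC_nonneg H).lt_of_ne fun h => ?_
  have hsq := constC_sq_mul_beta hH hH1
  rw [← h, zero_mul, zero_mul] at hsq
  exact (mul_pos (show 0 < H by linarith) (show 0 < 2 * H - 1 by linarith)).ne hsq

end AbelInversion

section Surjectivity

variable {H : Ioo (0 : ℝ) 1} {g : ℝ → ℝ}

theorem integrable_prod_dK_mul (hH : 1 / 2 < (H : ℝ)) (hg : MemLp g 2 unitMeasure) :
    Integrable (fun p : ℝ × ℝ => dK H p.2 p.1 * g p.1) (unitMeasure.prod unitMeasure) := by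
  have hunit : unitMeasure = volume.restrict (Ioc 0 1) :=
    Measure.restrict_congr_set Ioc_ae_eq_Icc.symm
  refine integrable_prod_mul_of_memLp_integral_norm (k := fun y u => dK H u y)
    ((measurable_dK H).comp measurable_swap).aestronglyMeasurable ?_ ?_ hg
  · filter_upwards [ae_unitMeasure_mem] with y hy
    rw [hunit]
    exact (intervalIntegrable_iff_integrableOn_Ioc_of_le zero_le_one).1
      (intervalIntegrable_dK hH hy.1 0 1)
  · convert memLp_kernelInt_Ioc hH 1 using 2 with y
    simp only [Real.norm_of_nonneg (dK_nonneg _ _ _)]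
    rw [hunit, Icc.coe_one, toReal_kernelInt_Ioc zero_le_one,
      intervalIntegral.integral_of_le zero_le_one]

theorem ae_integral_dK_mul_eq_zero (hH : 1 / 2 < (H : ℝ)) (hg : MemLp g 2 unitMeasure)
    (h : ∀ t : Icc (0 : ℝ) 1, ∫ y, (kernelInt H (Ioc 0 t) y).toReal * g y ∂unitMeasure = 0) :
    (fun u => ∫ y, dK H u y * g y ∂unitMeasure) =ᵐ[unitMeasure] 0 := by
  have hprod := integrable_prod_dK_mul hH hg
  refine ae_eq_zero_of_intervalIntegral_eq_zero hprod.integral_prod_right fun t ht => ?_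
  have hle : volume.restrict (Ioc 0 t) ≤ unitMeasure :=
    Measure.restrict_mono (Ioc_subset_Icc_self.trans (Icc_subset_Icc_right ht.2)) le_rfl
  rw [intervalIntegral.integral_of_le ht.1, ← integral_integral_swap
    (hprod.mono_measure (Measure.prod_mono le_rfl hle))]
  refine Eq.trans (integral_congr_ae (ae_of_all _ fun y => ?_)) (h ⟨t, ht⟩)
  simp only [integral_mul_const, toReal_kernelInt_Ioc ht.1, intervalIntegral.integral_of_le ht.1]

theorem integrable_prod_abelWeight_mul {t : ℝ} (hH : 1 / 2 < (H : ℝ)) (ht : t ≤ 1)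
    (hg : MemLp g 2 unitMeasure) :
    Integrable (fun p : ℝ × ℝ => abelWeight H t p.2 * dK H p.2 p.1 * g p.1)
      ((volume.restrict (Ioo 0 t)).prod (volume.restrict (Ioo 0 t))) := by
  have hle : volume.restrict (Ioo 0 t) ≤ unitMeasure :=
    Measure.restrict_mono (Ioo_subset_Icc_self.trans (Icc_subset_Icc_right ht)) le_rfl
  refine integrable_prod_mul_of_memLp_integral_norm
    (k := fun y u => abelWeight H t u * dK H u y)
    (measurable_abelWeight_mul_dK H t).aestronglyMeasurable ?_ ?_ (hg.mono_measure hle)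
  · filter_upwards [ae_restrict_mem measurableSet_Ioo] with y hy
    exact integrableOn_abelWeight_mul_dK hH H.2.2 hy
  · refine (((memLp_rpow_unitMeasure H.2.2).const_mul
      (constC H * beta (H - 1 / 2) (3 / 2 - H))).mono_measure hle).ae_eq ?_
    filter_upwards [ae_restrict_mem measurableSet_Ioo] with y hy
    rw [← integral_abelWeight_mul_dK hH H.2.2 hy]
    refine setIntegral_congr_fun measurableSet_Ioo fun u hu => ?_
    exact (Real.norm_of_nonneg (mul_nonneg (abelWeight_nonneg hu) (dK_nonneg _ _ _))).symm

theorem intervalIntegral_rpow_mul_eq_zero {t : ℝ} (hH : 1 / 2 < (H : ℝ)) (ht : t ∈ Icc (0 : ℝ) 1)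
    (hg : MemLp g 2 unitMeasure)
    (h : (fun u => ∫ y, dK H u y * g y ∂unitMeasure) =ᵐ[unitMeasure] 0) :
    ∫ y in (0 : ℝ)..t, y ^ (1 / 2 - (H : ℝ)) * g y = 0 := by
  have hsub : Ioo 0 t ⊆ Icc 0 1 := Ioo_subset_Icc_self.trans (Icc_subset_Icc_right ht.2)
  have hinner : ∀ u ∈ Ioo 0 t,
      ∫ y in Ioo 0 t, dK H u y * g y = ∫ y, dK H u y * g y ∂unitMeasure := by
    intro u hu
    refine (setIntegral_eq_of_subset_of_forall_sdiff_eq_zero measurableSet_Icc hsub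
      fun y hy => ?_).symm
    have hdK : dK H u y = 0 := if_neg fun hyu => hy.2 ⟨hyu.1, hyu.2.trans hu.2⟩
    rw [hdK, zero_mul]
  have hcoef : constC H * beta (H - 1 / 2) (3 / 2 - H) ≠ 0 :=
    (mul_pos (constC_pos hH H.2.2) (beta_pos (by linarith) (by linarith [H.2.2]))).ne'
  refine (mul_eq_zero.1 ?_).resolve_left hcoef
  calc constC H * beta (H - 1 / 2) (3 / 2 - H) * ∫ y in (0 : ℝ)..t, y ^ (1 / 2 - (H : ℝ)) * g y
      = ∫ y in Ioo 0 t, ∫ u in Ioo 0 t, abelWeight H t u * dK H u y * g y := by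
        rw [← intervalIntegral.integral_const_mul, intervalIntegral.integral_of_le ht.1,
          integral_Ioc_eq_integral_Ioo]
        refine setIntegral_congr_fun measurableSet_Ioo fun y hy => ?_
        simp only [integral_mul_const]
        rw [integral_abelWeight_mul_dK hH H.2.2 hy, ← mul_assoc]
    _ = ∫ u in Ioo 0 t, ∫ y in Ioo 0 t, abelWeight H t u * dK H u y * g y :=
        integral_integral_swap (integrable_prod_abelWeight_mul hH ht.2 hg)
    _ = 0 := by
        refine integral_eq_zero_of_ae ?_
        filter_upwards [ae_restrict_mem measurableSet_Ioo,
          ae_mono (Measure.restrict_mono hsub le_rfl) h] with u hu hzero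
        simp only [mul_assoc, integral_const_mul]
        rw [hinner u hu, hzero, Pi.zero_apply, mul_zero]

theorem ae_eq_zero_of_integral_kernelInt_eq_zero (hH : 1 / 2 < (H : ℝ))
    (hg : MemLp g 2 unitMeasure)
    (h : ∀ t : Icc (0 : ℝ) 1, ∫ y, (kernelInt H (Ioc 0 t) y).toReal * g y ∂unitMeasure = 0) :
    g =ᵐ[unitMeasure] 0 := by
  have hzero : (fun y : ℝ => y ^ (1 / 2 - (H : ℝ)) * g y) =ᵐ[unitMeasure] 0 :=
    ae_eq_zero_of_intervalIntegral_eq_zero ((memLp_rpow_unitMeasure H.2.2).integrable_mul hg)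
      fun t ht => intervalIntegral_rpow_mul_eq_zero hH ht hg (ae_integral_dK_mul_eq_zero hH hg h)
  filter_upwards [hzero, ae_unitMeasure_mem] with y hy hy0
  exact (mul_eq_zero.1 hy).resolve_left (Real.rpow_pos_of_pos hy0.1 _).ne'

/-- `K_H^*` as a linear isometry. -/
def KstarIsometry (hH : 1 / 2 < (H : ℝ)) : FBMSpace H →ₗᵢ[ℝ] Lp ℝ 2 unitMeasure :=
  (Kstar H).toLinearMap.isometryOfInner (inner_Kstar hH)

theorem Kstar_surjective (hH : 1 / 2 < (H : ℝ)) : Function.Surjective (Kstar H) := by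
  have hclosed : IsClosed ((Kstar H).range : Set (Lp ℝ 2 unitMeasure)) :=
    (KstarIsometry hH).isometry.isClosedEmbedding.isClosed_range
  have : CompleteSpace (Kstar H).range := hclosed.completeSpace_coe
  refine LinearMap.range_eq_top.1 ((Submodule.orthogonal_eq_bot_iff (K := (Kstar H).range)).1 ?_)
  refine (Submodule.eq_bot_iff _).2 fun g hg => (Lp.eq_zero_iff_ae_eq_zero).2
    (ae_eq_zero_of_integral_kernelInt_eq_zero hH (Lp.memLp g) fun t => ?_)
  have horth := (Submodule.mem_orthogonal _ _).1 hg (Kstar H (ind H t)) ⟨_, rfl⟩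
  rw [L2.inner_def] at horth
  refine (integral_congr_ae ?_).trans horth
  filter_upwards [Kstar_ind hH t] with y hy
  rw [hy, RCLike.inner_apply, conj_trivial, mul_comm]

/-- `K_H^*` as an isometric isomorphism. -/
def KstarEquiv (hH : 1 / 2 < (H : ℝ)) : FBMSpace H ≃ₗᵢ[ℝ] Lp ℝ 2 unitMeasure :=
  LinearIsometryEquiv.ofSurjective (KstarIsometry hH) (Kstar_surjective hH)

theorem KstarEquiv_symm_Kstar (hH : 1 / 2 < (H : ℝ)) (x : FBMSpace H) :
    (KstarEquiv hH).symm (Kstar H x) = x :=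
  (KstarEquiv hH).symm_apply_apply x

end Surjectivity

section WienerIntegral

theorem memLp_stepInd (t : Icc (0 : ℝ) 1) : MemLp (stepInd t) 2 unitMeasure :=
  (memLp_const (1 : ℝ)).indicator measurableSet_Icc

theorem integral_unitMeasure_indicator {t : ℝ} (ht : t ∈ Icc (0 : ℝ) 1) (f : ℝ → ℝ) :
    ∫ y, (Icc 0 t).indicator f y ∂unitMeasure = ∫ y in (0 : ℝ)..t, f y := by
  rw [unitMeasure, setIntegral_indicator measurableSet_Icc,
    inter_eq_self_of_subset_right (Icc_subset_Icc_right ht.2), integral_Icc_eq_integral_Ioc,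
    intervalIntegral.integral_of_le ht.1]

theorem orthogonal_span_stepInd :
    (Submodule.span ℝ (range fun t => toL2 unitMeasure (stepInd t)))ᗮ = ⊥ := by
  refine (Submodule.eq_bot_iff _).2 fun g hg => (Lp.eq_zero_iff_ae_eq_zero).2
    (ae_eq_zero_of_intervalIntegral_eq_zero ((Lp.memLp g).integrable one_le_two) fun t ht => ?_)
  have horth := (Submodule.mem_orthogonal _ _).1 hg _ (Submodule.subset_span ⟨⟨t, ht⟩, rfl⟩)
  rw [L2.inner_def] at horth
  rw [← integral_unitMeasure_indicator ht]
  refine Eq.trans (integral_congr_ae ?_) horth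
  filter_upwards [coeFn_toL2 (memLp_stepInd ⟨t, ht⟩)] with y hy
  rw [hy]
  by_cases hyt : y ∈ Icc 0 t <;> simp [stepInd, hyt]

variable {H : Ioo (0 : ℝ) 1} {Ω : Type*} {mΩ : MeasurableSpace Ω} {P : Measure Ω}
  {B : ℝ≥0 → Ω → ℝ}

theorem wienerIntegral_eq (hH : 1 / 2 < (H : ℝ)) :
    wienerIntegral H P B =
      isonormal H P B ∘L ((KstarEquiv hH).symm : Lp ℝ 2 unitMeasure →L[ℝ] FBMSpace H) := by
  have hext : IsExtension (fun t : Icc (0 : ℝ) 1 => toL2 unitMeasure (stepInd t)) (wiener H P B)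
      (isonormal H P B ∘L ((KstarEquiv hH).symm : Lp ℝ 2 unitMeasure →L[ℝ] FBMSpace H)) := by
    refine ⟨fun t => congrArg (isonormal H P B) ?_, fun x hx => ?_⟩
    · have hinv : Kstar H (Function.invFun (Kstar H) (toL2 unitMeasure (stepInd t))) =
          toL2 unitMeasure (stepInd t) :=
        Function.rightInverse_invFun (Kstar_surjective hH) _
      exact (congrArg (KstarEquiv hH).symm hinv).symm.trans (KstarEquiv_symm_Kstar hH _)
    · rw [orthogonal_span_stepInd] at hx
      rw [(Submodule.mem_bot ℝ).1 hx, map_zero]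
  exact (isExtension_extension ⟨_, hext⟩).unique hext

theorem wienerIntegral_Kstar (hH : 1 / 2 < (H : ℝ)) (h : FBMSpace H) :
    wienerIntegral H P B (Kstar H h) = isonormal H P B h := by
  rw [wienerIntegral_eq hH]
  exact congrArg (isonormal H P B) (KstarEquiv_symm_Kstar hH h)

theorem IsFBM.isIsonormal_wienerIntegral [IsProbabilityMeasure P] (hH : 1 / 2 < (H : ℝ))
    (hB : IsFBM H B P) : IsIsonormal (wienerIntegral H P B) := by
  intro g
  obtain ⟨h, rfl⟩ := Kstar_surjective hH g
  have hnorm : ‖Kstar H h‖ = ‖h‖ := (KstarIsometry hH).norm_map h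
  rw [wienerIntegral_Kstar hH, hB.isIsonormal]
  congr 2
  exact NNReal.eq hnorm.symm

end WienerIntegral

section CubeMeasure

theorem lintegral_pi_prod {n : ℕ} {E : Fin n → Type*} [∀ i, MeasurableSpace (E i)]
    {μ : ∀ i, Measure (E i)} [∀ i, SigmaFinite (μ i)] {f : ∀ i, E i → ℝ≥0∞}
    (hf : ∀ i, Measurable (f i)) :
    ∫⁻ x, ∏ i, f i (x i) ∂Measure.pi μ = ∏ i, ∫⁻ x, f i x ∂μ i := by
  induction n with
  | zero => simp
  | succ n ih =>
    have hmeas : Measurable fun y : ∀ i : Fin n, E i.succ => ∏ i, f i.succ (y i) :=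
      Finset.measurable_fun_prod _ fun i _ => (hf i.succ).comp (measurable_pi_apply i)
    rw [← ((measurePreserving_piFinSuccAbove μ 0).symm).lintegral_comp_emb
      (MeasurableEquiv.measurableEmbedding _)]
    simp_rw [MeasurableEquiv.piFinSuccAbove_symm_apply, Fin.insertNthEquiv,
      Fin.prod_univ_succ, Fin.insertNth_zero, Equiv.coe_fn_mk, Fin.cons_succ, Fin.cons_zero]
    rw [← ih fun i => hf i.succ]
    exact lintegral_prod_mul (μ := μ 0) (ν := Measure.pi fun i : Fin n => μ i.succ)
      (hf 0).aemeasurable hmeas.aemeasurable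

instance (q : ℕ) : IsFiniteMeasure (cubeMeasure q) := by
  unfold cubeMeasure
  infer_instance

variable {q : ℕ}

theorem lintegral_cubeMeasure_prod {f : ℝ → ℝ≥0∞} (hf : Measurable f) :
    ∫⁻ y, ∏ i, f (y i) ∂cubeMeasure q = (∫⁻ x, f x ∂unitMeasure) ^ q := by
  rw [cubeMeasure, lintegral_pi_prod fun _ => hf, Finset.prod_const, Finset.card_univ,
    Fintype.card_fin]

theorem ae_cubeMeasure_of_ae_unitMeasure {p : ℝ → Prop} (h : ∀ᵐ x ∂unitMeasure, p x) :
    ∀ᵐ y ∂cubeMeasure q, ∀ i, p (y i) :=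
  ae_all_iff.2 fun i =>
    (Measure.quasiMeasurePreserving_eval (fun _ : Fin q => unitMeasure) i).ae h

theorem memLp_prod_coeFn (h : Lp ℝ 2 unitMeasure) :
    MemLp (fun y : Fin q → ℝ => ∏ i, h (y i)) 2 (cubeMeasure q) := by
  have hmeas : AEStronglyMeasurable (fun y : Fin q → ℝ => ∏ i, h (y i)) (cubeMeasure q) :=
    Finset.aestronglyMeasurable_fun_prod _ fun i _ =>
      (Lp.aestronglyMeasurable h).comp_quasiMeasurePreserving
        (Measure.quasiMeasurePreserving_eval (fun _ : Fin q => unitMeasure) i)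
  have hint : Integrable (fun y : Fin q → ℝ => ∏ i, h (y i) ^ 2) (cubeMeasure q) :=
    Integrable.fintype_prod (μ := fun _ => unitMeasure) fun _ => (Lp.memLp h).integrable_sq
  rw [memLp_two_iff_integrable_sq hmeas]
  simpa only [Finset.prod_pow] using hint

theorem isTensorPow_powL2 (q : ℕ) : IsTensorPow q (powL2 q) := by
  intro g h
  rw [powL2, powL2, inner_toL2 (memLp_prod_coeFn g) (memLp_prod_coeFn h)]
  simp_rw [← Finset.prod_mul_distrib]
  rw [cubeMeasure, integral_fintype_prod_eq_pow fun y => g y * h y, Fintype.card_fin, L2.inner_def]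
  simp only [RCLike.inner_apply, conj_trivial, mul_comm]

end CubeMeasure

section CubeKernels

/-- `∏ᵢ ∫_A ∂₁K_H(u,yᵢ) du`, the `q`-th tensor power of `kernelInt`. -/
def powInt (H : ℝ) (q : ℕ) (A : Set ℝ) (y : Fin q → ℝ) : ℝ≥0∞ := ∏ i, kernelInt H A (y i)

/-- `∫_A ∏ᵢ ∂₁K_H(u,yᵢ) du`, the restriction of the kernel `L₁` to the values of `u` in `A`. -/
def diagInt (H : ℝ) (q : ℕ) (A : Set ℝ) (y : Fin q → ℝ) : ℝ≥0∞ :=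
  ∫⁻ u in A, ∏ i, ENNReal.ofReal (dK H u (y i))

theorem measurable_powInt (H : ℝ) (q : ℕ) (A : Set ℝ) : Measurable (powInt H q A) :=
  Finset.measurable_fun_prod _ fun i _ => (measurable_kernelInt H A).comp (measurable_pi_apply i)

theorem measurable_prod_dK (H : ℝ) (q : ℕ) : Measurable
    (Function.uncurry fun (u : ℝ) (y : Fin q → ℝ) => ∏ i, ENNReal.ofReal (dK H u (y i))) :=
  Finset.measurable_fun_prod _ fun i _ =>
    (measurable_ofReal_dK H).comp (f := fun p : ℝ × (Fin q → ℝ) => (p.1, p.2 i)) (by fun_prop)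

theorem measurable_diagInt (H : ℝ) (q : ℕ) (A : Set ℝ) : Measurable (diagInt H q A) :=
  (measurable_prod_dK H q).lintegral_prod_left'

theorem measurable_dK_left (H u : ℝ) : Measurable fun y => ENNReal.ofReal (dK H u y) :=
  (measurable_ofReal_dK H).comp measurable_prodMk_left

variable {H : ℝ} {q : ℕ} {A A' : Set ℝ}

theorem lintegral_powInt_mul_powInt (hH : 1 / 2 < H) (hH1 : H < 1) (hA : MeasurableSet A)
    (hA' : MeasurableSet A') (hA1 : A ⊆ Ioc 0 1) (hA0' : A' ⊆ Ioi 0) :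
    ∫⁻ y, powInt H q A y * powInt H q A' y ∂cubeMeasure q =
      (∫⁻ u in A, ∫⁻ v in A', ENNReal.ofReal (covDensity H u v)) ^ q := by
  simp only [powInt, ← Finset.prod_mul_distrib]
  rw [lintegral_cubeMeasure_prod (f := fun y => kernelInt H A y * kernelInt H A' y)
      ((measurable_kernelInt H A).mul (measurable_kernelInt H A')),
    lintegral_kernelInt_mul hH hH1 hA hA' hA1 hA0']

theorem lintegral_diagInt_mul_diagInt (hH : 1 / 2 < H) (hH1 : H < 1) (hA : MeasurableSet A)
    (hA' : MeasurableSet A') (hA1 : A ⊆ Ioc 0 1) (hA0' : A' ⊆ Ioi 0) :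
    ∫⁻ y, diagInt H q A y * diagInt H q A' y ∂cubeMeasure q =
      ∫⁻ u in A, ∫⁻ v in A', ENNReal.ofReal (covDensity H u v) ^ q := by
  simp only [diagInt]
  rw [lintegral_lintegral_mul_lintegral (measurable_prod_dK H q) (measurable_prod_dK H q)]
  refine setLIntegral_congr_fun hA fun u hu => lintegral_congr_ae ?_
  filter_upwards [ae_restrict_mem hA', ae_restrict_of_ae (Measure.ae_ne volume u)] with v hv hne
  simp only [← Finset.prod_mul_distrib]
  rw [lintegral_cubeMeasure_prod
      (f := fun y => ENNReal.ofReal (dK H u y) * ENNReal.ofReal (dK H v y))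
      ((measurable_dK_left H u).mul (measurable_dK_left H v)),
    lintegral_dK_mul_dK hH hH1 (hA1 hu) (hA0' hv) hne.symm]

theorem lintegral_kernelInt_mul_dK (hH : 1 / 2 < H) (hH1 : H < 1) (hA : MeasurableSet A)
    (hA1 : A ⊆ Ioc 0 1) {v : ℝ} (hv : 0 < v) :
    ∫⁻ y, kernelInt H A y * ENNReal.ofReal (dK H v y) ∂unitMeasure =
      ∫⁻ u in A, ENNReal.ofReal (covDensity H u v) := by
  have hmeas : Measurable (Function.uncurry fun y u : ℝ =>
      ENNReal.ofReal (dK H u y) * ENNReal.ofReal (dK H v y)) :=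
    ((measurable_ofReal_dK H).comp measurable_swap).mul
      ((measurable_dK_left H v).comp measurable_fst)
  calc ∫⁻ y, kernelInt H A y * ENNReal.ofReal (dK H v y) ∂unitMeasure
      = ∫⁻ y, (∫⁻ u in A, ENNReal.ofReal (dK H u y) * ENNReal.ofReal (dK H v y)) ∂unitMeasure :=
        lintegral_congr fun y => (lintegral_mul_const _
          ((measurable_ofReal_dK H).comp measurable_prodMk_right)).symm
    _ = ∫⁻ u in A, ∫⁻ y, ENNReal.ofReal (dK H u y) * ENNReal.ofReal (dK H v y) ∂unitMeasure :=
        lintegral_lintegral_swap hmeas.aemeasurable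
    _ = ∫⁻ u in A, ENNReal.ofReal (covDensity H u v) := by
        refine lintegral_congr_ae ?_
        filter_upwards [ae_restrict_mem hA, ae_restrict_of_ae (Measure.ae_ne volume v)]
          with u hu hne
        exact lintegral_dK_mul_dK hH hH1 (hA1 hu) hv hne

theorem lintegral_powInt_mul_diagInt (hH : 1 / 2 < H) (hH1 : H < 1) (hA : MeasurableSet A)
    (hA' : MeasurableSet A') (hA1 : A ⊆ Ioc 0 1) (hA0' : A' ⊆ Ioi 0) :
    ∫⁻ y, powInt H q A y * diagInt H q A' y ∂cubeMeasure q =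
      ∫⁻ v in A', (∫⁻ u in A, ENNReal.ofReal (covDensity H u v)) ^ q := by
  have hmeas : Measurable (Function.uncurry fun (y : Fin q → ℝ) (v : ℝ) =>
      powInt H q A y * ∏ i, ENNReal.ofReal (dK H v (y i))) :=
    ((measurable_powInt H q A).comp measurable_fst).mul
      ((measurable_prod_dK H q).comp measurable_swap)
  calc ∫⁻ y, powInt H q A y * diagInt H q A' y ∂cubeMeasure q
      = ∫⁻ y, (∫⁻ v in A', powInt H q A y * ∏ i, ENNReal.ofReal (dK H v (y i))) ∂cubeMeasure q :=
        lintegral_congr fun y => (lintegral_const_mul _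
          ((measurable_prod_dK H q).comp measurable_prodMk_right)).symm
    _ = ∫⁻ v in A', ∫⁻ y, powInt H q A y * ∏ i, ENNReal.ofReal (dK H v (y i)) ∂cubeMeasure q :=
        lintegral_lintegral_swap hmeas.aemeasurable
    _ = ∫⁻ v in A', (∫⁻ u in A, ENNReal.ofReal (covDensity H u v)) ^ q := by
        refine setLIntegral_congr_fun hA' fun v hv => ?_
        simp only [powInt, ← Finset.prod_mul_distrib]
        rw [lintegral_cubeMeasure_prod
            (f := fun y => kernelInt H A y * ENNReal.ofReal (dK H v y))
            ((measurable_kernelInt H A).mul (measurable_dK_left H v)),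
          lintegral_kernelInt_mul_dK hH hH1 hA hA1 (hA0' hv)]

end CubeKernels

section CovarianceBounds

variable {a b : ℝ}

theorem lintegral_abs_sub_rpow_le {r u : ℝ} (hr : -1 < r) (hu : u ∈ Icc a b) :
    ∫⁻ v in Ioc a b, ENNReal.ofReal (|u - v| ^ r) ≤
      ENNReal.ofReal (2 * (b - a) ^ (r + 1) / (r + 1)) := by
  have hr1 : 0 < r + 1 := by linarith
  have hleft : (u - a) ^ (r + 1) ≤ (b - a) ^ (r + 1) :=
    Real.rpow_le_rpow (sub_nonneg.2 hu.1) (by linarith [hu.2]) hr1.le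
  have hright : (b - u) ^ (r + 1) ≤ (b - a) ^ (r + 1) :=
    Real.rpow_le_rpow (sub_nonneg.2 hu.2) (by linarith [hu.1]) hr1.le
  rw [lintegral_abs_sub_rpow hr hu.1 hu.2,
    ← ENNReal.ofReal_add (div_nonneg (Real.rpow_nonneg (sub_nonneg.2 hu.1) _) hr1.le)
      (div_nonneg (Real.rpow_nonneg (sub_nonneg.2 hu.2) _) hr1.le), ← add_div]
  gcongr
  linarith

theorem lintegral_lintegral_abs_sub_rpow_le {r : ℝ} (hr : -1 < r) (hab : a ≤ b) :
    ∫⁻ u in Ioc a b, ∫⁻ v in Ioc a b, ENNReal.ofReal (|u - v| ^ r) ≤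
      ENNReal.ofReal (2 / (r + 1) * (b - a) ^ (r + 2)) := by
  have hnonneg : 0 ≤ 2 * (b - a) ^ (r + 1) / (r + 1) :=
    div_nonneg (mul_nonneg zero_le_two (Real.rpow_nonneg (sub_nonneg.2 hab) _)) (by linarith)
  calc ∫⁻ u in Ioc a b, ∫⁻ v in Ioc a b, ENNReal.ofReal (|u - v| ^ r)
      ≤ ∫⁻ _ in Ioc a b, ENNReal.ofReal (2 * (b - a) ^ (r + 1) / (r + 1)) :=
        setLIntegral_mono measurable_const fun u hu =>
          lintegral_abs_sub_rpow_le hr (Ioc_subset_Icc_self hu)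
    _ = ENNReal.ofReal (2 / (r + 1) * (b - a) ^ (r + 2)) := by
        rw [setLIntegral_const, Real.volume_Ioc, ← ENNReal.ofReal_mul hnonneg,
          show r + 2 = r + 1 + 1 by ring,
          Real.rpow_add_one' (sub_nonneg.2 hab) (show r + 1 + 1 ≠ 0 by linarith),
          mul_div_right_comm, mul_assoc]

variable {H : ℝ} {q : ℕ}

theorem covDensity_pow (u v : ℝ) :
    covDensity H u v ^ q = (H * (2 * H - 1)) ^ q * |u - v| ^ (-(q * (2 - 2 * H))) := by
  rw [covDensity, mul_pow, ← Real.rpow_mul_natCast (abs_nonneg _)]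
  ring_nf

theorem lintegral_covDensity_pow_le (hH : 1 / 2 < H) (hqH : q * (2 - 2 * H) < 1) (hab : a ≤ b) :
    ∫⁻ u in Ioc a b, ∫⁻ v in Ioc a b, ENNReal.ofReal (covDensity H u v) ^ q ≤
      ENNReal.ofReal ((H * (2 * H - 1)) ^ q *
        (2 / (1 - q * (2 - 2 * H)) * (b - a) ^ (2 - q * (2 - 2 * H)))) := by
  have hcoef : 0 ≤ (H * (2 * H - 1)) ^ q := pow_nonneg (mul_nonneg (by linarith) (by linarith)) _
  have hpow (u v : ℝ) : ENNReal.ofReal (covDensity H u v) ^ q =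
      ENNReal.ofReal ((H * (2 * H - 1)) ^ q) *
        ENNReal.ofReal (|u - v| ^ (-(q * (2 - 2 * H)))) := by
    rw [← ENNReal.ofReal_pow (covDensity_nonneg hH u v), covDensity_pow, ENNReal.ofReal_mul hcoef]
  simp_rw [hpow, lintegral_const_mul' _ _ ENNReal.ofReal_ne_top]
  rw [ENNReal.ofReal_mul hcoef, sub_eq_neg_add 1 ((q : ℝ) * _), sub_eq_neg_add 2 ((q : ℝ) * _)]
  gcongr
  exact lintegral_lintegral_abs_sub_rpow_le (by linarith) hab

theorem lintegral_covDensity_le (hH : 1 / 2 < H) (hab : a ≤ b) :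
    ∫⁻ u in Ioc a b, ∫⁻ v in Ioc a b, ENNReal.ofReal (covDensity H u v) ≤
      ENNReal.ofReal (2 * H * (b - a) ^ (2 * H)) := by
  have hne : H * 2 - 1 ≠ 0 := by linarith
  have hle := lintegral_covDensity_pow_le (q := 1) hH (by rw [Nat.cast_one]; linarith) hab
  simp only [pow_one, Nat.cast_one, one_mul] at hle
  refine hle.trans_eq (congrArg ENNReal.ofReal ?_)
  rw [show 1 - (2 - 2 * H) = 2 * H - 1 by ring, show 2 - (2 - 2 * H) = 2 * H by ring]
  field_simp

end CovarianceBounds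

section GramSums

theorem sum_filter_dist_le {d : ℕ → ℝ} (hd : ∀ m, 0 ≤ d m) {n k : ℕ} (hk : k < n)
    (p : ℕ → Prop) [DecidablePred p] (hp : InjOn (Nat.dist k) {l | p l}) :
    ∑ l ∈ Finset.range n with p l, d (Nat.dist k l) ≤ ∑ m ∈ Finset.range n, d m := by
  have hinj : InjOn (Nat.dist k) (Finset.range n |>.filter p : Finset ℕ) :=
    hp.mono fun l hl => (Finset.mem_filter.1 hl).2
  rw [← Finset.sum_image (f := d) hinj]
  refine Finset.sum_le_sum_of_subset_of_nonneg (Finset.image_subset_iff.2 fun l hl => ?_)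
    fun m _ _ => hd m
  have hln := Finset.mem_range.1 (Finset.mem_filter.1 hl).1
  rw [Finset.mem_range, Nat.dist]
  omega

theorem sum_dist_le {d : ℕ → ℝ} (hd : ∀ m, 0 ≤ d m) {n k : ℕ} (hk : k < n) :
    ∑ l ∈ Finset.range n, d (Nat.dist k l) ≤ 2 * ∑ m ∈ Finset.range n, d m := by
  rw [← Finset.sum_filter_add_sum_filter_not _ (fun l => l ≤ k), two_mul]
  refine add_le_add (sum_filter_dist_le hd hk _ ?_) (sum_filter_dist_le hd hk _ ?_) <;>
  · intro l hl l' hl' hdist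
    simp only [mem_ofPred_eq, Nat.dist] at hl hl' hdist
    omega

theorem norm_sum_sq_le_of_inner_le {F : Type*} [NormedAddCommGroup F] [InnerProductSpace ℝ F]
    {n : ℕ} {w : ℕ → F} {d : ℕ → ℝ} (hd : ∀ m, 0 ≤ d m)
    (h : ∀ k < n, ∀ l < n, inner ℝ (w k) (w l) ≤ d (Nat.dist k l)) :
    ‖∑ k ∈ Finset.range n, w k‖ ^ 2 ≤ n * (2 * ∑ m ∈ Finset.range n, d m) := by
  simp_rw [← real_inner_self_eq_norm_sq, sum_inner, inner_sum]
  calc ∑ k ∈ Finset.range n, ∑ l ∈ Finset.range n, inner ℝ (w k) (w l)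
      ≤ ∑ k ∈ Finset.range n, ∑ l ∈ Finset.range n, d (Nat.dist k l) :=
        Finset.sum_le_sum fun k hk => Finset.sum_le_sum fun l hl =>
          h k (Finset.mem_range.1 hk) l (Finset.mem_range.1 hl)
    _ ≤ ∑ _k ∈ Finset.range n, 2 * ∑ m ∈ Finset.range n, d m :=
        Finset.sum_le_sum fun k hk => sum_dist_le hd (Finset.mem_range.1 hk)
    _ = n * (2 * ∑ m ∈ Finset.range n, d m) := by
        rw [Finset.sum_const, Finset.card_range, nsmul_eq_mul]

/-- A bound for the entries of a Gram matrix at distance `m` from the diagonal: the constant `C`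
near the diagonal, and away from it a difference of powers, so that its sum telescopes. -/
def gramBound (C D β : ℝ) (m : ℕ) : ℝ :=
  if m ≤ 1 then C else D * (((m : ℝ) - 1) ^ (-β) - ((m : ℝ) + 1) ^ (-β))

variable {C D β : ℝ}

theorem gramBound_of_le_one {m : ℕ} (hm : m ≤ 1) : gramBound C D β m = C := if_pos hm

theorem gramBound_of_two_le {m : ℕ} (hm : 2 ≤ m) :
    gramBound C D β m = D * (((m : ℝ) - 1) ^ (-β) - ((m : ℝ) + 1) ^ (-β)) :=
  if_neg (by omega)

theorem gramBound_nonneg (hC : 0 ≤ C) (hD : 0 ≤ D) (hβ : 0 ≤ β) (m : ℕ) :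
    0 ≤ gramBound C D β m := by
  rcases Nat.lt_or_ge 1 m with hm | hm
  · have hm' : (2 : ℝ) ≤ m := by exact_mod_cast hm
    rw [gramBound_of_two_le hm]
    exact mul_nonneg hD (sub_nonneg.2 (Real.rpow_le_rpow_of_nonpos (by linarith) (by linarith)
      (neg_nonpos.2 hβ)))
  · rwa [gramBound_of_le_one hm]

theorem sum_range_add_two_gramBound (C D β : ℝ) (N : ℕ) :
    ∑ m ∈ Finset.range (N + 2), gramBound C D β m =
      2 * C + D * (1 + 2 ^ (-β) - ((N : ℝ) + 1) ^ (-β) - ((N : ℝ) + 2) ^ (-β)) := by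
  induction N with
  | zero =>
    rw [Finset.sum_range_succ, Finset.sum_range_one, gramBound_of_le_one zero_le_one,
      gramBound_of_le_one le_rfl, Nat.cast_zero, zero_add, zero_add, Real.one_rpow]
    ring
  | succ N ih =>
    rw [Nat.add_right_comm, Finset.sum_range_succ, ih, gramBound_of_two_le (by omega)]
    push_cast
    rw [show (N : ℝ) + 2 - 1 = N + 1 by ring, show (N : ℝ) + 2 + 1 = N + 3 by ring,
      show (N : ℝ) + 1 + 1 = N + 2 by ring, show (N : ℝ) + 1 + 2 = N + 3 by ring]
    ring

theorem sum_gramBound_le (hC : 0 ≤ C) (hD : 0 ≤ D) (hβ : 0 ≤ β) (n : ℕ) :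
    ∑ m ∈ Finset.range n, gramBound C D β m ≤ 2 * C + 2 * D := by
  calc ∑ m ∈ Finset.range n, gramBound C D β m
      ≤ ∑ m ∈ Finset.range (n + 2), gramBound C D β m :=
        Finset.sum_le_sum_of_subset_of_nonneg (Finset.range_mono (by omega))
          fun m _ _ => gramBound_nonneg hC hD hβ m
    _ = 2 * C + D * (1 + 2 ^ (-β) - ((n : ℝ) + 1) ^ (-β) - ((n : ℝ) + 2) ^ (-β)) :=
        sum_range_add_two_gramBound C D β n
    _ ≤ 2 * C + D * 2 := by
        have htwo : (2 : ℝ) ^ (-β) ≤ 1 :=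
          Real.rpow_le_one_of_one_le_of_nonpos one_le_two (neg_nonpos.2 hβ)
        have hsucc : 0 ≤ ((n : ℝ) + 1) ^ (-β) := by positivity
        have hsucc' : 0 ≤ ((n : ℝ) + 2) ^ (-β) := by positivity
        gcongr
        linarith
    _ = 2 * C + 2 * D := by rw [mul_comm D]

end GramSums

section Cells

/-- The `k`-th cell `(k/n, (k+1)/n]` of the uniform partition of `(0,1]` into `n` intervals. -/
def cell (n k : ℕ) : Set ℝ := Ioc ((k : ℝ) / n) (((k : ℝ) + 1) / n)

variable {n k l : ℕ}

theorem measurableSet_cell (n k : ℕ) : MeasurableSet (cell n k) := measurableSet_Ioc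

theorem cell_subset (hk : k < n) : cell n k ⊆ Ioc 0 1 := by
  have hn : (0 : ℝ) < n := Nat.cast_pos.2 hk.pos
  refine Ioc_subset_Ioc (by positivity) ?_
  rw [div_le_one hn]
  exact_mod_cast hk

theorem cell_width (n k : ℕ) : ((k : ℝ) + 1) / n - (k : ℝ) / n = (n : ℝ)⁻¹ := by ring

theorem cell_left_le_right (n k : ℕ) : (k : ℝ) / n ≤ ((k : ℝ) + 1) / n := by gcongr; linarith

theorem volume_real_cell (n k : ℕ) : volume.real (cell n k) = (n : ℝ)⁻¹ := by
  rw [cell, Real.volume_real_Ioc_of_le (cell_left_le_right n k), cell_width]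

theorem abs_sub_mem_Icc_of_mem_cell {u v : ℝ} (hu : u ∈ cell n k) (hv : v ∈ cell n l)
    (hkl : 1 ≤ Nat.dist k l) :
    |u - v| ∈ Icc (((Nat.dist k l : ℝ) - 1) / n) (((Nat.dist k l : ℝ) + 1) / n) := by
  wlog hlk : l ≤ k generalizing k l u v
  · rw [abs_sub_comm, Nat.dist_comm]
    exact this hv hu (Nat.dist_comm k l ▸ hkl) (not_le.1 hlk).le
  have hdist : (Nat.dist k l : ℝ) = k - l := by
    rw [Nat.dist_eq_sub_of_le_right hlk, Nat.cast_sub hlk]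
  have hkl' : (1 : ℝ) ≤ Nat.dist k l := by exact_mod_cast hkl
  have hlower : ((Nat.dist k l : ℝ) - 1) / n = k / n - (l + 1) / n := by rw [hdist]; ring
  have hupper : ((Nat.dist k l : ℝ) + 1) / n = (k + 1) / n - l / n := by rw [hdist]; ring
  have hgap : 0 ≤ ((Nat.dist k l : ℝ) - 1) / n := div_nonneg (by linarith) n.cast_nonneg
  have huv : ((Nat.dist k l : ℝ) - 1) / n ≤ u - v := by linarith [hu.1, hv.2]
  rw [abs_of_nonneg (hgap.trans huv)]
  exact ⟨huv, by linarith [hu.2, hv.1]⟩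

end Cells

section KernelVectors

variable {H : ℝ} {q : ℕ} {A A' : Set ℝ}

/-- The class of `∏ᵢ ∫_A ∂₁K_H(u,yᵢ) du` in `L²([0,1]^q)`. -/
def powVec (H : ℝ) (q : ℕ) (A : Set ℝ) : Lp ℝ 2 (cubeMeasure q) :=
  toL2 (cubeMeasure q) fun y => (powInt H q A y).toReal

/-- The class of `∫_A ∏ᵢ ∂₁K_H(u,yᵢ) du` in `L²([0,1]^q)`. -/
def diagVec (H : ℝ) (q : ℕ) (A : Set ℝ) : Lp ℝ 2 (cubeMeasure q) :=
  toL2 (cubeMeasure q) fun y => (diagInt H q A y).toReal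

theorem lintegral_powInt_sq_ne_top (hH : 1 / 2 < H) (hH1 : H < 1) (hA : MeasurableSet A)
    (hA1 : A ⊆ Ioc 0 1) : ∫⁻ y, powInt H q A y * powInt H q A y ∂cubeMeasure q ≠ ∞ := by
  rw [lintegral_powInt_mul_powInt hH hH1 hA hA hA1 (hA1.trans Ioc_subset_Ioi_self)]
  refine ENNReal.pow_ne_top (ne_top_of_le_ne_top ENNReal.ofReal_ne_top
    (((lintegral_mono_set hA1).trans ?_).trans (lintegral_covDensity_le hH zero_le_one)))
  exact lintegral_mono fun u => lintegral_mono_set hA1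

theorem lintegral_diagInt_sq_ne_top (hH : 1 / 2 < H) (hH1 : H < 1) (hqH : q * (2 - 2 * H) < 1)
    (hA : MeasurableSet A) (hA1 : A ⊆ Ioc 0 1) :
    ∫⁻ y, diagInt H q A y * diagInt H q A y ∂cubeMeasure q ≠ ∞ := by
  rw [lintegral_diagInt_mul_diagInt hH hH1 hA hA hA1 (hA1.trans Ioc_subset_Ioi_self)]
  refine ne_top_of_le_ne_top ENNReal.ofReal_ne_top
    (((lintegral_mono_set hA1).trans ?_).trans (lintegral_covDensity_pow_le hH hqH zero_le_one))
  exact lintegral_mono fun u => lintegral_mono_set hA1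

theorem memLp_diagInt (hH : 1 / 2 < H) (hH1 : H < 1) (hqH : q * (2 - 2 * H) < 1)
    (hA : MeasurableSet A) (hA1 : A ⊆ Ioc 0 1) :
    MemLp (fun y => (diagInt H q A y).toReal) 2 (cubeMeasure q) :=
  memLp_two_toReal (measurable_diagInt H q A).aemeasurable
    (lintegral_diagInt_sq_ne_top hH hH1 hqH hA hA1)

theorem inner_powVec_powVec (hH : 1 / 2 < H) (hH1 : H < 1) (hA : MeasurableSet A)
    (hA' : MeasurableSet A') (hA1 : A ⊆ Ioc 0 1) (hA1' : A' ⊆ Ioc 0 1) :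
    inner ℝ (powVec H q A) (powVec H q A') =
      ((∫⁻ u in A, ∫⁻ v in A', ENNReal.ofReal (covDensity H u v)) ^ q).toReal := by
  rw [powVec, powVec, inner_toL2_toReal (measurable_powInt H q A).aemeasurable
      (measurable_powInt H q A').aemeasurable (lintegral_powInt_sq_ne_top hH hH1 hA hA1)
      (lintegral_powInt_sq_ne_top hH hH1 hA' hA1'),
    lintegral_powInt_mul_powInt hH hH1 hA hA' hA1 (hA1'.trans Ioc_subset_Ioi_self)]

theorem inner_diagVec_diagVec (hH : 1 / 2 < H) (hH1 : H < 1) (hqH : q * (2 - 2 * H) < 1)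
    (hA : MeasurableSet A) (hA' : MeasurableSet A') (hA1 : A ⊆ Ioc 0 1) (hA1' : A' ⊆ Ioc 0 1) :
    inner ℝ (diagVec H q A) (diagVec H q A') =
      (∫⁻ u in A, ∫⁻ v in A', ENNReal.ofReal (covDensity H u v) ^ q).toReal := by
  rw [diagVec, diagVec, inner_toL2_toReal (measurable_diagInt H q A).aemeasurable
      (measurable_diagInt H q A').aemeasurable (lintegral_diagInt_sq_ne_top hH hH1 hqH hA hA1)
      (lintegral_diagInt_sq_ne_top hH hH1 hqH hA' hA1'),
    lintegral_diagInt_mul_diagInt hH hH1 hA hA' hA1 (hA1'.trans Ioc_subset_Ioi_self)]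

theorem inner_powVec_diagVec (hH : 1 / 2 < H) (hH1 : H < 1) (hqH : q * (2 - 2 * H) < 1)
    (hA : MeasurableSet A) (hA' : MeasurableSet A') (hA1 : A ⊆ Ioc 0 1) (hA1' : A' ⊆ Ioc 0 1) :
    inner ℝ (powVec H q A) (diagVec H q A') =
      (∫⁻ v in A', (∫⁻ u in A, ENNReal.ofReal (covDensity H u v)) ^ q).toReal := by
  rw [powVec, diagVec, inner_toL2_toReal (measurable_powInt H q A).aemeasurable
      (measurable_diagInt H q A').aemeasurable (lintegral_powInt_sq_ne_top hH hH1 hA hA1)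
      (lintegral_diagInt_sq_ne_top hH hH1 hqH hA' hA1'),
    lintegral_powInt_mul_diagInt hH hH1 hA hA' hA1 (hA1'.trans Ioc_subset_Ioi_self)]

theorem norm_powVec_Ioc_sq_le (hH : 1 / 2 < H) (hH1 : H < 1) {a b : ℝ} (hab : a ≤ b)
    (h01 : Ioc a b ⊆ Ioc 0 1) (q : ℕ) :
    ‖powVec H q (Ioc a b)‖ ^ 2 ≤ (2 * H * (b - a) ^ (2 * H)) ^ q := by
  have hbound : 0 ≤ 2 * H * (b - a) ^ (2 * H) :=
    mul_nonneg (by linarith) (Real.rpow_nonneg (sub_nonneg.2 hab) _)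
  rw [← real_inner_self_eq_norm_sq,
    inner_powVec_powVec hH hH1 measurableSet_Ioc measurableSet_Ioc h01 h01, ENNReal.toReal_pow]
  gcongr
  exact ENNReal.toReal_le_of_le_ofReal hbound (lintegral_covDensity_le hH hab)

theorem norm_diagVec_Ioc_sq_le (hH : 1 / 2 < H) (hH1 : H < 1) (hqH : q * (2 - 2 * H) < 1)
    {a b : ℝ} (hab : a ≤ b) (h01 : Ioc a b ⊆ Ioc 0 1) :
    ‖diagVec H q (Ioc a b)‖ ^ 2 ≤ (H * (2 * H - 1)) ^ q *
      (2 / (1 - q * (2 - 2 * H)) * (b - a) ^ (2 - q * (2 - 2 * H))) := by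
  have hcoef : 0 ≤ (H * (2 * H - 1)) ^ q := pow_nonneg (mul_nonneg (by linarith) (by linarith)) _
  have hpow : 0 ≤ (b - a) ^ (2 - q * (2 - 2 * H)) := Real.rpow_nonneg (sub_nonneg.2 hab) _
  rw [← real_inner_self_eq_norm_sq,
    inner_diagVec_diagVec hH hH1 hqH measurableSet_Ioc measurableSet_Ioc h01 h01]
  exact ENNReal.toReal_le_of_le_ofReal
    (mul_nonneg hcoef (mul_nonneg (div_nonneg zero_le_two (by linarith)) hpow))
    (lintegral_covDensity_pow_le hH hqH hab)

end KernelVectors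

section KernelVectorBounds

theorem setLIntegral_le_of_forall_le {α : Type*} [MeasurableSpace α] {μ : Measure α} {A : Set α}
    {f : α → ℝ≥0∞} {c : ℝ} (hc : 0 ≤ c) (hA : μ A ≠ ∞) (h : ∀ u ∈ A, f u ≤ ENNReal.ofReal c) :
    ∫⁻ u in A, f u ∂μ ≤ ENNReal.ofReal (c * μ.real A) := by
  refine (setLIntegral_mono measurable_const h).trans_eq ?_
  rw [setLIntegral_const, ENNReal.ofReal_mul hc, ofReal_measureReal hA]

theorem le_setLIntegral_of_forall_le {α : Type*} [MeasurableSpace α] {μ : Measure α} {A : Set α}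
    {f : α → ℝ≥0∞} {c : ℝ} (hc : 0 ≤ c) (hA : MeasurableSet A) (hfin : μ A ≠ ∞)
    (h : ∀ u ∈ A, ENNReal.ofReal c ≤ f u) :
    ENNReal.ofReal (c * μ.real A) ≤ ∫⁻ u in A, f u ∂μ := by
  refine Eq.trans_le ?_ (setLIntegral_mono' hA h)
  rw [setLIntegral_const, ENNReal.ofReal_mul hc, ofReal_measureReal hfin]

variable {H : ℝ} {q : ℕ} {A A' : Set ℝ} {c : ℝ}

theorem volume_ne_top_of_subset_Ioc (hA1 : A ⊆ Ioc 0 1) : volume A ≠ ∞ :=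
  measure_ne_top_of_subset hA1 measure_Ioc_lt_top.ne

theorem inner_powVec_powVec_le (hH : 1 / 2 < H) (hH1 : H < 1) (hA : MeasurableSet A)
    (hA' : MeasurableSet A') (hA1 : A ⊆ Ioc 0 1) (hA1' : A' ⊆ Ioc 0 1) (hc : 0 ≤ c)
    (h : ∀ u ∈ A, ∀ v ∈ A', covDensity H u v ≤ c) (q : ℕ) :
    inner ℝ (powVec H q A) (powVec H q A') ≤ (c * volume.real A' * volume.real A) ^ q := by
  rw [inner_powVec_powVec hH hH1 hA hA' hA1 hA1', ENNReal.toReal_pow]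
  gcongr
  refine ENNReal.toReal_le_of_le_ofReal (by positivity) (setLIntegral_le_of_forall_le
    (by positivity) (volume_ne_top_of_subset_Ioc hA1) fun u hu => ?_)
  exact setLIntegral_le_of_forall_le hc (volume_ne_top_of_subset_Ioc hA1') fun v hv =>
    ENNReal.ofReal_le_ofReal (h u hu v hv)

theorem inner_diagVec_diagVec_le (hH : 1 / 2 < H) (hH1 : H < 1) (hqH : q * (2 - 2 * H) < 1)
    (hA : MeasurableSet A) (hA' : MeasurableSet A') (hA1 : A ⊆ Ioc 0 1) (hA1' : A' ⊆ Ioc 0 1)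
    (hc : 0 ≤ c) (h : ∀ u ∈ A, ∀ v ∈ A', covDensity H u v ≤ c) :
    inner ℝ (diagVec H q A) (diagVec H q A') ≤ c ^ q * volume.real A' * volume.real A := by
  rw [inner_diagVec_diagVec hH hH1 hqH hA hA' hA1 hA1']
  refine ENNReal.toReal_le_of_le_ofReal (by positivity) (setLIntegral_le_of_forall_le
    (by positivity) (volume_ne_top_of_subset_Ioc hA1) fun u hu => ?_)
  refine setLIntegral_le_of_forall_le (by positivity) (volume_ne_top_of_subset_Ioc hA1')
    fun v hv => ?_
  rw [ENNReal.ofReal_pow hc]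
  gcongr
  exact h u hu v hv

theorem le_inner_powVec_diagVec (hH : 1 / 2 < H) (hH1 : H < 1) (hqH : q * (2 - 2 * H) < 1)
    (hA : MeasurableSet A) (hA' : MeasurableSet A') (hA1 : A ⊆ Ioc 0 1) (hA1' : A' ⊆ Ioc 0 1)
    (hc : 0 ≤ c) (h : ∀ u ∈ A, ∀ v ∈ A', c ≤ covDensity H u v) :
    (c * volume.real A) ^ q * volume.real A' ≤ inner ℝ (powVec H q A) (diagVec H q A') := by
  have hfin : ∫⁻ v in A', (∫⁻ u in A, ENNReal.ofReal (covDensity H u v)) ^ q ≠ ∞ := by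
    rw [← lintegral_powInt_mul_diagInt hH hH1 hA hA' hA1 (hA1'.trans Ioc_subset_Ioi_self)]
    exact lintegral_mul_ne_top (measurable_powInt H q A).aemeasurable
      (lintegral_powInt_sq_ne_top hH hH1 hA hA1) (lintegral_diagInt_sq_ne_top hH hH1 hqH hA' hA1')
  rw [inner_powVec_diagVec hH hH1 hqH hA hA' hA1 hA1', ← ENNReal.ofReal_le_iff_le_toReal hfin]
  refine le_setLIntegral_of_forall_le (by positivity) hA' (volume_ne_top_of_subset_Ioc hA1')
    fun v hv => ?_
  rw [ENNReal.ofReal_pow (by positivity)]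
  gcongr
  exact le_setLIntegral_of_forall_le hc hA (volume_ne_top_of_subset_Ioc hA1) fun u hu =>
    ENNReal.ofReal_le_ofReal (h u hu v hv)

end KernelVectorBounds

section CellError

variable {H : ℝ} {q n k l : ℕ}

/-- The contribution of the cell `(k/n,(k+1)/n]` to the difference between the images of `f_n` and
of its limit in `L²([0,1]^q)`. -/
def cellError (H : ℝ) (q n k : ℕ) : Lp ℝ 2 (cubeMeasure q) :=
  (n : ℝ) ^ (q - 1) • powVec H q (cell n k) - diagVec H q (cell n k)

theorem inner_cellError (H : ℝ) (q n k l : ℕ) :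
    inner ℝ (cellError H q n k) (cellError H q n l) =
      (n : ℝ) ^ (q - 1) * ((n : ℝ) ^ (q - 1) *
          inner ℝ (powVec H q (cell n k)) (powVec H q (cell n l))) -
        (n : ℝ) ^ (q - 1) * inner ℝ (powVec H q (cell n k)) (diagVec H q (cell n l)) -
        (n : ℝ) ^ (q - 1) * inner ℝ (powVec H q (cell n l)) (diagVec H q (cell n k)) +
        inner ℝ (diagVec H q (cell n k)) (diagVec H q (cell n l)) := by
  simp only [cellError, inner_sub_left, inner_sub_right, real_inner_smul_left,
    real_inner_smul_right]
  rw [real_inner_comm (powVec H q (cell n l)) (diagVec H q (cell n k))]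
  ring

theorem pow_pred_mul_inv_pow {x : ℝ} (hx : x ≠ 0) (hq : q ≠ 0) : x ^ (q - 1) * x⁻¹ ^ q = x⁻¹ := by
  rw [← pow_sub_one_mul hq x⁻¹, ← mul_assoc, ← mul_pow, mul_inv_cancel₀ hx, one_pow, one_mul]

theorem inner_cellError_le_of_covDensity_mem_Icc (hH : 1 / 2 < H) (hH1 : H < 1)
    (hqH : q * (2 - 2 * H) < 1) (hq : q ≠ 0) (hk : k < n) (hl : l < n) {lo hi : ℝ} (hlo : 0 ≤ lo)
    (hhi : 0 ≤ hi) (h : ∀ u ∈ cell n k, ∀ v ∈ cell n l, covDensity H u v ∈ Icc lo hi) :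
    inner ℝ (cellError H q n k) (cellError H q n l) ≤ 2 * (hi ^ q - lo ^ q) * (n : ℝ)⁻¹ ^ 2 := by
  have hn : (n : ℝ) ≠ 0 := Nat.cast_ne_zero.2 hk.ne_bot
  have hmk := measurableSet_cell n k
  have hml := measurableSet_cell n l
  have hsk := cell_subset hk
  have hsl := cell_subset hl
  have hscale := pow_pred_mul_inv_pow hn hq
  have hpow := inner_powVec_powVec_le hH hH1 hmk hml hsk hsl hhi
    (fun u hu v hv => (h u hu v hv).2) q
  have hdiag := inner_diagVec_diagVec_le hH hH1 hqH hmk hml hsk hsl hhi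
    fun u hu v hv => (h u hu v hv).2
  have hcross := le_inner_powVec_diagVec hH hH1 hqH hmk hml hsk hsl hlo
    fun u hu v hv => (h u hu v hv).1
  have hcross' := le_inner_powVec_diagVec hH hH1 hqH hml hmk hsl hsk hlo
    fun v hv u hu => covDensity_comm H u v ▸ (h u hu v hv).1
  rw [volume_real_cell, volume_real_cell] at hpow hdiag hcross hcross'
  calc inner ℝ (cellError H q n k) (cellError H q n l)
      ≤ (n : ℝ) ^ (q - 1) * ((n : ℝ) ^ (q - 1) * (hi * (n : ℝ)⁻¹ * (n : ℝ)⁻¹) ^ q) -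
          (n : ℝ) ^ (q - 1) * ((lo * (n : ℝ)⁻¹) ^ q * (n : ℝ)⁻¹) -
          (n : ℝ) ^ (q - 1) * ((lo * (n : ℝ)⁻¹) ^ q * (n : ℝ)⁻¹) +
          hi ^ q * (n : ℝ)⁻¹ * (n : ℝ)⁻¹ := by
        rw [inner_cellError]
        gcongr
    _ = hi ^ q * ((n : ℝ) ^ (q - 1) * (n : ℝ)⁻¹ ^ q) * ((n : ℝ) ^ (q - 1) * (n : ℝ)⁻¹ ^ q) -
          2 * (lo ^ q * ((n : ℝ) ^ (q - 1) * (n : ℝ)⁻¹ ^ q) * (n : ℝ)⁻¹) +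
          hi ^ q * (n : ℝ)⁻¹ * (n : ℝ)⁻¹ := by
        simp only [mul_pow]
        ring
    _ = 2 * (hi ^ q - lo ^ q) * (n : ℝ)⁻¹ ^ 2 := by
        rw [hscale]
        ring

/-- The constant bounding the squared norm of the rescaled `cellError`, and hence the entries of
its Gram matrix near the diagonal. -/
def nearConst (H : ℝ) (q : ℕ) : ℝ :=
  (2 * H) ^ q + (H * (2 * H - 1)) ^ q * (2 / (1 - q * (2 - 2 * H)))

theorem nearConst_nonneg (hH : 1 / 2 < H) (hqH : q * (2 - 2 * H) < 1) : 0 ≤ nearConst H q :=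
  add_nonneg (pow_nonneg (by linarith) _) (mul_nonneg
    (pow_nonneg (mul_nonneg (by linarith) (by linarith)) _) (div_nonneg zero_le_two (by linarith)))

theorem pow_pred_mul_pow_pred_mul_rpow_pow {x s : ℝ} (hx : 0 < x) (hq : q ≠ 0) :
    x ^ (q - 1) * (x ^ (q - 1) * (x⁻¹ ^ s) ^ q) = x⁻¹ ^ (2 - q * (2 - s)) := by
  have hpred : x ^ (q - 1) = x⁻¹ ^ (1 - q : ℝ) := by
    rw [Real.inv_rpow hx.le, ← Real.rpow_neg hx.le, neg_sub,
      ← Nat.cast_pred (Nat.pos_of_ne_zero hq), Real.rpow_natCast]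
  have hx' : 0 < x⁻¹ := inv_pos.2 hx
  rw [hpred, ← Real.rpow_mul_natCast hx'.le, ← Real.rpow_add hx', ← Real.rpow_add hx']
  ring_nf

theorem norm_cellError_sq_le (hH : 1 / 2 < H) (hH1 : H < 1) (hqH : q * (2 - 2 * H) < 1)
    (hq : q ≠ 0) (hk : k < n) :
    ‖cellError H q n k‖ ^ 2 ≤ (n : ℝ)⁻¹ ^ (2 - q * (2 - 2 * H)) * nearConst H q := by
  have hn : (0 : ℝ) < n := Nat.cast_pos.2 hk.pos
  have hpow := norm_powVec_Ioc_sq_le hH hH1 (cell_left_le_right n k) (cell_subset hk) q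
  have hdiag := norm_diagVec_Ioc_sq_le hH hH1 hqH (cell_left_le_right n k) (cell_subset hk)
  have hcross : 0 ≤ inner ℝ (powVec H q (cell n k)) (diagVec H q (cell n k)) := by
    rw [inner_powVec_diagVec hH hH1 hqH (measurableSet_cell n k) (measurableSet_cell n k)
      (cell_subset hk) (cell_subset hk)]
    exact ENNReal.toReal_nonneg
  rw [cell_width, ← cell] at hpow hdiag
  calc ‖cellError H q n k‖ ^ 2
      = (n : ℝ) ^ (q - 1) * ((n : ℝ) ^ (q - 1) * ‖powVec H q (cell n k)‖ ^ 2) -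
          2 * ((n : ℝ) ^ (q - 1) * inner ℝ (powVec H q (cell n k)) (diagVec H q (cell n k))) +
          ‖diagVec H q (cell n k)‖ ^ 2 := by
        simp only [← real_inner_self_eq_norm_sq, inner_cellError]
        ring
    _ ≤ (n : ℝ) ^ (q - 1) * ((n : ℝ) ^ (q - 1) * (2 * H * (n : ℝ)⁻¹ ^ (2 * H)) ^ q) - 2 * 0 +
          (H * (2 * H - 1)) ^ q *
            (2 / (1 - q * (2 - 2 * H)) * (n : ℝ)⁻¹ ^ (2 - q * (2 - 2 * H))) := by
        gcongr
        positivity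
    _ = (n : ℝ)⁻¹ ^ (2 - q * (2 - 2 * H)) * nearConst H q := by
        rw [← pow_pred_mul_pow_pred_mul_rpow_pow hn hq, nearConst, mul_pow]
        ring

theorem covDensity_le_covDensity (hH : 1 / 2 < H) (hH1 : H < 1) {u v u' v' : ℝ} (hne : u ≠ v)
    (h : |u - v| ≤ |u' - v'|) : covDensity H u' v' ≤ covDensity H u v :=
  mul_le_mul_of_nonneg_left
    (Real.rpow_le_rpow_of_nonpos (abs_pos.2 (sub_ne_zero.2 hne)) h (by linarith))
    (mul_nonneg (by linarith) (by linarith))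

theorem covDensity_div_zero_pow {x y : ℝ} (hx : 0 ≤ x) (hy : 0 ≤ y) :
    covDensity H (x / y) 0 ^ q =
      (H * (2 * H - 1)) ^ q * (x ^ (-(q * (2 - 2 * H))) * y⁻¹ ^ (-(q * (2 - 2 * H)))) := by
  rw [covDensity_pow, sub_zero, abs_of_nonneg (div_nonneg hx hy), div_eq_mul_inv,
    Real.mul_rpow hx (inv_nonneg.2 hy)]

theorem covDensity_mem_Icc_of_mem_cell (hH : 1 / 2 < H) (hH1 : H < 1)
    (hkl : 2 ≤ Nat.dist k l) {u v : ℝ} (hu : u ∈ cell n k) (hv : v ∈ cell n l) :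
    covDensity H u v ∈ Icc (covDensity H (((Nat.dist k l : ℝ) + 1) / n) 0)
      (covDensity H (((Nat.dist k l : ℝ) - 1) / n) 0) := by
  have hn : (0 : ℝ) < n := by
    rcases n.eq_zero_or_pos with rfl | hn
    · simp [cell] at hu
    · exact Nat.cast_pos.2 hn
  have hkl' : (2 : ℝ) ≤ Nat.dist k l := by exact_mod_cast hkl
  have hpos : 0 < ((Nat.dist k l : ℝ) - 1) / n := div_pos (by linarith) hn
  obtain ⟨hlower, hupper⟩ := abs_sub_mem_Icc_of_mem_cell hu hv (by omega)
  refine ⟨covDensity_le_covDensity hH hH1 (sub_ne_zero.1 (abs_pos.1 (hpos.trans_le hlower))) ?_,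
    covDensity_le_covDensity hH hH1 hpos.ne' ?_⟩
  · exact hupper.trans (by rw [sub_zero]; exact le_abs_self _)
  · rwa [sub_zero, abs_of_pos hpos]

theorem inner_cellError_le (hH : 1 / 2 < H) (hH1 : H < 1) (hqH : q * (2 - 2 * H) < 1)
    (hq : q ≠ 0) (hk : k < n) (hl : l < n) :
    inner ℝ (cellError H q n k) (cellError H q n l) ≤ (n : ℝ)⁻¹ ^ (2 - q * (2 - 2 * H)) *
      gramBound (nearConst H q) (2 * (H * (2 * H - 1)) ^ q) (q * (2 - 2 * H)) (Nat.dist k l) := by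
  have hn : (0 : ℝ) < n := Nat.cast_pos.2 hk.pos
  rcases Nat.lt_or_ge 1 (Nat.dist k l) with hfar | hnear
  · have hfar' : (2 : ℝ) ≤ Nat.dist k l := by exact_mod_cast hfar
    refine (inner_cellError_le_of_covDensity_mem_Icc hH hH1 hqH hq hk hl (covDensity_nonneg hH _ _)
      (covDensity_nonneg hH _ _) fun u hu v hv =>
        covDensity_mem_Icc_of_mem_cell hH hH1 hfar hu hv).trans_eq ?_
    rw [gramBound_of_two_le hfar, covDensity_div_zero_pow (by linarith) hn.le,
      covDensity_div_zero_pow (by linarith) hn.le, sub_eq_add_neg 2 ((q : ℝ) * _),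
      Real.rpow_add (inv_pos.2 hn), Real.rpow_two]
    ring
  · rw [gramBound_of_le_one hnear]
    have hk_le := norm_cellError_sq_le hH hH1 hqH hq hk
    have hl_le := norm_cellError_sq_le hH hH1 hqH hq hl
    linarith [real_inner_le_norm (cellError H q n k) (cellError H q n l),
      two_mul_le_add_sq ‖cellError H q n k‖ ‖cellError H q n l‖]

theorem norm_sum_cellError_sq_le (hH : 1 / 2 < H) (hH1 : H < 1) (hqH : q * (2 - 2 * H) < 1)
    (hq : q ≠ 0) (hn : n ≠ 0) :
    ‖∑ k ∈ Finset.range n, cellError H q n k‖ ^ 2 ≤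
      2 * (2 * nearConst H q + 2 * (2 * (H * (2 * H - 1)) ^ q)) *
        (n : ℝ) ^ (2 * (q : ℝ) - 1 - 2 * q * H) := by
  have hn0 : (0 : ℝ) < n := Nat.cast_pos.2 (Nat.pos_of_ne_zero hn)
  have hβ : 0 ≤ (q : ℝ) * (2 - 2 * H) := mul_nonneg q.cast_nonneg (by linarith)
  have hD : 0 ≤ 2 * (H * (2 * H - 1)) ^ q :=
    mul_nonneg zero_le_two (pow_nonneg (mul_nonneg (by linarith) (by linarith)) _)
  have hC := nearConst_nonneg hH hqH
  have hexp : (n : ℝ) * (n : ℝ)⁻¹ ^ (2 - q * (2 - 2 * H)) =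
      (n : ℝ) ^ (2 * (q : ℝ) - 1 - 2 * q * H) := by
    rw [Real.inv_rpow hn0.le, ← Real.rpow_neg hn0.le, ← Real.rpow_one_add' hn0.le (by linarith)]
    ring_nf
  refine (norm_sum_sq_le_of_inner_le
    (fun m => mul_nonneg (Real.rpow_nonneg (inv_nonneg.2 hn0.le) _) (gramBound_nonneg hC hD hβ m))
    fun k hk l hl => inner_cellError_le hH hH1 hqH hq hk hl).trans ?_
  rw [← Finset.mul_sum, ← hexp]
  calc (n : ℝ) * (2 * ((n : ℝ)⁻¹ ^ (2 - q * (2 - 2 * H)) * ∑ m ∈ Finset.range n,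
        gramBound (nearConst H q) (2 * (H * (2 * H - 1)) ^ q) (q * (2 - 2 * H)) m))
      ≤ (n : ℝ) * (2 * ((n : ℝ)⁻¹ ^ (2 - q * (2 - 2 * H)) *
        (2 * nearConst H q + 2 * (2 * (H * (2 * H - 1)) ^ q)))) := by
        gcongr
        exact sum_gramBound_le hC hD hβ n
    _ = _ := by ring

end CellError

section HermiteKernel

variable {H : ℝ} {q : ℕ} {A A' : Set ℝ}

theorem toReal_diagInt (H : ℝ) (q : ℕ) (A : Set ℝ) (y : Fin q → ℝ) :
    (diagInt H q A y).toReal = ∫ u in A, ∏ i, dK H u (y i) := by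
  rw [integral_eq_lintegral_of_nonneg_ae, diagInt]
  · simp_rw [ENNReal.ofReal_prod_of_nonneg fun i _ => dK_nonneg H _ (y i)]
  · exact ae_of_all _ fun u => Finset.prod_nonneg fun i _ => dK_nonneg _ _ _
  · refine (Finset.measurable_fun_prod _ fun i _ => ?_).aestronglyMeasurable
    exact (measurable_dK H).comp (f := fun u => (u, y i)) (by fun_prop)

theorem hermiteKernel_ae_eq (hH : 1 / 2 < H) (hq : q ≠ 0) :
    hermiteKernel H q =ᵐ[cubeMeasure q] fun y => (diagInt H q (Ioc 0 1) y).toReal := by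
  have : Nonempty (Fin q) := Fin.pos_iff_nonempty.1 (Nat.pos_of_ne_zero hq)
  filter_upwards [ae_cubeMeasure_of_ae_unitMeasure ae_unitMeasure_mem] with y hy
  obtain ⟨j, hj⟩ := exists_eq_ciSup_of_finite (f := y)
  have hle : ∀ i, y i ≤ ⨆ i, y i := fun i => le_ciSup (finite_range y).bddAbove i
  rw [hermiteKernel, indicator_of_mem (by exact fun i => Ioc_subset_Icc_self (hy i)),
    toReal_diagInt, intervalIntegral.integral_of_le (hj ▸ (hy j).2),
    setIntegral_eq_of_subset_of_forall_sdiff_eq_zero (s := Ioc (⨆ i, y i) 1) (t := Ioc 0 1)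
      measurableSet_Ioc (Ioc_subset_Ioc_left (hj ▸ (hy j).1.le))]
  · refine setIntegral_congr_fun measurableSet_Ioc fun u hu => ?_
    exact Finset.prod_congr rfl fun i _ => derivK_eq_dK hH (hy i).1 ((hle i).trans_lt hu.1).ne'
  · intro u hu
    have hus : u ≤ ⨆ i, y i := not_lt.1 fun h => hu.2 ⟨h, hu.1.2⟩
    exact Finset.prod_eq_zero (Finset.mem_univ j) (dK_of_le (hj ▸ hus))

theorem memLp_hermiteKernel (hH : 1 / 2 < H) (hH1 : H < 1) (hqH : q * (2 - 2 * H) < 1)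
    (hq : q ≠ 0) : MemLp (hermiteKernel H q) 2 (cubeMeasure q) :=
  (memLp_diagInt hH hH1 hqH measurableSet_Ioc subset_rfl).ae_eq (hermiteKernel_ae_eq hH hq).symm

theorem toL2_hermiteKernel (hH : 1 / 2 < H) (hq : q ≠ 0) :
    toL2 (cubeMeasure q) (hermiteKernel H q) = diagVec H q (Ioc 0 1) :=
  toL2_congr (hermiteKernel_ae_eq hH hq)

theorem diagVec_empty (H : ℝ) (q : ℕ) : diagVec H q ∅ = 0 := by
  simp only [diagVec, diagInt, Measure.restrict_empty, lintegral_zero_measure,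
    ENNReal.toReal_zero]
  rw [toL2, dif_pos MemLp.zero']
  rfl

theorem diagVec_union (hH : 1 / 2 < H) (hH1 : H < 1) (hqH : q * (2 - 2 * H) < 1)
    (hA : MeasurableSet A) (hA' : MeasurableSet A') (hA1 : A ⊆ Ioc 0 1) (hA1' : A' ⊆ Ioc 0 1)
    (hdisj : Disjoint A A') : diagVec H q (A ∪ A') = diagVec H q A + diagVec H q A' := by
  have hfin {D : Set ℝ} (hD : MeasurableSet D) (hD1 : D ⊆ Ioc 0 1) :
      ∀ᵐ y ∂cubeMeasure q, diagInt H q D y < ∞ :=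
    ae_lt_top_of_lintegral_mul_self (measurable_diagInt _ _ _).aemeasurable
      (lintegral_diagInt_sq_ne_top hH hH1 hqH hD hD1)
  refine Lp.ext ?_
  filter_upwards [Lp.coeFn_add (diagVec H q A) (diagVec H q A'),
    coeFn_toL2 (memLp_diagInt hH hH1 hqH hA hA1), coeFn_toL2 (memLp_diagInt hH hH1 hqH hA' hA1'),
    coeFn_toL2 (memLp_diagInt hH hH1 hqH (hA.union hA') (union_subset hA1 hA1')),
    hfin hA hA1, hfin hA' hA1'] with y hadd hy hy' hunion hlt hlt'
  rw [hadd, Pi.add_apply, diagVec, diagVec, diagVec, hy, hy', hunion,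
    ← ENNReal.toReal_add hlt.ne hlt'.ne]
  simp only [diagInt, lintegral_union hA' hdisj]

theorem sum_range_diagVec_cell (hH : 1 / 2 < H) (hH1 : H < 1) (hqH : q * (2 - 2 * H) < 1)
    {n m : ℕ} (hm : m ≤ n) :
    ∑ k ∈ Finset.range m, diagVec H q (cell n k) = diagVec H q (Ioc 0 ((m : ℝ) / n)) := by
  induction m with
  | zero => rw [Finset.range_zero, Finset.sum_empty, Nat.cast_zero, zero_div, Ioc_self,
      diagVec_empty]
  | succ m ih =>
    have hinit : Ioc 0 ((m : ℝ) / n) ⊆ Ioc 0 1 :=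
      Ioc_subset_Ioc_right (div_le_one_of_le₀ (by exact_mod_cast (by omega)) (by positivity))
    rw [Finset.sum_range_succ, ih (by omega), ← diagVec_union hH hH1 hqH measurableSet_Ioc
      (measurableSet_cell n m) hinit (cell_subset hm) (Ioc_disjoint_Ioc_of_le le_rfl), cell,
      Ioc_union_Ioc_eq_Ioc (by positivity) (cell_left_le_right n m), Nat.cast_succ]

theorem sum_cellError (hH : 1 / 2 < H) (hH1 : H < 1) (hqH : q * (2 - 2 * H) < 1) (hq : q ≠ 0)
    {n : ℕ} (hn : n ≠ 0) :
    ∑ k ∈ Finset.range n, cellError H q n k =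
      ∑ k ∈ Finset.range n, (n : ℝ) ^ (q - 1) • powVec H q (cell n k) -
        toL2 (cubeMeasure q) (hermiteKernel H q) := by
  rw [toL2_hermiteKernel hH hq, ← div_self (Nat.cast_ne_zero.2 hn : (n : ℝ) ≠ 0),
    ← sum_range_diagVec_cell hH hH1 hqH le_rfl, ← Finset.sum_sub_distrib]
  rfl

end HermiteKernel

section Increments

variable {H : Ioo (0 : ℝ) 1} {q n k : ℕ}

/-- The indicator of `[k/n,(k+1)/n]` in the Hilbert space of fractional Brownian motion. -/
def incr (H : Ioo (0 : ℝ) 1) (n k : ℕ) : FBMSpace H :=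
  ind H (projIcc 0 1 zero_le_one (((k : ℝ) + 1) / n)) -
    ind H (projIcc 0 1 zero_le_one ((k : ℝ) / n))

theorem kernelSeq_eq (H : Ioo (0 : ℝ) 1) (q n : ℕ) :
    kernelSeq H q n = (n : ℝ) ^ (q - 1) • ∑ k ∈ Finset.range n, tpow q (incr H n k) := rfl

theorem kernelSeq_mem (H : Ioo (0 : ℝ) 1) (q n : ℕ) :
    kernelSeq H q n ∈ symTensorPower (FBMSpace H) q :=
  Submodule.smul_mem _ _ (Submodule.sum_mem _ fun _ _ => mem_closedSpan _ _)

theorem coe_projIcc_of_mem {x : ℝ} (hx : x ∈ Icc (0 : ℝ) 1) :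
    (projIcc (0 : ℝ) 1 zero_le_one x : ℝ) = x := by
  rw [projIcc_of_mem _ hx]

theorem div_mem_Icc (hk : k ≤ n) : (k : ℝ) / n ∈ Icc (0 : ℝ) 1 :=
  ⟨by positivity, div_le_one_of_le₀ (by exact_mod_cast hk) (by positivity)⟩

theorem succ_div_mem_Icc (hk : k < n) : ((k : ℝ) + 1) / n ∈ Icc (0 : ℝ) 1 := by
  exact_mod_cast div_mem_Icc (Nat.succ_le_of_lt hk)

theorem norm_ind_sub_ind_sq (s t : Icc (0 : ℝ) 1) :
    ‖ind H t - ind H s‖ ^ 2 = |(t : ℝ) - s| ^ (2 * (H : ℝ)) := by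
  have hzero : (0 : ℝ) ^ (2 * (H : ℝ)) = 0 := Real.zero_rpow (by linarith [H.2.1])
  rw [norm_sub_sq_real, ← real_inner_self_eq_norm_sq, ← real_inner_self_eq_norm_sq, inner_ind,
    inner_ind, inner_ind, fbmCov, fbmCov, fbmCov, sub_self, sub_self, abs_zero, hzero,
    abs_sub_comm]
  ring

theorem norm_incr (hk : k < n) : ‖incr H n k‖ = ((n : ℝ) ^ (H : ℝ))⁻¹ := by
  have hn : (0 : ℝ) < n := Nat.cast_pos.2 hk.pos
  rw [← sq_eq_sq₀ (norm_nonneg _) (by positivity), incr, norm_ind_sub_ind_sq,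
    coe_projIcc_of_mem (succ_div_mem_Icc hk), coe_projIcc_of_mem (div_mem_Icc hk.le), cell_width,
    abs_of_pos (by positivity), Real.inv_rpow hn.le, inv_pow, mul_comm, Real.rpow_mul hn.le,
    Real.rpow_two]

theorem Kstar_incr (hH : 1 / 2 < (H : ℝ)) (hk : k < n) :
    Kstar H (incr H n k) =ᵐ[unitMeasure] fun y => (kernelInt H (cell n k) y).toReal := by
  have hleft := div_mem_Icc hk.le
  have hright := succ_div_mem_Icc hk
  rw [incr, map_sub]
  filter_upwards [Lp.coeFn_sub (Kstar H (ind H (projIcc 0 1 zero_le_one (((k : ℝ) + 1) / n))))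
    (Kstar H (ind H (projIcc 0 1 zero_le_one ((k : ℝ) / n)))), Kstar_ind hH _, Kstar_ind hH _,
    ae_unitMeasure_mem] with y hsub hyr hyl hy
  rw [hsub, Pi.sub_apply, hyr, hyl, coe_projIcc_of_mem hright, coe_projIcc_of_mem hleft, cell,
    toReal_kernelInt_Ioc hright.1, toReal_kernelInt_Ioc hleft.1,
    toReal_kernelInt_Ioc (cell_left_le_right n k),
    intervalIntegral.integral_interval_sub_left] <;>
  exact intervalIntegrable_dK hH hy.1 _ _

theorem powL2_Kstar_incr (hH : 1 / 2 < (H : ℝ)) (hk : k < n) :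
    powL2 q (Kstar H (incr H n k)) = powVec H q (cell n k) := by
  refine toL2_congr ?_
  filter_upwards [ae_cubeMeasure_of_ae_unitMeasure (Kstar_incr hH hk)] with y hy
  simp only [powInt, ENNReal.toReal_prod, hy]

end Increments

section Transfer

variable {H : Ioo (0 : ℝ) 1} {q : ℕ}

/-- The map `h^{⊗q} ↦ (K_H^* h)^{⊗q}`, isometric on symmetric tensors. It carries `I_q` to
`I_q^W`. -/
def transfer (H : Ioo (0 : ℝ) 1) (q : ℕ) :
    TensorPower (FBMSpace H) q →L[ℝ] Lp ℝ 2 (cubeMeasure q) :=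
  extension (tpow q) fun h => powL2 q (Kstar H h)

theorem transfer_tpow (hH : 1 / 2 < (H : ℝ)) (h : FBMSpace H) :
    transfer H q (tpow q h) = powL2 q (Kstar H h) :=
  ((isTensorPow_tpow q).isExtension ((isTensorPow_powL2 q).comp (inner_Kstar hH))).1 h

theorem norm_transfer (hH : 1 / 2 < (H : ℝ)) {x : TensorPower (FBMSpace H) q}
    (hx : x ∈ symTensorPower (FBMSpace H) q) : ‖transfer H q x‖ = ‖x‖ :=
  (isTensorPow_tpow q).norm_extension ((isTensorPow_powL2 q).comp (inner_Kstar hH)) hx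

theorem transfer_kernelSeq_sub (hH : 1 / 2 < (H : ℝ)) (hqH : q * (2 - 2 * (H : ℝ)) < 1)
    (hq : q ≠ 0) {n : ℕ} (hn : n ≠ 0) :
    transfer H q (kernelSeq H q n) - toL2 (cubeMeasure q) (hermiteKernel H q) =
      ∑ k ∈ Finset.range n, cellError H q n k := by
  rw [sum_cellError hH H.2.2 hqH hq hn, kernelSeq_eq, map_smul, map_sum, Finset.smul_sum]
  congr 1
  refine Finset.sum_congr rfl fun k hk => ?_
  rw [transfer_tpow hH, powL2_Kstar_incr hH (Finset.mem_range.1 hk)]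

theorem isBigO_norm_transfer_kernelSeq_sub_sq (hH : 1 / 2 < (H : ℝ))
    (hqH : q * (2 - 2 * (H : ℝ)) < 1) (hq : q ≠ 0) :
    (fun n => ‖transfer H q (kernelSeq H q n) - toL2 (cubeMeasure q) (hermiteKernel H q)‖ ^ 2)
      =O[atTop] fun n : ℕ => (n : ℝ) ^ (2 * (q : ℝ) - 1 - 2 * q * H) := by
  refine IsBigO.of_bound (2 * (2 * nearConst H q + 2 * (2 * (H * (2 * H - 1)) ^ q)))
    ((eventually_ne_atTop 0).mono fun n hn => ?_)
  rw [transfer_kernelSeq_sub hH hqH hq hn, Real.norm_of_nonneg (by positivity),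
    Real.norm_of_nonneg (by positivity)]
  exact norm_sum_cellError_sq_le hH H.2.2 hqH hq hn

theorem tendsto_transfer_kernelSeq (hH : 1 / 2 < (H : ℝ)) (hqH : q * (2 - 2 * (H : ℝ)) < 1)
    (hq : q ≠ 0) :
    Tendsto (fun n => transfer H q (kernelSeq H q n)) atTop
      (𝓝 (toL2 (cubeMeasure q) (hermiteKernel H q))) := by
  have hrate : Tendsto (fun n : ℕ => (n : ℝ) ^ (2 * (q : ℝ) - 1 - 2 * q * H)) atTop (𝓝 0) := by
    rw [← neg_neg (2 * (q : ℝ) - 1 - 2 * q * H)]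
    exact (tendsto_rpow_neg_atTop (by linarith)).comp tendsto_natCast_atTop_atTop
  rw [tendsto_iff_norm_sub_tendsto_zero]
  simpa using ((isBigO_norm_transfer_kernelSeq_sub_sq hH hqH hq).trans_tendsto hrate).sqrt

theorem exists_tendsto_of_tendsto_map {E F : Type*} [NormedAddCommGroup E] [NormedSpace ℝ E]
    [CompleteSpace E] [NormedAddCommGroup F] [NormedSpace ℝ F] {V : Submodule ℝ E}
    (hV : IsClosed (V : Set E)) {T : E →L[ℝ] F} (hT : ∀ x ∈ V, ‖T x‖ = ‖x‖) {x : ℕ → E}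
    (hx : ∀ n, x n ∈ V) {y : F} (hy : Tendsto (fun n => T (x n)) atTop (𝓝 y)) :
    ∃ z ∈ V, Tendsto x atTop (𝓝 z) ∧ T z = y := by
  have hdist : ∀ m n, dist (x m) (x n) = dist (T (x m)) (T (x n)) := fun m n => by
    rw [dist_eq_norm, dist_eq_norm, ← map_sub, hT _ (V.sub_mem (hx m) (hx n))]
  have hcauchy : CauchySeq x := by
    simpa only [Metric.cauchySeq_iff, hdist] using hy.cauchySeq
  obtain ⟨z, hz⟩ := cauchySeq_tendsto_of_complete hcauchy
  exact ⟨z, hV.mem_of_tendsto hz (Eventually.of_forall hx), hz,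
    tendsto_nhds_unique ((T.continuous.tendsto z).comp hz) hy⟩

theorem exists_tendsto_kernelSeq (hH : 1 / 2 < (H : ℝ)) (hqH : q * (2 - 2 * (H : ℝ)) < 1)
    (hq : q ≠ 0) :
    ∃ f ∈ symTensorPower (FBMSpace H) q, Tendsto (kernelSeq H q) atTop (𝓝 f) ∧
      transfer H q f = toL2 (cubeMeasure q) (hermiteKernel H q) :=
  exists_tendsto_of_tendsto_map (Submodule.isClosed_topologicalClosure _)
    (fun _ => norm_transfer hH) (kernelSeq_mem H q) (tendsto_transfer_kernelSeq hH hqH hq)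

theorem isBigO_symNorm_kernelSeq_sub_sq (hH : 1 / 2 < (H : ℝ)) (hqH : q * (2 - 2 * (H : ℝ)) < 1)
    (hq : q ≠ 0) {f : TensorPower (FBMSpace H) q} (hf : f ∈ symTensorPower (FBMSpace H) q)
    (hfL : transfer H q f = toL2 (cubeMeasure q) (hermiteKernel H q)) :
    (fun n => symNorm q (kernelSeq H q n - f) ^ 2) =O[atTop]
      fun n : ℕ => (n : ℝ) ^ (2 * (q : ℝ) - 1 - 2 * q * H) := by
  refine ((isBigO_norm_transfer_kernelSeq_sub_sq hH hqH hq).const_mul_left q.factorial).congr_left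
    fun n => ?_
  rw [← hfL, ← map_sub, norm_transfer hH (Submodule.sub_mem _ (kernelSeq_mem H q n) hf), symNorm,
    mul_pow, Real.sq_sqrt (by positivity)]

end Transfer

section Integrals

variable {Ω : Type*} {mΩ : MeasurableSpace Ω} {P : Measure Ω} {H : Ioo (0 : ℝ) 1}
  {B : ℝ≥0 → Ω → ℝ} {q n k : ℕ}

theorem mul_two_sub_lt_one_of_lt {H : ℝ} (hq : q ≠ 0) (hH : 1 - 1 / (2 * (q : ℝ)) < H) :
    q * (2 - 2 * H) < 1 := by
  have hlt : 1 - H < 1 / (2 * q) := by linarith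
  rw [lt_div_iff₀ (by positivity)] at hlt
  linarith

namespace IsFBM

theorem isonormal_incr (hB : IsFBM H B P) (hk : k < n) :
    isonormal H P B (incr H n k) =ᵐ[P]
      fun ω => B (((k : ℝ≥0) + 1) / n) ω - B ((k : ℝ≥0) / n) ω := by
  have hright : unitInterval.toNNReal (projIcc 0 1 zero_le_one (((k : ℝ) + 1) / n)) =
      ((k : ℝ≥0) + 1) / n := by
    ext
    rw [unitInterval.coe_toNNReal, coe_projIcc_of_mem (succ_div_mem_Icc hk)]
    norm_cast
  have hleft : unitInterval.toNNReal (projIcc 0 1 zero_le_one ((k : ℝ) / n)) = (k : ℝ≥0) / n := by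
    ext
    rw [unitInterval.coe_toNNReal, coe_projIcc_of_mem (div_mem_Icc hk.le)]
    norm_cast
  rw [incr, map_sub]
  filter_upwards [Lp.coeFn_sub
      (isonormal H P B (ind H (projIcc 0 1 zero_le_one (((k : ℝ) + 1) / n))))
      (isonormal H P B (ind H (projIcc 0 1 zero_le_one ((k : ℝ) / n)))),
    hB.isonormal_ind _, hB.isonormal_ind _] with ω hsub hωr hωl
  rw [hsub, Pi.sub_apply, hωr, hωl, hright, hleft]

variable [IsProbabilityMeasure P]

theorem fbmIntegral_eq_wienerMultipleIntegral_transfer (hB : IsFBM H B P) (hH : 1 / 2 < (H : ℝ))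
    (hq : q ≠ 0) {f : TensorPower (FBMSpace H) q} (hf : f ∈ symTensorPower (FBMSpace H) q) :
    fbmIntegral H q P B f = wienerMultipleIntegral H q P B (transfer H q f) :=
  (hB.isIsonormal.multipleIntegral_extension (hB.isIsonormal_wienerIntegral hH)
    (isTensorPow_tpow q) (isTensorPow_powL2 q) hq (inner_Kstar hH) (wienerIntegral_Kstar hH)
    hf).symm

theorem fbmIntegral_tpow_incr (hB : IsFBM H B P) (hq : q ≠ 0) (hk : k < n) :
    fbmIntegral H q P B (tpow q (incr H n k)) =ᵐ[P] fun ω => ((n : ℝ) ^ (H : ℝ))⁻¹ ^ q *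
      hermiteFun q ((n : ℝ) ^ (H : ℝ) * (B (((k : ℝ≥0) + 1) / n) ω - B ((k : ℝ≥0) / n) ω)) := by
  filter_upwards [hB.isIsonormal.multipleIntegral_pow (isTensorPow_tpow q) hq (incr H n k),
    hB.isonormal_incr hk] with ω hpow hincr
  rw [fbmIntegral, hpow, hincr, norm_incr hk, inv_inv]

theorem S_ae_eq (hB : IsFBM H B P) (hq : q ≠ 0) (hn : 1 ≤ n) :
    S H q B n =ᵐ[P] fbmIntegral H q P B (kernelSeq H q n) := by
  have hn0 : (0 : ℝ) < n := Nat.cast_pos.2 hn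
  have hscale : (n : ℝ) ^ (q - 1) * ((n : ℝ) ^ (H : ℝ))⁻¹ ^ q =
      (n : ℝ) ^ (q * (1 - H) - 1 : ℝ) := by
    rw [← Real.rpow_natCast, ← Real.rpow_natCast, ← Real.rpow_neg hn0.le, ← Real.rpow_mul hn0.le,
      ← Real.rpow_add hn0, Nat.cast_pred (Nat.pos_of_ne_zero hq)]
    congr 1
    ring
  have hterm := (Finset.eventually_all _).2 fun k (hk : k ∈ Finset.range n) =>
    hB.fbmIntegral_tpow_incr hq (Finset.mem_range.1 hk)
  rw [kernelSeq_eq, map_smul, map_sum]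
  filter_upwards [hterm, Lp.coeFn_smul ((n : ℝ) ^ (q - 1))
      (∑ k ∈ Finset.range n, fbmIntegral H q P B (tpow q (incr H n k))),
    Lp.coeFn_finsetSum (Finset.range n) fun k => fbmIntegral H q P B (tpow q (incr H n k))]
    with ω hterm hsmul hsum
  rw [hsmul, Pi.smul_apply, hsum, Finset.sum_apply, Finset.sum_congr rfl hterm, ← Finset.mul_sum,
    smul_eq_mul, ← mul_assoc, hscale, S]

theorem integral_fbmIntegral_sub_sq (hB : IsFBM H B P) (hq : q ≠ 0)
    {f g : TensorPower (FBMSpace H) q} (hf : f ∈ symTensorPower (FBMSpace H) q)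
    (hg : g ∈ symTensorPower (FBMSpace H) q) :
    ∫ ω, |fbmIntegral H q P B f ω - fbmIntegral H q P B g ω| ^ 2 ∂P = symNorm q (f - g) ^ 2 := by
  rw [symNorm, mul_pow, Real.sq_sqrt (by positivity)]
  exact hB.isIsonormal.integral_sq_multipleIntegral_sub (isTensorPow_tpow q) hq hf hg

end IsFBM

end Integrals

end

end FBM

theorem proposition3p1 {Ω : Type*} [MeasurableSpace Ω] (P : Measure Ω) [IsProbabilityMeasure P]
    (q : ℕ) (hq : 2 ≤ q) (H : Ioo (0 : ℝ) 1) (hH : 1 - 1 / (2 * (q : ℝ)) < (H : ℝ))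
    (B : ℝ≥0 → Ω → ℝ) (hB : FBM.IsFBM H B P) :
    -- the multiple integrals with respect to `B` and `W` and the kernel `L_1` are well defined
    FBM.IsMultipleIntegral q (FBM.tpow q) (FBM.isonormal H P B) (FBM.fbmIntegral H q P B) ∧
    FBM.IsMultipleIntegral q (FBM.powL2 q) (FBM.wienerIntegral H P B)
      (FBM.wienerMultipleIntegral H q P B) ∧
    MemLp (FBM.hermiteKernel H q) 2 (FBM.cubeMeasure q) ∧
    -- `S_n = I_q(f_n)` is a copy of `Z_n`
    (∀ n : ℕ, 1 ≤ n →
      FBM.kernelSeq H q n ∈ FBM.symTensorPower (FBM.FBMSpace H) q ∧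
      FBM.S H q B n =ᵐ[P] FBM.fbmIntegral H q P B (FBM.kernelSeq H q n) ∧
      IdentDistrib (FBM.S H q B n) (FBM.hermiteVariation H q B n) P P) ∧
    -- `f_n` converges, and the rate of convergence
    ∃ f ∈ FBM.symTensorPower (FBM.FBMSpace H) q,
      Tendsto (FBM.kernelSeq H q) atTop (𝓝 f) ∧
      FBM.hermiteRV H q P B = FBM.fbmIntegral H q P B f ∧
      (∀ n : ℕ, 1 ≤ n →
        ∫ ω, |FBM.S H q B n ω - FBM.hermiteRV H q P B ω| ^ 2 ∂P =
          ∫ ω, |FBM.fbmIntegral H q P B (FBM.kernelSeq H q n) ω -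
            FBM.fbmIntegral H q P B f ω| ^ 2 ∂P ∧
        ∫ ω, |FBM.fbmIntegral H q P B (FBM.kernelSeq H q n) ω -
            FBM.fbmIntegral H q P B f ω| ^ 2 ∂P =
          FBM.symNorm q (FBM.kernelSeq H q n - f) ^ 2) ∧
      (fun n : ℕ => FBM.symNorm q (FBM.kernelSeq H q n - f) ^ 2) =O[atTop]
        fun n : ℕ => (n : ℝ) ^ (2 * (q : ℝ) - 1 - 2 * (q : ℝ) * (H : ℝ)) := by
  have hq0 : q ≠ 0 := by omega
  have hqH : q * (2 - 2 * (H : ℝ)) < 1 := FBM.mul_two_sub_lt_one_of_lt hq0 hH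
  have hH2 : 1 / 2 < (H : ℝ) := by
    have hq2 : (2 : ℝ) ≤ q := by exact_mod_cast hq
    nlinarith [H.2.2]
  obtain ⟨f, hf, hlim, hfL⟩ := FBM.exists_tendsto_kernelSeq hH2 hqH hq0
  have hZ : FBM.hermiteRV H q P B = FBM.fbmIntegral H q P B f := by
    rw [hB.fbmIntegral_eq_wienerMultipleIntegral_transfer hH2 hq0 hf, hfL, FBM.hermiteRV]
  have hS {n : ℕ} (hn : 1 ≤ n) := hB.S_ae_eq hq0 hn
  refine ⟨hB.isIsonormal.isMultipleIntegral (FBM.isTensorPow_tpow q),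
    (hB.isIsonormal_wienerIntegral hH2).isMultipleIntegral (FBM.isTensorPow_powL2 q),
    FBM.memLp_hermiteKernel hH2 H.2.2 hqH hq0,
    fun n hn => ⟨FBM.kernelSeq_mem H q n, hS hn, hB.identDistrib_hermiteVariation q hn⟩,
    f, hf, hlim, hZ,
    fun n hn => ⟨?_, hB.integral_fbmIntegral_sub_sq hq0 (FBM.kernelSeq_mem H q n) hf⟩,
    FBM.isBigO_symNorm_kernelSeq_sub_sq hH2 hqH hq0 hf hfL⟩
  refine integral_congr_ae ?_
  filter_upwards [hS hn] with ω hω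
  rw [hω, hZ]
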